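/- **Setting.** Fix a number of stocks $n>0$; a non-increasing demand curve $\mu:[0,\infty)\to(0,1)$, continuously differentiable on $(0,\infty)$; for each value $m=\mu(S)$, $S\ge 0$, a probability law $\Phi(m,\cdot)$ of a variable $\xi$ on $[-z,z]$, $z=\min\{m,1-m\}$, with zero mean and variance $\zeta^2=\zeta(m)^2$ ($\zeta$ continuous on the range of $\mu$, e.g. constant); and a real random variable $Y$ with zero mean and unit variance. For $r>0$, $\sigma,D\ge0$ let $\Theta_\sigma$ be the law of $\eta=\sigma Y$. Let $\mathcal M_p$ be the set of Borel probability measures on $[0,\infty)$ with finite moment of order $p$, and for $p>2$ let $\mathcal F_p$ be the set of functions $\phi$ on $[0,\infty)$ with $\phi(0)=\phi'(0)=0$ which are $C^m$ with $\phi^{(m)}$ Hölder continuous of order $\delta'$, where $p=m+\delta'$, $m\in\mathbb N$, $0<\delta'\le1$. A curve $f:[0,\infty)\to\mathcal M_p$ is called $C^1$ if $t\mapsto\int\phi\,df_t$ is $C^1$ on $[0,\infty)$ for all $\phi\in\mathcal F_p$; it has initial datum $f_0$ if $\lim_{t\downarrow0}\int\phi\,df_t=\int\phi\,df_0$ for all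 $\phi\in\mathcal F_p$. The price $S>0$ associated with a wealth distribution $f$ is given by $S=\frac1n\mu(S)\int w\,df(w)$. With $$w'=(1-\gamma)w(1+r)+\gamma w\Big(1+\frac{S'-S+D+\eta}{S}\Big),\qquad \gamma=\mu(S)+\xi,$$ the future price $S'\ge0$ is given by $S'=\frac1n\mu(S')E[w']$, where $w\sim f$, $\xi\sim\Phi(\mu(S),\cdot)$, $\eta\sim\Theta_\sigma$ are independent. A weak solution of the Boltzmann-type kinetic equation with parameters $(r,\sigma,D)$ and initial datum $f_0\in\mathcal M_p$ is a $C^1$ curve $f:[0,\infty)\to\mathcal M_p$ with initial datum $f_0$, having at each time $t\ge0$ prices $S(t)>0$, $S'(t)\ge0$ as above, such that $\Theta_\sigma$ is supported in some $[-d,d]$ with $0<d\le S'(t)+D$ for all $t$ (so that $w'\ge0$), and for all $\phi\in\mathcal F_p$, $t>0$, $$\frac{d}{dt}\int\phi\,df_t=\int\!\!\int\!\!\int\big(\phi(w')-\phi(w)\big)\,\Theta_\sigma(d\eta)\,\Phi(\mu(S(t)),d\xi)\,f_t(dw).$$ **Theorem.** Let $p=2+\delta$ with $\delta>0$, $f_0\in\mathcal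 M_p$, $\nu,\lambda\ge0$. Let $r_k>0$, $r_k\to0$, $\sigma_k\ge 0$ with $\sigma_k^2=\nu r_k$, $D_k=\lambda r_k$, and let $f_k$ be weak solutions of the kinetic equation with parameters $(r_k,\sigma_k,D_k)$ and the same initial datum $f_0$. Then there are a subsequence $(k_j)$ and probability measures $\tilde f_\tau\in\mathcal M_p$, $\tau\ge0$, such that, for every $\tau\ge0$, $f_{k_j}(\tau/r_{k_j})\to\tilde f_\tau$ weakly as $j\to\infty$; if $f_0$ has a density, then so has every $\tilde f_\tau$. Each $\tilde f_\tau$ has a price $\tilde S=\tilde S(\tau)>0$, $\tilde S=\frac1n\mu(\tilde S)\int w\,d\tilde f_\tau(w)$, and $\tilde f$ is a weak solution with initial datum $f_0$ of $$\partial_\tau\tilde f+A(\tau)\,\partial_w(w\tilde f)=\tfrac12B(\tau)\,\partial_w^2(w^2\tilde f),$$ that is, $\tilde f$ is a $C^1$ curve in $\mathcal M_p$ with initial datum $f_0$ and, for all $\phi\in\mathcal F_p$, $\tau>0$, $$\frac{d}{d\tau}\int\phi\,d\tilde f_\tau=A(\tau)\int w\phi'(w)\,d\tilde f_\tau(w)+\tfrac12B(\tau)\int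 w^2\phi''(w)\,d\tilde f_\tau(w).$$ Here, with $\tilde S=\tilde S(\tau)$, $$A(\tau)=1+\mu(\tilde S)\Big((\kappa(\tilde S)-1)+\frac{\mu(\tilde S)(\kappa(\tilde S)-1)+1}{1-\mu(\tilde S)}\,\frac{\lambda}{\tilde S}\Big),\qquad B(\tau)=\frac{\mu(\tilde S)^2+\zeta(\mu(\tilde S))^2}{\tilde S^2}\,\nu,$$ $$\kappa(S)=\frac{\mu(S)(1-\mu(S))}{\mu(S)(1-\mu(S))-S\mu'(S)}.$$ -/

import Mathlib

open MeasureTheory Filter Topology Set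
open scoped NNReal

noncomputable section

/-- The fixed data of the market: the number of stocks `n`, the optimal demand curve `μ`,
the law `Φ m` of the deviation `ξ` of an investor around the optimal fraction `m`
(centred, with variance `ζ m ^ 2`, with values in `[-z, z]`, `z = min m (1 - m)`),
and the centred, unit variance law `Y` from which the law of the noise on the return is
obtained by scaling. Only the values `m = μ S` with `0 ≤ S` matter. -/
structure Market where
  n : ℝ
  n_pos : 0 < n
  μ : ℝ → ℝ
  μ_antitone : AntitoneOn μ (Ici 0)
  μ_pos : ∀ S, 0 ≤ S → 0 < μ S
  μ_zero_lt_one : μ 0 < 1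
  μ_contDiff : ContDiffOn ℝ 1 μ (Ioi 0)
  Φ : ℝ → ProbabilityMeasure ℝ
  ζ : ℝ → ℝ
  Φ_support : ∀ S, 0 ≤ S → ∀ᵐ ξ ∂(Φ (μ S) : Measure ℝ), |ξ| ≤ min (μ S) (1 - μ S)
  Φ_mean : ∀ S, 0 ≤ S → ∫ ξ, ξ ∂(Φ (μ S) : Measure ℝ) = 0
  Φ_variance : ∀ S, 0 ≤ S → ∫ ξ, ξ ^ 2 ∂(Φ (μ S) : Measure ℝ) = ζ (μ S) ^ 2
  ζ_continuous : ContinuousOn ζ (μ '' Ici 0)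
  Y : ProbabilityMeasure ℝ
  Y_mean : ∫ y, y ∂(Y : Measure ℝ) = 0
  Y_variance : ∫ y, y ^ 2 ∂(Y : Measure ℝ) = 1

/-- Finiteness of the moment of order `p` of a probability measure on `[0, ∞)`. -/
def HasMoment (p : ℝ) (f : ProbabilityMeasure ℝ≥0) : Prop :=
  Integrable (fun w : ℝ≥0 => (w : ℝ) ^ p) (f : Measure ℝ≥0)

/-- `f` has a probability density, i.e. it is absolutely continuous with respect to Lebesgue
measure. -/
def HasDensity (f : ProbabilityMeasure ℝ≥0) : Prop :=
  (f : Measure ℝ≥0).map (fun w : ℝ≥0 => (w : ℝ)) ≪ volume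

/-- The class of test functions on `[0, ∞)`: `φ 0 = φ' 0 = 0`, and the derivative of order `m`
of `φ` is Hölder continuous of order `δ`, where `m + δ = p` with `m` an integer and
`0 < δ ≤ 1`. -/
def IsTestFunction (p : ℝ) (φ : ℝ → ℝ) : Prop :=
  φ 0 = 0 ∧ derivWithin φ (Ici 0) 0 = 0 ∧
    ∃ (m : ℕ) (δ : ℝ), 0 < δ ∧ δ ≤ 1 ∧ (m : ℝ) + δ = p ∧ ContDiffOn ℝ m φ (Ici 0) ∧
      ∃ C : ℝ, ∀ v ∈ Ici (0 : ℝ), ∀ w ∈ Ici (0 : ℝ),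
        |iteratedDerivWithin m φ (Ici 0) v - iteratedDerivWithin m φ (Ici 0) w|
          ≤ C * |v - w| ^ δ

/-- Continuously differentiable curves `[0, ∞) → M_p`, differentiability being tested against
the functions of the class above. -/
def IsC1Curve (p : ℝ) (f : ℝ → ProbabilityMeasure ℝ≥0) : Prop :=
  (∀ t, 0 ≤ t → HasMoment p (f t)) ∧
    ∀ φ, IsTestFunction p φ →
      ContDiffOn ℝ 1 (fun t => ∫ w, φ (w : ℝ) ∂(f t : Measure ℝ≥0)) (Ici 0)

/-- The initial condition: `∫ φ df_t → ∫ φ df₀` as `t ↓ 0`, for all test functions `φ`. -/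
def HasInitialDatum (p : ℝ) (f₀ : ProbabilityMeasure ℝ≥0) (f : ℝ → ProbabilityMeasure ℝ≥0) :
    Prop :=
  ∀ φ, IsTestFunction p φ →
    Tendsto (fun t => ∫ w, φ (w : ℝ) ∂(f t : Measure ℝ≥0)) (𝓝[>] 0)
      (𝓝 (∫ w, φ (w : ℝ) ∂(f₀ : Measure ℝ≥0)))

/-- The mean wealth. -/
def meanWealth (f : ProbabilityMeasure ℝ≥0) : ℝ := ∫ w, (w : ℝ) ∂(f : Measure ℝ≥0)

/-- The wealth after one round of the market of an agent of wealth `w` who has invested the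
fraction `γ` in stocks; `S` and `S'` are the present and the future price, `r` the interest rate
of bonds, `D` the dividend, `η` the noise. -/
def newWealth (r D S S' γ η w : ℝ) : ℝ :=
  (1 - γ) * w * (1 + r) + γ * w * (1 + (S' - S + D + η) / S)

namespace Market

/-- The law of `η = σ Y`. -/
def Θ (M : Market) (σ : ℝ) : Measure ℝ := (M.Y : Measure ℝ).map (fun y => σ * y)

/-- The expected wealth `E[w']` after one round, for wealth distribution `f`, present price `S`
and future price `S'`. -/
def expectedNewWealth (M : Market) (r σ D S S' : ℝ) (f : ProbabilityMeasure ℝ≥0) : ℝ :=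
  ∫ w, ∫ ξ, ∫ η, newWealth r D S S' (M.μ S + ξ) η w
    ∂(M.Θ σ) ∂(M.Φ (M.μ S) : Measure ℝ) ∂(f : Measure ℝ≥0)

/-- `S` is the price at which supply equals demand for the wealth distribution `f`. -/
def IsPrice (M : Market) (f : ProbabilityMeasure ℝ≥0) (S : ℝ) : Prop :=
  0 < S ∧ S = 1 / M.n * M.μ S * meanWealth f

/-- `S'` is the future price: supply equals demand after the next round. -/
def IsFuturePrice (M : Market) (r σ D : ℝ) (f : ProbabilityMeasure ℝ≥0) (S S' : ℝ) : Prop :=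
  0 ≤ S' ∧ S' = 1 / M.n * M.μ S' * M.expectedNewWealth r σ D S S' f

/-- The right-hand side of the weak form of the kinetic equation. -/
def collision (M : Market) (r σ D S S' : ℝ) (f : ProbabilityMeasure ℝ≥0) (φ : ℝ → ℝ) : ℝ :=
  ∫ w, ∫ ξ, ∫ η, (φ (newWealth r D S S' (M.μ S + ξ) η w) - φ (w : ℝ))
    ∂(M.Θ σ) ∂(M.Φ (M.μ S) : Measure ℝ) ∂(f : Measure ℝ≥0)

/-- `f` is a weak solution of the kinetic (Boltzmann) equation with interest rate `r`, noise of
standard deviation `σ` and dividend `D`, for the initial datum `f₀`; `S t` and `S' t` are the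
present and the future price at time `t`. The noise takes values in an interval `[-d, d]` with
`d ≤ S' + D`, so that wealth never becomes negative. -/
structure IsKineticSolution (M : Market) (p r σ D : ℝ) (f₀ : ProbabilityMeasure ℝ≥0)
    (f : ℝ → ProbabilityMeasure ℝ≥0) (S S' : ℝ → ℝ) : Prop where
  curve : IsC1Curve p f
  price : ∀ t, 0 ≤ t → M.IsPrice (f t) (S t)
  futurePrice : ∀ t, 0 ≤ t → M.IsFuturePrice r σ D (f t) (S t) (S' t)
  noise : ∃ d : ℝ, 0 < d ∧ (∀ᵐ η ∂(M.Θ σ), |η| ≤ d) ∧ ∀ t, 0 ≤ t → d ≤ S' t + D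
  equation : ∀ φ, IsTestFunction p φ → ∀ t, 0 < t →
    HasDerivAt (fun s => ∫ w, φ (w : ℝ) ∂(f s : Measure ℝ≥0))
      (M.collision r σ D (S t) (S' t) (f t) φ) t
  initial : HasInitialDatum p f₀ f

/-- The factor `κ(S)`. -/
def κ (M : Market) (S : ℝ) : ℝ :=
  M.μ S * (1 - M.μ S) / (M.μ S * (1 - M.μ S) - S * deriv M.μ S)

/-- The drift coefficient at price `S`. -/
def driftCoeff (M : Market) (lam S : ℝ) : ℝ :=
  1 + M.μ S * ((M.κ S - 1) + (M.μ S * (M.κ S - 1) + 1) / (1 - M.μ S) * (lam / S))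

/-- The diffusion coefficient at price `S`. -/
def diffusionCoeff (M : Market) (ν S : ℝ) : ℝ :=
  (M.μ S ^ 2 + M.ζ (M.μ S) ^ 2) / S ^ 2 * ν

end Market

/-- `f` is a weak solution, for the initial datum `f₀`, of the Fokker-Planck equation
`∂_τ f + A(τ) ∂_w (w f) = ½ B(τ) ∂²_w (w² f)`. -/
structure IsFokkerPlanckSolution (p : ℝ) (A B : ℝ → ℝ) (f₀ : ProbabilityMeasure ℝ≥0)
    (f : ℝ → ProbabilityMeasure ℝ≥0) : Prop where
  curve : IsC1Curve p f
  equation : ∀ φ, IsTestFunction p φ → ∀ τ, 0 < τ →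
    HasDerivAt (fun s => ∫ w, φ (w : ℝ) ∂(f s : Measure ℝ≥0))
      (A τ * (∫ w : ℝ≥0, (w : ℝ) * derivWithin φ (Ici 0) (w : ℝ) ∂(f τ : Measure ℝ≥0))
        + 1 / 2 * B τ *
          ∫ w : ℝ≥0, (w : ℝ) ^ 2 * iteratedDerivWithin 2 φ (Ici 0) (w : ℝ)
            ∂(f τ : Measure ℝ≥0)) τ
  initial : HasInitialDatum p f₀ f

end

/-! ### Test functions -/

/-! A round of the market multiplies wealth: $w'=w(1+g)$, where the gain $g$ is independent of $w$
and its law depends on time only through the prices. The characters $w^{is}$ of the multiplicative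
group therefore diagonalise the collision operator. With $\tau=rt$, the function $M_s(\tau)=\int
w^{is}\,df_{\tau/r}$ solves a scalar linear equation with coefficient $r^{-1}E[(1+g)^{is}-1]$
(`IsJumpFlow.logCharFun_sub_eq`). The nonlinearity sits only in the price, which is a Lipschitz
function of the mean wealth.

Compactness is thus needed for one real function only. Supply and demand for the future price reduce
to $G(S')=(1+r)G(S)+\lambda r$ with $G(S)=S(1-\mu(S))/\mu(S)$ (`Market.IsFuturePrice.bondValue_eq`),
and $G$ is increasing with slope bounded below. Hence returns on stocks are nonnegative and $O(r)$,
prices stay above the common initial price, and the logarithm of the mean wealth is Lipschitz in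
$\tau$ uniformly in $k$. Along a subsequence the mean wealth converges, and so does the price, to a
continuous $P$.

Noise is bounded by a multiple of $\sigma_k\to0$, so jumps are uniformly small. A Taylor expansion
of $x^{is}$ at $1$ shows that the coefficient is asymptotically $isA+\frac12 is(is-1)B$, with $A$
and $B$ evaluated at the limiting price (`Market.tendsto_jumpDrift`,
`Market.norm_jump_sub_symbol_le`). By Gronwall, $M_s(\tau)$ converges to its initial value times
$\exp\int_0^\tau(isA+\frac12 is(is-1)B)$.

This is the transform of an explicit law: that of $wX_\tau$, where $w\sim f_0$ and $X_\tau$ is an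
independent log-normal variable with parameters $\int_0^\tau A$ and $\int_0^\tau B$
(`logCharFun_logNormalLaw`). Lévy's continuity theorem gives weak convergence. Moments, density and
the Fokker-Planck equation are read off the explicit law, the last by Gaussian integration by parts,
so neither uniform moment bounds of order $p$ nor uniqueness for the limiting equation is used.

Neither $w$ nor $w^{is}$ is a test function, because of the conditions at the origin; they are
reached by approximation with `ramp` and `cutoff`. An atom at zero wealth is invisible to $w^{is}$,
but its mass is recovered from $s=0$. -/

lemma holder_of_lipschitz_of_bounded {ψ : ℝ → ℝ} {L B δ : ℝ} (hδ0 : 0 < δ) (hδ1 : δ ≤ 1)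
    (hL : ∀ v w, |ψ v - ψ w| ≤ L * |v - w|) (hB : ∀ v, |ψ v| ≤ B) (v w : ℝ) :
    |ψ v - ψ w| ≤ (|L| + 2 * B) * |v - w| ^ δ := by
  have hB0 : 0 ≤ B := (abs_nonneg _).trans (hB 0)
  rcases le_total |v - w| 1 with h | h
  · have h1 : |v - w| ≤ |v - w| ^ δ := by
      simpa using Real.rpow_le_rpow_of_exponent_ge' (abs_nonneg (v - w)) h hδ0.le hδ1
    have h2 : L * |v - w| ≤ |L| * |v - w| ^ δ :=
      (mul_le_mul_of_nonneg_right (le_abs_self L) (abs_nonneg _)).trans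
        (mul_le_mul_of_nonneg_left h1 (abs_nonneg L))
    nlinarith [hL v w, Real.rpow_nonneg (abs_nonneg (v - w)) δ]
  · have h1 : 1 ≤ |v - w| ^ δ := Real.one_le_rpow h hδ0.le
    have h2 : |ψ v - ψ w| ≤ 2 * B := (abs_sub _ _).trans (by linarith [hB v, hB w])
    nlinarith [abs_nonneg L]

lemma exists_nat_add_eq {p : ℝ} (hp : 2 < p) :
    ∃ (k : ℕ) (δ : ℝ), 0 < δ ∧ δ ≤ 1 ∧ ((k + 2 : ℕ) : ℝ) + δ = p := by
  -- The order of differentiation is `⌈p⌉₊ - 1` and not the floor of `p`: for integer `p` the Hölder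
  -- exponent must be 1, since 0 is excluded.
  have h3 : 2 < ⌈p⌉₊ := Nat.lt_ceil.2 (by exact_mod_cast hp)
  obtain ⟨k, hk⟩ : ∃ k, ⌈p⌉₊ = k + 3 := ⟨⌈p⌉₊ - 3, by omega⟩
  have h1 := Nat.le_ceil p
  have h2 := Nat.ceil_lt_add_one (by linarith : 0 ≤ p)
  rw [hk] at h1 h2
  push_cast at h1 h2
  refine ⟨k, p - (k + 2 : ℕ), ?_, ?_, by ring⟩ <;> push_cast <;> linarith

lemma HasCompactSupport.iterate_deriv {φ : ℝ → ℝ} (h : HasCompactSupport φ) (k : ℕ) :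
    HasCompactSupport (deriv^[k] φ) := by
  induction k with
  | zero => exact h
  | succ k ih => rw [Function.iterate_succ_apply']; exact ih.deriv

/-- Compact support is asked of the second derivative only, so that functions linear at infinity
qualify. The Hölder condition concerns a derivative of order at least two, which is then both
Lipschitz and bounded. -/
lemma isTestFunction_of_hasCompactSupport {p : ℝ} (hp : 2 < p) {φ : ℝ → ℝ}
    (hφ : ContDiff ℝ (⊤ : ℕ∞) φ) (h0 : φ 0 = 0) (h1 : deriv φ 0 = 0)
    (h2 : HasCompactSupport (deriv^[2] φ)) : IsTestFunction p φ := by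
  obtain ⟨k, δ, hδ0, hδ1, hk⟩ := exists_nat_add_eq hp
  have hu := uniqueDiffOn_Ici (0 : ℝ)
  refine ⟨h0, ?_, k + 2, δ, hδ0, hδ1, hk, (contDiff_infty.1 hφ _).contDiffOn, ?_⟩
  · rw [(hφ.differentiable (by simp)).differentiableAt.derivWithin (hu 0 self_mem_Ici), h1]
  have hsmooth : ∀ n : ℕ, ContDiff ℝ n φ := contDiff_infty.1 hφ
  have hc : HasCompactSupport (deriv^[k + 2] φ) := by
    rw [Function.iterate_add_apply]; exact h2.iterate_deriv k
  have hd : ContDiff ℝ (1 : ℕ) (deriv^[k + 2] φ) := (hsmooth (1 + (k + 2))).iterate_deriv' 1 (k + 2)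
  obtain ⟨L, hL⟩ := hd.lipschitzWith_of_hasCompactSupport hc (by simp)
  obtain ⟨B, hB⟩ := hc.exists_bound_of_continuous hd.continuous
  refine ⟨|(L : ℝ)| + 2 * B, fun v hv w hw => ?_⟩
  rw [iteratedDerivWithin_eq_iteratedDeriv hu (hsmooth _).contDiffAt hv,
    iteratedDerivWithin_eq_iteratedDeriv hu (hsmooth _).contDiffAt hw, iteratedDeriv_eq_iterate]
  exact holder_of_lipschitz_of_bounded hδ0 hδ1 (L := L)
    (fun v w => by simpa [Real.dist_eq] using hL.dist_le_mul v w) hB v w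

/-- A smooth function which is close to the identity and flat at the origin. -/
noncomputable def ramp (ε w : ℝ) : ℝ := w * Real.smoothTransition (w / ε)

lemma contDiff_ramp (ε : ℝ) : ContDiff ℝ (⊤ : ℕ∞) (ramp ε) :=
  contDiff_id.mul (Real.smoothTransition.contDiff.comp (contDiff_id.div_const ε))

lemma abs_ramp_sub_le {ε w : ℝ} (hε : 0 < ε) (hw : 0 ≤ w) : |ramp ε w - w| ≤ ε := by
  unfold ramp
  have h0 := Real.smoothTransition.nonneg (w / ε)
  have h1 := Real.smoothTransition.le_one (w / ε)
  rcases le_total w ε with h | h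
  · rw [abs_le]; constructor <;> nlinarith
  · rw [Real.smoothTransition.one_of_one_le ((one_le_div hε).2 h)]; simp [hε.le]

lemma isTestFunction_ramp {p : ℝ} (hp : 2 < p) {ε : ℝ} (hε : 0 < ε) :
    IsTestFunction p (ramp ε) := by
  have hr : ContDiff ℝ (⊤ : ℕ∞) (fun w : ℝ => Real.smoothTransition (w / ε)) :=
    Real.smoothTransition.contDiff.comp (contDiff_id.div_const ε)
  refine isTestFunction_of_hasCompactSupport hp (contDiff_ramp ε) (by simp [ramp]) ?_ ?_
  · have h : HasDerivAt (ramp ε) _ 0 :=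
      (hasDerivAt_id (0 : ℝ)).mul ((hr.differentiable (by simp)) 0).hasDerivAt
    rw [h.deriv]; simp
  · refine HasCompactSupport.intro (isCompact_Icc (a := 0) (b := ε)) fun w hw => ?_
    have key : ∀ {φ ψ : ℝ → ℝ} {w : ℝ}, φ =ᶠ[𝓝 w] ψ → deriv^[2] φ w = deriv^[2] ψ w :=
      fun h => h.deriv.deriv_eq
    rcases lt_or_ge w 0 with h | h
    · have : ramp ε =ᶠ[𝓝 w] fun _ => 0 := by
        filter_upwards [Iio_mem_nhds h] with v hv
        simp [ramp, Real.smoothTransition.zero_of_nonpos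
          (div_nonpos_of_nonpos_of_nonneg (le_of_lt hv) hε.le)]
      rw [key this]; simp
    · have h' : ε < w := by
        by_contra h'
        exact hw ⟨h, not_lt.1 h'⟩
      have : ramp ε =ᶠ[𝓝 w] fun v => v := by
        filter_upwards [Ioi_mem_nhds h'] with v hv
        simp [ramp, Real.smoothTransition.one_of_one_le ((one_le_div hε).2 (le_of_lt hv))]
      rw [key this]; simp

/-- A smooth cutoff, equal to one on `[2/(j+1), j+1]` and vanishing outside
`[1/(j+1), j+2]`. -/
noncomputable def cutoff (j : ℕ) (w : ℝ) : ℝ :=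
  Real.smoothTransition ((j + 1) * w - 1) * Real.smoothTransition (j + 2 - w)

lemma contDiff_cutoff (j : ℕ) : ContDiff ℝ (⊤ : ℕ∞) (cutoff j) :=
  (Real.smoothTransition.contDiff.comp ((contDiff_const.mul contDiff_id).sub contDiff_const)).mul
    (Real.smoothTransition.contDiff.comp (contDiff_const.sub contDiff_id))

lemma cutoff_nonneg (j : ℕ) (w : ℝ) : 0 ≤ cutoff j w :=
  mul_nonneg (Real.smoothTransition.nonneg _) (Real.smoothTransition.nonneg _)

lemma cutoff_le_one (j : ℕ) (w : ℝ) : cutoff j w ≤ 1 :=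
  mul_le_one₀ (Real.smoothTransition.le_one _) (Real.smoothTransition.nonneg _)
    (Real.smoothTransition.le_one _)

lemma cutoff_of_lt {j : ℕ} {w : ℝ} (h : (j + 1) * w ≤ 1) : cutoff j w = 0 := by
  simp [cutoff, Real.smoothTransition.zero_of_nonpos (sub_nonpos.2 h)]

lemma cutoff_of_gt {j : ℕ} {w : ℝ} (h : (j + 2 : ℝ) ≤ w) : cutoff j w = 0 := by
  simp [cutoff, Real.smoothTransition.zero_of_nonpos (sub_nonpos.2 h)]

lemma eventually_cutoff_eq_one {w : ℝ} (hw : 0 < w) : ∀ᶠ j : ℕ in atTop, cutoff j w = 1 := by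
  obtain ⟨N, hN⟩ := exists_nat_ge (2 / w + w)
  filter_upwards [eventually_ge_atTop N] with j hj
  have hj' : (N : ℝ) ≤ j := by exact_mod_cast hj
  have h2 : 0 < 2 / w := by positivity
  have h1 : 2 ≤ (j + 1) * w := by
    have : 2 / w ≤ j + 1 := by linarith
    rwa [div_le_iff₀ hw] at this
  rw [cutoff, Real.smoothTransition.one_of_one_le (by linarith),
    Real.smoothTransition.one_of_one_le (by linarith), mul_one]

/-- Meant for the real and imaginary parts of `w ^ (i s)`, which oscillate at the origin: the cutoff
vanishes on a neighbourhood of every `w ≤ 0`. -/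
lemma contDiff_cutoff_mul {h : ℝ → ℝ} (hh : ∀ w, 0 < w → ContDiffAt ℝ (⊤ : ℕ∞) h w) (j : ℕ) :
    ContDiff ℝ (⊤ : ℕ∞) (fun w => cutoff j w * h w) := by
  refine contDiff_iff_contDiffAt.2 fun w => ?_
  rcases lt_or_ge 0 w with hw | hw
  · exact (contDiff_cutoff j).contDiffAt.mul (hh w hw)
  · have hj : (0 : ℝ) < j + 1 := by positivity
    have : (fun w => cutoff j w * h w) =ᶠ[𝓝 w] fun _ => 0 := by
      filter_upwards [Iio_mem_nhds (show w < 1 / (j + 1) from hw.trans_lt (by positivity))]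
        with v hv
      rw [cutoff_of_lt, zero_mul]
      have := (lt_div_iff₀ hj).1 (mem_Iio.1 hv)
      linarith
    exact contDiffAt_const.congr_of_eventuallyEq this

lemma isTestFunction_cutoff_mul {p : ℝ} (hp : 2 < p) {h : ℝ → ℝ}
    (hh : ∀ w, 0 < w → ContDiffAt ℝ (⊤ : ℕ∞) h w) (j : ℕ) :
    IsTestFunction p (fun w => cutoff j w * h w) := by
  have hj : (0 : ℝ) < j + 1 := by positivity
  have hc : HasCompactSupport (fun w => cutoff j w * h w) := by
    refine HasCompactSupport.intro (isCompact_Icc (a := 0) (b := (j : ℝ) + 2)) fun w hw => ?_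
    rcases lt_or_ge w 0 with h | h
    · rw [cutoff_of_lt (by nlinarith), zero_mul]
    · rw [cutoff_of_gt, zero_mul]
      by_contra h'
      exact hw ⟨h, (not_le.1 h').le⟩
  refine isTestFunction_of_hasCompactSupport hp (contDiff_cutoff_mul hh j) ?_ ?_
    (hc.iterate_deriv 2)
  · simp [cutoff_of_lt (show ((j : ℝ) + 1) * 0 ≤ 1 by simp)]
  · have : (fun w => cutoff j w * h w) =ᶠ[𝓝 0] fun _ => 0 := by
      filter_upwards [Iio_mem_nhds (show (0 : ℝ) < 1 / (j + 1) by positivity)] with v hv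
      rw [cutoff_of_lt, zero_mul]
      have := (lt_div_iff₀ hj).1 (mem_Iio.1 hv)
      linarith
    rw [this.deriv_eq]; simp

lemma IsTestFunction.two_le {p : ℝ} (hp : 2 < p) {m : ℕ} {δ : ℝ} (hδ : δ ≤ 1)
    (h : (m : ℝ) + δ = p) : 2 ≤ m := by
  have : (1 : ℝ) < m := by linarith
  exact_mod_cast this

/-- Growth of a test function and of its derivatives at infinity. -/
lemma IsTestFunction.exists_growth {p : ℝ} (hp : 2 < p) {φ : ℝ → ℝ} (hφ : IsTestFunction p φ) :
    ∃ C, 0 ≤ C ∧ ∀ j : ℕ, j ≤ 2 → ∀ w, 0 ≤ w →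
      |iteratedDerivWithin j φ (Ici 0) w| ≤ C * (1 + w) ^ (p - j) := by
  obtain ⟨-, -, m, δ, hδ0, hδ1, hm, hcd, C, hC⟩ := hφ
  have h2m := IsTestFunction.two_le hp hδ1 hm
  have hu := uniqueDiffOn_Ici (0 : ℝ)
  -- Descent from the top derivative: the Hölder condition gives growth of order `δ` for the
  -- derivative of order `m`, and each integration adds one power.
  have step : ∀ i, i ≤ m → ∃ K, 0 ≤ K ∧ ∀ w, 0 ≤ w →
      |iteratedDerivWithin (m - i) φ (Ici 0) w| ≤ K * (1 + w) ^ (δ + i) := by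
    intro i
    induction i with
    | zero =>
      intro _
      refine ⟨|iteratedDerivWithin m φ (Ici 0) 0| + |C|, by positivity, fun w hw => ?_⟩
      have h1 := hC w hw 0 self_mem_Ici
      rw [sub_zero, abs_of_nonneg hw] at h1
      have h2 : w ^ δ ≤ (1 + w) ^ δ := Real.rpow_le_rpow hw (by linarith) hδ0.le
      have h3 : 1 ≤ (1 + w) ^ δ := Real.one_le_rpow (by linarith) hδ0.le
      have h4 : C * w ^ δ ≤ |C| * (1 + w) ^ δ :=
        (mul_le_mul_of_nonneg_right (le_abs_self C) (Real.rpow_nonneg hw _)).trans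
          (mul_le_mul_of_nonneg_left h2 (abs_nonneg C))
      have h5 := abs_sub_abs_le_abs_sub (iteratedDerivWithin m φ (Ici 0) w)
        (iteratedDerivWithin m φ (Ici 0) 0)
      simp only [Nat.cast_zero, add_zero, Nat.sub_zero]
      nlinarith [abs_nonneg (iteratedDerivWithin m φ (Ici 0) 0)]
    | succ i ih =>
      intro hi
      obtain ⟨K, hK0, hK⟩ := ih (by omega)
      refine ⟨|iteratedDerivWithin (m - (i + 1)) φ (Ici 0) 0| + K, by positivity, fun w hw => ?_⟩
      have hd : ∀ x ∈ Icc 0 w, HasDerivWithinAt (iteratedDerivWithin (m - (i + 1)) φ (Ici 0))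
          (iteratedDerivWithin (m - i) φ (Ici 0) x) (Icc 0 w) x := by
        intro x hx
        have h1 := hcd.differentiableOn_iteratedDerivWithin (m := m - (i + 1))
          (by exact_mod_cast (by omega : m - (i + 1) < m)) hu x hx.1
        have h2 := h1.hasDerivWithinAt
        rw [← iteratedDerivWithin_succ, show m - (i + 1) + 1 = m - i by omega] at h2
        exact h2.mono Icc_subset_Ici_self
      have hb : ∀ x ∈ Icc 0 w, ‖iteratedDerivWithin (m - i) φ (Ici 0) x‖ ≤
          K * (1 + w) ^ (δ + i) := fun x hx => (hK x hx.1).trans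
        (mul_le_mul_of_nonneg_left (Real.rpow_le_rpow (by linarith [hx.1]) (by linarith [hx.2])
          (by positivity)) hK0)
      have h3 := (convex_Icc 0 w).norm_image_sub_le_of_norm_hasDerivWithin_le hd hb
        (left_mem_Icc.2 hw) (right_mem_Icc.2 hw)
      rw [sub_zero, Real.norm_eq_abs, Real.norm_eq_abs, abs_of_nonneg hw] at h3
      have h5 := abs_sub_abs_le_abs_sub (iteratedDerivWithin (m - (i + 1)) φ (Ici 0) w)
        (iteratedDerivWithin (m - (i + 1)) φ (Ici 0) 0)
      have h6 : (1 + w) ^ (δ + (i + 1 : ℕ)) = (1 + w) ^ (δ + i) * (1 + w) := by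
        rw [← Real.rpow_add_one (by linarith)]; push_cast; ring_nf
      have h7 : 1 ≤ (1 + w) ^ (δ + i) := Real.one_le_rpow (by linarith) (by positivity)
      rw [h6]
      nlinarith [abs_nonneg (iteratedDerivWithin (m - (i + 1)) φ (Ici 0) 0),
        mul_nonneg hK0 (by positivity : 0 ≤ (1 + w) ^ (δ + i)),
        mul_nonneg (abs_nonneg (iteratedDerivWithin (m - (i + 1)) φ (Ici 0) 0))
          (by nlinarith : 0 ≤ (1 + w) ^ (δ + i) * (1 + w) - 1)]
  have hfin : ∀ j : ℕ, j ≤ 2 → ∃ K, 0 ≤ K ∧ ∀ w, 0 ≤ w →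
      |iteratedDerivWithin j φ (Ici 0) w| ≤ K * (1 + w) ^ (p - j) := by
    intro j hj
    obtain ⟨K, hK0, hK⟩ := step (m - j) (by omega)
    refine ⟨K, hK0, fun w hw => ?_⟩
    have := hK w hw
    rw [show m - (m - j) = j by omega, Nat.cast_sub (by omega)] at this
    rwa [show p - j = δ + (m - j) by linarith]
  choose! K hK0 hK using hfin
  refine ⟨K 0 + K 1 + K 2, by linarith [hK0 0 (by simp), hK0 1 (by simp), hK0 2 (by simp)],
    fun j hj w hw => (hK j hj w hw).trans (mul_le_mul_of_nonneg_right ?_ (by positivity))⟩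
  have := hK0 0 (by simp)
  have := hK0 1 (by simp)
  have := hK0 2 (by simp)
  interval_cases j <;> linarith

lemma IsTestFunction.contDiffOn_two {p : ℝ} (hp : 2 < p) {φ : ℝ → ℝ} (hφ : IsTestFunction p φ) :
    ContDiffOn ℝ 2 φ (Ici 0) := by
  obtain ⟨-, -, m, δ, hδ0, hδ1, hm, hcd, -⟩ := hφ
  exact hcd.of_le (by exact_mod_cast IsTestFunction.two_le hp hδ1 hm)

/-! ### Multiplicative jump flows -/

/-- A curve of wealth distributions which solves, when tested against smooth functions of at most
linear growth, the evolution equation in which wealth is multiplied, at rate `1 / r`, by a random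
factor with the law `ρ τ`. -/
structure IsJumpFlow (p r : ℝ) (f₀ : ProbabilityMeasure ℝ≥0) (F : ℝ → ProbabilityMeasure ℝ≥0)
    (ρ : ℝ → ProbabilityMeasure ℝ) : Prop where
  bounded : ∀ τ, 0 ≤ τ → ∃ K, ∀ᵐ x ∂(ρ τ : Measure ℝ), 0 ≤ x ∧ x ≤ K
  integrable : ∀ τ, 0 ≤ τ → Integrable (fun w : ℝ≥0 => (w : ℝ)) (F τ : Measure ℝ≥0)
  contDiffOn : ∀ φ, IsTestFunction p φ →
    ContDiffOn ℝ 1 (fun τ => ∫ w, φ (w : ℝ) ∂(F τ : Measure ℝ≥0)) (Ici 0)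
  initial : ∀ φ, IsTestFunction p φ →
    ∫ w, φ (w : ℝ) ∂(F 0 : Measure ℝ≥0) = ∫ w, φ (w : ℝ) ∂(f₀ : Measure ℝ≥0)
  hasDerivAt : ∀ φ, IsTestFunction p φ → Continuous φ → (∀ w, 0 ≤ w → |φ w| ≤ 1 + w) →
    ∀ τ, 0 < τ → HasDerivAt (fun t => ∫ w, φ (w : ℝ) ∂(F t : Measure ℝ≥0))
      (r⁻¹ * ∫ z : ℝ≥0 × ℝ, (φ (z.1 * z.2) - φ z.1)
        ∂((F τ : Measure ℝ≥0).prod (ρ τ : Measure ℝ))) τ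

lemma continuous_ramp (ε : ℝ) : Continuous (ramp ε) := (contDiff_ramp ε).continuous

lemma abs_ramp_le (ε w : ℝ) : |ramp ε w| ≤ |w| := by
  rw [ramp, abs_mul, abs_of_nonneg (Real.smoothTransition.nonneg _)]
  exact mul_le_of_le_one_right (abs_nonneg _) (Real.smoothTransition.le_one _)

/-- The error is independent of the law `f`, hence uniform in time along a curve of laws; this is
what lets continuity and derivatives pass from ramps to the mean wealth. -/
lemma abs_integral_ramp_sub_le {ε : ℝ} (hε : 0 < ε) {f : ProbabilityMeasure ℝ≥0}
    (hf : Integrable (fun w : ℝ≥0 => (w : ℝ)) (f : Measure ℝ≥0)) :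
    |∫ w : ℝ≥0, ramp ε w ∂(f : Measure ℝ≥0) - meanWealth f| ≤ ε := by
  have hr : Integrable (fun w : ℝ≥0 => ramp ε w) (f : Measure ℝ≥0) :=
    hf.mono ((continuous_ramp ε).comp NNReal.continuous_coe).aestronglyMeasurable
      (ae_of_all _ fun w => abs_ramp_le ε w)
  rw [meanWealth, ← integral_sub hr hf, ← Real.norm_eq_abs]
  simpa using norm_integral_le_of_norm_le_const (μ := (f : Measure ℝ≥0)) (C := ε)
    (f := fun w : ℝ≥0 => ramp ε w - w) (ae_of_all _ fun w : ℝ≥0 => abs_ramp_sub_le hε w.coe_nonneg)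

lemma integrable_sub_of_linear_growth {f : ProbabilityMeasure ℝ≥0} {ρ : ProbabilityMeasure ℝ}
    (hf : Integrable (fun w : ℝ≥0 => (w : ℝ)) (f : Measure ℝ≥0))
    (hρ : ∃ K, ∀ᵐ x ∂(ρ : Measure ℝ), 0 ≤ x ∧ x ≤ K) {φ : ℝ → ℝ} (hφ : Continuous φ)
    (hb : ∀ w, 0 ≤ w → |φ w| ≤ 1 + w) :
    Integrable (fun z : ℝ≥0 × ℝ => φ (z.1 * z.2) - φ z.1)
      ((f : Measure ℝ≥0).prod (ρ : Measure ℝ)) := by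
  obtain ⟨K, hK⟩ := hρ
  have h1 : Integrable (fun z : ℝ≥0 × ℝ => 2 + (1 + K) * (z.1 : ℝ))
      ((f : Measure ℝ≥0).prod (ρ : Measure ℝ)) :=
    (integrable_const _).add ((hf.comp_fst _).const_mul _)
  refine h1.mono' (by fun_prop) ?_
  filter_upwards [Measure.quasiMeasurePreserving_snd.ae hK] with z hz
  have hz1 : (0 : ℝ) ≤ z.1 := z.1.2
  have h2 := hb (z.1 * z.2) (mul_nonneg hz1 hz.1)
  have h3 := hb z.1 hz1
  have h4 : (z.1 : ℝ) * z.2 ≤ z.1 * K := mul_le_mul_of_nonneg_left hz.2 hz1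
  rw [Real.norm_eq_abs]
  refine (abs_sub _ _).trans ?_
  linarith

lemma tendsto_one_div_succ : Tendsto (fun j : ℕ => 1 / ((j : ℝ) + 1)) atTop (𝓝 0) :=
  tendsto_one_div_add_atTop_nhds_zero_nat

namespace IsJumpFlow

variable {p r : ℝ} {f₀ : ProbabilityMeasure ℝ≥0} {F : ℝ → ProbabilityMeasure ℝ≥0}
  {ρ : ℝ → ProbabilityMeasure ℝ}

lemma continuousOn_meanWealth (h : IsJumpFlow p r f₀ F ρ) (hp : 2 < p) :
    ContinuousOn (fun τ => meanWealth (F τ)) (Ici 0) := by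
  have hu : TendstoUniformlyOn (fun (j : ℕ) τ => ∫ w : ℝ≥0, ramp (1 / ((j : ℝ) + 1)) w
      ∂(F τ : Measure ℝ≥0)) (fun τ => meanWealth (F τ)) atTop (Ici 0) := by
    rw [Metric.tendstoUniformlyOn_iff]
    intro ε hε
    filter_upwards [tendsto_one_div_succ.eventually_lt_const hε] with j hj τ hτ
    rw [dist_comm, Real.dist_eq]
    exact (abs_integral_ramp_sub_le (by positivity) (h.integrable τ hτ)).trans_lt hj
  exact hu.continuousOn (Eventually.of_forall fun j =>
    (h.contDiffOn _ (isTestFunction_ramp hp (by positivity))).continuousOn).frequently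

lemma meanWealth_zero (h : IsJumpFlow p r f₀ F ρ) (hp : 2 < p)
    (hf₀ : Integrable (fun w : ℝ≥0 => (w : ℝ)) (f₀ : Measure ℝ≥0)) :
    meanWealth (F 0) = meanWealth f₀ := by
  refine eq_of_forall_dist_le fun ε hε => ?_
  rw [Real.dist_eq]
  have h1 := abs_integral_ramp_sub_le (half_pos hε) (h.integrable 0 le_rfl)
  have h2 := abs_integral_ramp_sub_le (half_pos hε) hf₀
  rw [h.initial _ (isTestFunction_ramp hp (half_pos hε))] at h1
  rw [abs_le] at *
  constructor <;> linarith

lemma integrable_prod (h : IsJumpFlow p r f₀ F ρ) {φ : ℝ → ℝ} (hφ : Continuous φ)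
    (hb : ∀ w, 0 ≤ w → |φ w| ≤ 1 + w) {τ : ℝ} (hτ : 0 ≤ τ) :
    Integrable (fun z : ℝ≥0 × ℝ => φ (z.1 * z.2) - φ z.1)
      ((F τ : Measure ℝ≥0).prod (ρ τ : Measure ℝ)) :=
  integrable_sub_of_linear_growth (h.integrable τ hτ) (h.bounded τ hτ) hφ hb

/-- Replacing the identity by a ramp changes the integrand of the jump term by at most twice the
ramp error, whatever the wealth and the factor. The derivatives thus converge uniformly on `(0, ∞)`,
and for the identity the jump term factorises by independence. -/
lemma hasDerivAt_meanWealth (h : IsJumpFlow p r f₀ F ρ) (hp : 2 < p) (hr : 0 < r) {τ : ℝ}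
    (hτ : 0 < τ) : HasDerivAt (fun t => meanWealth (F t))
      (r⁻¹ * (∫ x, (x - 1) ∂(ρ τ : Measure ℝ)) * meanWealth (F τ)) τ := by
  let f' : ℕ → ℝ → ℝ := fun j t => r⁻¹ * ∫ z : ℝ≥0 × ℝ,
    (ramp (1 / ((j : ℝ) + 1)) (z.1 * z.2) - ramp (1 / ((j : ℝ) + 1)) z.1)
        ∂((F t : Measure ℝ≥0).prod (ρ t : Measure ℝ))
  have hgrow : ∀ ε w : ℝ, 0 ≤ w → |ramp ε w| ≤ 1 + w := fun ε w hw => by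
    have := abs_ramp_le ε w
    rw [abs_of_nonneg hw] at this
    linarith
  have hu : TendstoUniformlyOn f' (fun t => r⁻¹ * (∫ x, (x - 1) ∂(ρ t : Measure ℝ)) *
      meanWealth (F t)) atTop (Ioi 0) := by
    rw [Metric.tendstoUniformlyOn_iff]
    intro ε hε
    have hlim : Tendsto (fun j : ℕ => r⁻¹ * (2 * (1 / ((j : ℝ) + 1)))) atTop (𝓝 0) := by
      simpa using (tendsto_one_div_succ.const_mul 2).const_mul r⁻¹
    filter_upwards [hlim.eventually_lt_const hε] with j hj t ht
    have ht0 : 0 ≤ t := le_of_lt ht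
    have hj0 : 0 < 1 / ((j : ℝ) + 1) := by positivity
    have h1 := h.integrable_prod (continuous_ramp (1 / ((j : ℝ) + 1))) (hgrow _) ht0
    have h2 := h.integrable_prod (φ := fun w => w) continuous_id
      (fun w hw => by rw [abs_of_nonneg hw]; linarith) ht0
    have h3 : r⁻¹ * (∫ x, (x - 1) ∂(ρ t : Measure ℝ)) * meanWealth (F t) =
        r⁻¹ * ∫ z : ℝ≥0 × ℝ, ((z.1 : ℝ) * z.2 - z.1)
          ∂((F t : Measure ℝ≥0).prod (ρ t : Measure ℝ)) := by
      have h4 := integral_prod_mul (μ := (F t : Measure ℝ≥0)) (ν := (ρ t : Measure ℝ))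
        (fun w : ℝ≥0 => (w : ℝ)) (fun x : ℝ => x - 1)
      rw [meanWealth, mul_assoc, mul_comm (∫ x, (x - 1) ∂(ρ t : Measure ℝ)), ← h4]
      simp only [mul_sub, mul_one]
    rw [h3, dist_comm, Real.dist_eq, ← mul_sub, abs_mul, abs_of_pos (inv_pos.2 hr),
      ← integral_sub h1 h2]
    refine lt_of_le_of_lt (mul_le_mul_of_nonneg_left ?_ (inv_pos.2 hr).le) hj
    rw [← Real.norm_eq_abs]
    have := norm_integral_le_of_norm_le_const
      (μ := (F t : Measure ℝ≥0).prod (ρ t : Measure ℝ)) (C := 2 * (1 / ((j : ℝ) + 1)))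
      (f := fun z : ℝ≥0 × ℝ => ramp (1 / ((j : ℝ) + 1)) (z.1 * z.2) -
        ramp (1 / ((j : ℝ) + 1)) z.1 - ((z.1 : ℝ) * z.2 - z.1)) ?_
    · simpa using this
    · obtain ⟨K, hK⟩ := h.bounded t ht0
      filter_upwards [Measure.quasiMeasurePreserving_snd.ae hK] with z hz
      have h5 := abs_ramp_sub_le hj0 z.1.coe_nonneg
      have h6 := abs_ramp_sub_le hj0 (mul_nonneg z.1.coe_nonneg hz.1)
      rw [Real.norm_eq_abs]
      rw [abs_le] at *
      constructor <;> linarith [h5.1, h5.2, h6.1, h6.2]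
  refine hasDerivAt_of_tendstoUniformlyOn isOpen_Ioi hu
    (f := fun (j : ℕ) t => ∫ w : ℝ≥0, ramp (1 / ((j : ℝ) + 1)) w ∂(F t : Measure ℝ≥0))
    (Eventually.of_forall fun j t ht => h.hasDerivAt _ (isTestFunction_ramp hp (by positivity))
      (continuous_ramp _) (hgrow _) t ht) (fun t ht => ?_) hτ
  rw [tendsto_iff_dist_tendsto_zero]
  exact squeeze_zero (fun _ => dist_nonneg) (fun j => by
    rw [Real.dist_eq]
    exact abs_integral_ramp_sub_le (by positivity) (h.integrable t (le_of_lt ht)))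
    tendsto_one_div_succ

lemma integral_sub_eq (h : IsJumpFlow p r f₀ F ρ) (hr : 0 < r) {φ : ℝ → ℝ}
    (hφ : IsTestFunction p φ) (hc : Continuous φ) (hb : ∀ w, 0 ≤ w → |φ w| ≤ 1 + w) {T : ℝ}
    (hT : 0 ≤ T) :
    IntervalIntegrable (fun u => ∫ z : ℝ≥0 × ℝ, (φ (z.1 * z.2) - φ z.1)
        ∂((F u : Measure ℝ≥0).prod (ρ u : Measure ℝ))) volume 0 T ∧
      ∫ w, φ (w : ℝ) ∂(F T : Measure ℝ≥0) - ∫ w, φ (w : ℝ) ∂(f₀ : Measure ℝ≥0) =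
        r⁻¹ * ∫ u in (0)..T, ∫ z : ℝ≥0 × ℝ, (φ (z.1 * z.2) - φ z.1)
          ∂((F u : Measure ℝ≥0).prod (ρ u : Measure ℝ)) := by
  have hcd := h.contDiffOn φ hφ
  have hd := h.hasDerivAt φ hφ hc hb
  have hcont : ContinuousOn
      (derivWithin (fun τ => ∫ w, φ (w : ℝ) ∂(F τ : Measure ℝ≥0)) (Ici 0)) (Icc 0 T) :=
    (hcd.continuousOn_derivWithin (uniqueDiffOn_Ici 0) le_rfl).mono Icc_subset_Ici_self
  have hint := (hcont.intervalIntegrable_of_Icc hT (μ := volume)).const_mul r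
  -- Nothing is assumed about the dependence of `ρ u` on `u`. Integrability comes from the equation
  -- itself: on `(0, T]` the jump term is `r` times the derivative of a curve that is C¹ up to 0.
  have hJ : IntervalIntegrable (fun u => ∫ z : ℝ≥0 × ℝ, (φ (z.1 * z.2) - φ z.1)
        ∂((F u : Measure ℝ≥0).prod (ρ u : Measure ℝ))) volume 0 T := by
    refine hint.congr fun u hu => ?_
    rw [uIoc_of_le hT] at hu
    rw [derivWithin_of_mem_nhds (Ici_mem_nhds hu.1), (hd u hu.1).deriv,
      mul_inv_cancel_left₀ hr.ne']
  refine ⟨hJ, ?_⟩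
  rw [← intervalIntegral.integral_const_mul, ← h.initial φ hφ]
  exact (intervalIntegral.integral_eq_sub_of_hasDeriv_right_of_le hT
    (hcd.continuousOn.mono Icc_subset_Ici_self)
    (fun u hu => (hd u hu.1).hasDerivWithinAt) (hJ.const_mul _)).symm

/-- The evolution equation extends to bounded functions which are smooth on `(0, ∞)` and vanish at
the origin. -/
lemma integral_sub_eq_of_contDiffAt (h : IsJumpFlow p r f₀ F ρ) (hp : 2 < p) (hr : 0 < r)
    {g : ℝ → ℝ} (hg : ∀ w, 0 < w → ContDiffAt ℝ (⊤ : ℕ∞) g w) (hg0 : g 0 = 0)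
    (hb : ∀ w, |g w| ≤ 1) {T : ℝ} (hT : 0 ≤ T) :
    IntervalIntegrable (fun u => ∫ z : ℝ≥0 × ℝ, (g (z.1 * z.2) - g z.1)
        ∂((F u : Measure ℝ≥0).prod (ρ u : Measure ℝ))) volume 0 T ∧
      ∫ w, g (w : ℝ) ∂(F T : Measure ℝ≥0) - ∫ w, g (w : ℝ) ∂(f₀ : Measure ℝ≥0) =
        r⁻¹ * ∫ u in (0)..T, ∫ z : ℝ≥0 × ℝ, (g (z.1 * z.2) - g z.1)
          ∂((F u : Measure ℝ≥0).prod (ρ u : Measure ℝ)) := by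
  let φ : ℕ → ℝ → ℝ := fun j w => cutoff j w * g w
  let J : ℕ → ℝ → ℝ := fun j u => ∫ z : ℝ≥0 × ℝ, (φ j (z.1 * z.2) - φ j z.1)
        ∂((F u : Measure ℝ≥0).prod (ρ u : Measure ℝ))
  have hφc : ∀ j, Continuous (φ j) := fun j => (contDiff_cutoff_mul hg j).continuous
  have hφb : ∀ j w, |φ j w| ≤ 1 := fun j w => by
    rw [abs_mul, abs_of_nonneg (cutoff_nonneg j w)]
    exact mul_le_one₀ (cutoff_le_one j w) (abs_nonneg _) (hb w)
  have hlim : ∀ w, 0 ≤ w → Tendsto (fun j => φ j w) atTop (𝓝 (g w)) := by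
    intro w hw
    rcases hw.eq_or_lt with rfl | hw
    · simp [φ, hg0]
    · refine tendsto_const_nhds.congr' ?_
      filter_upwards [eventually_cutoff_eq_one hw] with j hj
      simp [φ, hj]
  have hlim1 : ∀ f : ProbabilityMeasure ℝ≥0, Tendsto (fun j => ∫ w, φ j (w : ℝ) ∂(f : Measure ℝ≥0))
      atTop (𝓝 (∫ w, g (w : ℝ) ∂(f : Measure ℝ≥0))) := fun f =>
    tendsto_integral_of_dominated_convergence (fun _ => (1 : ℝ))
      (fun j => ((hφc j).comp NNReal.continuous_coe).aestronglyMeasurable) (integrable_const _)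
      (fun j => ae_of_all _ fun w => hφb j w) (ae_of_all _ fun w => hlim w w.coe_nonneg)
  have hJlim : ∀ u, 0 ≤ u → Tendsto (fun j => J j u) atTop
      (𝓝 (∫ z : ℝ≥0 × ℝ, (g (z.1 * z.2) - g z.1)
        ∂((F u : Measure ℝ≥0).prod (ρ u : Measure ℝ)))) := fun u hu => by
    refine tendsto_integral_of_dominated_convergence (fun _ => (2 : ℝ))
      (fun j => ?_) (integrable_const _) (fun j => ae_of_all _ fun z => ?_) ?_
    · have := hφc j
      fun_prop
    · rw [Real.norm_eq_abs]
      refine (abs_sub _ _).trans ?_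
      linarith [hφb j (z.1 * z.2), hφb j z.1]
    · obtain ⟨K, hK⟩ := h.bounded u hu
      filter_upwards [Measure.quasiMeasurePreserving_snd.ae hK] with z hz
      exact (hlim _ (mul_nonneg z.1.coe_nonneg hz.1)).sub (hlim _ z.1.coe_nonneg)
  have hJb : ∀ j u, |J j u| ≤ 2 := fun j u => by
    rw [← Real.norm_eq_abs]
    have := norm_integral_le_of_norm_le_const
      (μ := (F u : Measure ℝ≥0).prod (ρ u : Measure ℝ)) (C := 2)
      (f := fun z : ℝ≥0 × ℝ => φ j (z.1 * z.2) - φ j z.1) (ae_of_all _ fun z => by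
        rw [Real.norm_eq_abs]
        refine (abs_sub _ _).trans ?_
        linarith [hφb j (z.1 * z.2), hφb j z.1])
    simpa using this
  have hj := fun j => h.integral_sub_eq hr (isTestFunction_cutoff_mul hp hg j) (hφc j)
    (fun w hw => (hφb j w).trans (by linarith)) hT
  have hmem : ∀ u ∈ uIoc 0 T, 0 ≤ u := fun u hu => by
    rw [uIoc_of_le hT] at hu
    exact hu.1.le
  constructor
  -- Measurability in time is inherited from the cut-off functions, to which the C¹ hypothesis
  -- applies.
  · have hae : AEStronglyMeasurable (fun u => ∫ z : ℝ≥0 × ℝ, (g (z.1 * z.2) - g z.1)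
        ∂((F u : Measure ℝ≥0).prod (ρ u : Measure ℝ))) (volume.restrict (uIoc 0 T)) :=
      aestronglyMeasurable_of_tendsto_ae atTop
        (fun j => (hj j).1.aestronglyMeasurable_restrict_uIoc)
        ((ae_restrict_iff' measurableSet_uIoc).2 (ae_of_all _ fun u hu => hJlim u (hmem u hu)))
    refine (intervalIntegrable_const (c := (2 : ℝ))).mono_fun' hae
      ((ae_restrict_iff' measurableSet_uIoc).2 (ae_of_all _ fun u hu => ?_))
    exact le_of_tendsto ((hJlim u (hmem u hu)).norm) (Eventually.of_forall fun j => hJb j u)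
  · refine tendsto_nhds_unique ((hlim1 (F T)).sub (hlim1 f₀)) ?_
    have := (intervalIntegral.tendsto_integral_filter_of_dominated_convergence
      (μ := volume) (a := 0) (b := T) (F := J) (l := atTop) (fun _ => (2 : ℝ))
      (Eventually.of_forall fun j => (hj j).1.aestronglyMeasurable_restrict_uIoc)
      (Eventually.of_forall fun j => ae_of_all _ fun u _ => hJb j u) intervalIntegrable_const
      (ae_of_all _ fun u hu => hJlim u (hmem u hu))).const_mul r⁻¹
    exact this.congr fun j => (hj j).2.symm

end IsJumpFlow

/-! ### The characteristic function of the logarithm of wealth -/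

/-- The function `w ↦ w ^ (i s)` for `w > 0`, extended by zero. -/
noncomputable def logChar (s w : ℝ) : ℂ :=
  if 0 < w then Complex.exp ((s * Real.log w : ℝ) * Complex.I) else 0

lemma measurable_logChar (s : ℝ) : Measurable (logChar s) :=
  Measurable.ite measurableSet_Ioi (by fun_prop) measurable_const

lemma logChar_zero_right (s : ℝ) : logChar s 0 = 0 := by simp [logChar]

lemma norm_logChar_of_pos (s : ℝ) {w : ℝ} (hw : 0 < w) : ‖logChar s w‖ = 1 := by
  rw [logChar, if_pos hw, Complex.norm_exp_ofReal_mul_I]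

lemma norm_logChar_le (s w : ℝ) : ‖logChar s w‖ ≤ 1 := by
  rcases lt_or_ge 0 w with hw | hw
  · exact (norm_logChar_of_pos s hw).le
  · simp [logChar, hw.not_gt]

lemma logChar_mul (s : ℝ) {w x : ℝ} (hw : 0 ≤ w) (hx : 0 < x) :
    logChar s (w * x) = logChar s w * logChar s x := by
  rcases hw.eq_or_lt with rfl | hw
  · simp [logChar]
  · rw [logChar, logChar, logChar, if_pos hw, if_pos hx, if_pos (mul_pos hw hx), ← Complex.exp_add,
      Real.log_mul hw.ne' hx.ne']
    push_cast
    ring_nf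

lemma contDiffAt_logChar (s : ℝ) {w : ℝ} (hw : 0 < w) :
    ContDiffAt ℝ (⊤ : ℕ∞) (logChar s) w := by
  have h : ContDiffAt ℝ (⊤ : ℕ∞)
      (fun w : ℝ => Complex.exp ((s * Real.log w : ℝ) * Complex.I)) w := by
    have h1 : ContDiffAt ℝ (⊤ : ℕ∞) (fun w : ℝ => s * Real.log w) w :=
      contDiffAt_const.mul (Real.contDiffAt_log.2 hw.ne')
    exact ((Complex.ofRealCLM.contDiff.contDiffAt.comp w h1).mul contDiffAt_const).cexp
  refine h.congr_of_eventuallyEq ?_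
  filter_upwards [Ioi_mem_nhds hw] with v hv
  exact if_pos hv

lemma integral_eq_re_add_im {α : Type*} [MeasurableSpace α] {μ : Measure α} {f : α → ℂ}
    (hf : Integrable f μ) :
    ∫ a, f a ∂μ = ((∫ a, (f a).re ∂μ : ℝ) : ℂ) + ((∫ a, (f a).im ∂μ : ℝ) : ℂ) * Complex.I :=
  (integral_re_add_im hf).symm

/-- The characteristic function of the logarithm of wealth, on the set of positive wealth. -/
noncomputable def logCharFun (f : ProbabilityMeasure ℝ≥0) (s : ℝ) : ℂ :=
  ∫ w : ℝ≥0, logChar s w ∂(f : Measure ℝ≥0)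

lemma integrable_of_norm_le_const {α E : Type*} [MeasurableSpace α] [NormedAddCommGroup E]
    {μ : Measure α} [IsFiniteMeasure μ] {f : α → E} {C : ℝ} (hf : AEStronglyMeasurable f μ)
    (hC : ∀ a, ‖f a‖ ≤ C) : Integrable f μ :=
  (integrable_const C).mono' hf (ae_of_all _ hC)

lemma integrable_logChar (f : ProbabilityMeasure ℝ≥0) (s : ℝ) :
    Integrable (fun w : ℝ≥0 => logChar s w) (f : Measure ℝ≥0) :=
  integrable_of_norm_le_const
    ((measurable_logChar s).comp measurable_coe_nnreal_real).aestronglyMeasurable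
    fun w => norm_logChar_le s w

lemma norm_logCharFun_le (f : ProbabilityMeasure ℝ≥0) (s : ℝ) : ‖logCharFun f s‖ ≤ 1 := by
  have := norm_integral_le_of_norm_le_const (μ := (f : Measure ℝ≥0)) (C := 1)
    (f := fun w : ℝ≥0 => logChar s w) (ae_of_all _ fun w => norm_logChar_le s w)
  simpa [logCharFun] using this

/-- The equation closes for each `s` separately: multiplicativity gives `(w x)^(is) - w^(is) =
w^(is) (x^(is) - 1)`, and wealth and factor are independent. Real and imaginary parts of `w^(is)`
are bounded, smooth on `(0, ∞)` and zero at the origin, so the extended evolution equation applies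
to them. -/
lemma IsJumpFlow.logCharFun_sub_eq {p r : ℝ} {f₀ : ProbabilityMeasure ℝ≥0}
    {F : ℝ → ProbabilityMeasure ℝ≥0} {ρ : ℝ → ProbabilityMeasure ℝ}
    (h : IsJumpFlow p r f₀ F ρ) (hp : 2 < p) (hr : 0 < r)
    (hρ : ∀ τ, 0 ≤ τ → ∀ᵐ x ∂(ρ τ : Measure ℝ), 0 < x) (s : ℝ) {T : ℝ} (hT : 0 ≤ T) :
    IntervalIntegrable
      (fun u => logCharFun (F u) s * ∫ x, (logChar s x - 1) ∂(ρ u : Measure ℝ)) volume 0 T ∧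
    logCharFun (F T) s - logCharFun f₀ s = (r⁻¹ : ℝ) *
      ∫ u in (0)..T, logCharFun (F u) s * ∫ x, (logChar s x - 1) ∂(ρ u : Measure ℝ) := by
  have hre := h.integral_sub_eq_of_contDiffAt hp hr (g := fun w => (logChar s w).re)
    (fun w hw => Complex.reCLM.contDiff.contDiffAt.comp w (contDiffAt_logChar s hw))
    (by simp [logChar_zero_right])
    (fun w => (Complex.abs_re_le_norm _).trans (norm_logChar_le s w)) hT
  have him := h.integral_sub_eq_of_contDiffAt hp hr (g := fun w => (logChar s w).im)
    (fun w hw => Complex.imCLM.contDiff.contDiffAt.comp w (contDiffAt_logChar s hw))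
    (by simp [logChar_zero_right])
    (fun w => (Complex.abs_im_le_norm _).trans (norm_logChar_le s w)) hT
  have hJ : ∀ u, 0 ≤ u →
      logCharFun (F u) s * ∫ x, (logChar s x - 1) ∂(ρ u : Measure ℝ) =
        ((∫ z : ℝ≥0 × ℝ, ((logChar s (z.1 * z.2)).re - (logChar s z.1).re)
          ∂((F u : Measure ℝ≥0).prod (ρ u : Measure ℝ)) : ℝ) : ℂ) +
        ((∫ z : ℝ≥0 × ℝ, ((logChar s (z.1 * z.2)).im - (logChar s z.1).im)
          ∂((F u : Measure ℝ≥0).prod (ρ u : Measure ℝ)) : ℝ) : ℂ) * Complex.I := by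
    intro u hu
    rw [logCharFun, ← integral_prod_mul (μ := (F u : Measure ℝ≥0)) (ν := (ρ u : Measure ℝ))
      (fun w : ℝ≥0 => logChar s w) (fun x : ℝ => logChar s x - 1)]
    have hm : Measurable (fun z : ℝ≥0 × ℝ => logChar s (z.1 * z.2) - logChar s z.1) :=
      ((measurable_logChar s).comp (by fun_prop)).sub ((measurable_logChar s).comp (by fun_prop))
    have hint : Integrable (fun z : ℝ≥0 × ℝ => logChar s (z.1 * z.2) - logChar s z.1)
        ((F u : Measure ℝ≥0).prod (ρ u : Measure ℝ)) :=
      integrable_of_norm_le_const (C := 2) hm.aestronglyMeasurable fun z =>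
        (norm_sub_le _ _).trans (by
          linarith [norm_logChar_le s (z.1 * z.2), norm_logChar_le s z.1])
    have h1 := integral_eq_re_add_im hint
    simp only [Complex.sub_re, Complex.sub_im] at h1
    rw [← h1]
    refine integral_congr_ae ?_
    filter_upwards [Measure.quasiMeasurePreserving_snd.ae (hρ u hu)] with z hz
    rw [logChar_mul s z.1.coe_nonneg hz]
    ring
  have hmem : ∀ u ∈ uIoc 0 T, 0 ≤ u := fun u hu => by
    rw [uIoc_of_le hT] at hu
    exact hu.1.le
  have hmem' : ∀ u ∈ uIcc 0 T, 0 ≤ u := fun u hu => by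
    rw [uIcc_of_le hT] at hu
    exact hu.1
  have h1 : IntervalIntegrable (fun u => ((∫ z : ℝ≥0 × ℝ, ((logChar s (z.1 * z.2)).re -
      (logChar s z.1).re) ∂((F u : Measure ℝ≥0).prod (ρ u : Measure ℝ)) : ℝ) : ℂ)) volume 0 T :=
    ⟨hre.1.1.ofReal, hre.1.2.ofReal⟩
  have h2 : IntervalIntegrable (fun u => ((∫ z : ℝ≥0 × ℝ, ((logChar s (z.1 * z.2)).im -
      (logChar s z.1).im) ∂((F u : Measure ℝ≥0).prod (ρ u : Measure ℝ)) : ℝ) : ℂ) * Complex.I)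
      volume 0 T := IntervalIntegrable.mul_const
    ⟨him.1.1.ofReal, him.1.2.ofReal⟩ _
  refine ⟨(h1.add h2).congr fun u hu => (hJ u (hmem u hu)).symm, ?_⟩
  rw [intervalIntegral.integral_congr (fun u hu => hJ u (hmem' u hu)),
    intervalIntegral.integral_add h1 h2, intervalIntegral.integral_mul_const,
    intervalIntegral.integral_ofReal, intervalIntegral.integral_ofReal, mul_add, ← mul_assoc,
    ← Complex.ofReal_mul, ← Complex.ofReal_mul, ← hre.2, ← him.2, logCharFun, logCharFun,
    integral_eq_re_add_im (integrable_logChar _ s), integral_eq_re_add_im (integrable_logChar _ s)]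
  push_cast
  ring

/-- Gronwall's inequality in integral form. -/
lemma le_mul_exp_of_le_integral {u : ℝ → ℝ} {C ε T : ℝ} (hC : 0 < C) (hT : 0 ≤ T)
    (hu : ContinuousOn u (Icc 0 T)) (hu0 : ∀ t ∈ Icc 0 T, 0 ≤ u t)
    (h : ∀ t ∈ Icc 0 T, u t ≤ C * (∫ x in (0)..t, u x) + ε) : u T ≤ ε * Real.exp (C * T) := by
  have hi : IntervalIntegrable u volume 0 T := hu.intervalIntegrable_of_Icc hT
  have hv0 : ∀ t ∈ Icc 0 T, 0 ≤ ∫ x in (0)..t, u x := fun t ht =>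
    intervalIntegral.integral_nonneg ht.1 fun x hx => hu0 x ⟨hx.1, hx.2.trans ht.2⟩
  have hv : ContinuousOn (fun t => ∫ x in (0)..t, u x) (Icc 0 T) := by
    have := intervalIntegral.continuousOn_primitive_interval' hi left_mem_uIcc
    rwa [uIcc_of_le hT] at this
  have hd : ∀ x ∈ Ico 0 T, HasDerivWithinAt (fun t => ∫ x in (0)..t, u x) (u x) (Ici x) x := by
    intro x hx
    have hx' : IntervalIntegrable u volume 0 x :=
      hi.mono_set (by rw [uIcc_of_le hT, uIcc_of_le hx.1]; exact Icc_subset_Icc_right hx.2.le)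
    have hc : ContinuousWithinAt u (Ioi x) x :=
      (hu x ⟨hx.1, hx.2.le⟩).mono_of_mem_nhdsWithin (mem_of_superset (Ioc_mem_nhdsGT hx.2)
        fun y hy => ⟨hx.1.trans hy.1.le, hy.2⟩)
    exact intervalIntegral.integral_hasDerivWithinAt_right hx'
      ((hu.stronglyMeasurableAtFilter_nhdsWithin measurableSet_Icc x).filter_mono
        (nhdsWithin_le_of_mem (mem_of_superset (Ioc_mem_nhdsGT hx.2)
        fun y hy => ⟨hx.1.trans hy.1.le, hy.2⟩))) hc
  -- The differential inequality is applied to the primitive of `u`, which starts from 0; inserting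
  -- the result in `h` then bounds `u T`.
  have hg := norm_le_gronwallBound_of_norm_deriv_right_le (f := fun t => ∫ x in (0)..t, u x)
    (f' := u) (δ := 0) (K := C) (ε := ε) hv hd (by simp) (fun x hx => by
      have hx' : x ∈ Icc 0 T := ⟨hx.1, hx.2.le⟩
      rw [Real.norm_of_nonneg (hu0 x hx'), Real.norm_of_nonneg (hv0 x hx')]
      exact h x hx') T (right_mem_Icc.2 hT)
  rw [Real.norm_of_nonneg (hv0 T (right_mem_Icc.2 hT)), gronwallBound_of_K_ne_0 hC.ne'] at hg
  simp only [zero_mul, zero_add, sub_zero] at hg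
  have h1 := h T (right_mem_Icc.2 hT)
  have h2 : C * (∫ x in (0)..T, u x) ≤ C * (ε / C * (Real.exp (C * T) - 1)) :=
    mul_le_mul_of_nonneg_left hg hC.le
  have h3 : C * (ε / C * (Real.exp (C * T) - 1)) = ε * Real.exp (C * T) - ε := by
    field_simp
  linarith

/-- If the jump operator is close to multiplication by `θ` on the function `w ^ (i s)`, then the
characteristic function is close to the exponential of the integral of `θ`. -/
lemma IsJumpFlow.norm_logCharFun_sub_le {p r : ℝ} {f₀ : ProbabilityMeasure ℝ≥0}
    {F : ℝ → ProbabilityMeasure ℝ≥0} {ρ : ℝ → ProbabilityMeasure ℝ}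
    (h : IsJumpFlow p r f₀ F ρ) (hp : 2 < p) (hr : 0 < r)
    (hρ : ∀ τ, 0 ≤ τ → ∀ᵐ x ∂(ρ τ : Measure ℝ), 0 < x) (s : ℝ) {θ : ℝ → ℂ} {C ε : ℝ}
    (hθ : ContinuousOn θ (Ici 0)) (hC : 0 < C) (hε : 0 ≤ ε) (hθC : ∀ τ, 0 ≤ τ → ‖θ τ‖ ≤ C)
    (hθε : ∀ τ, 0 ≤ τ →
      ‖(r⁻¹ : ℝ) * (∫ x, (logChar s x - 1) ∂(ρ τ : Measure ℝ)) - θ τ‖ ≤ ε)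
    {T : ℝ} (hT : 0 ≤ T) :
    ‖logCharFun (F T) s - logCharFun f₀ s * Complex.exp (∫ u in (0)..T, θ u)‖ ≤
      ε * T * Real.exp (C * T) := by
  have key := fun (t : ℝ) (ht : 0 ≤ t) => h.logCharFun_sub_eq hp hr hρ s ht
  set M : ℝ → ℂ := fun t => logCharFun (F t) s with hM
  set Q : ℝ → ℂ := fun t => ∫ x, (logChar s x - 1) ∂(ρ t : Measure ℝ) with hQ
  -- `N` is the exact solution of `N' = θ N` with the same initial value, and `M` is an approximate
  -- one.
  set N : ℝ → ℂ := fun t => logCharFun f₀ s * Complex.exp (∫ u in (0)..t, θ u) with hN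
  have hsub : ∀ t ∈ Icc 0 T, uIcc 0 t ⊆ Ici 0 := fun t ht => by
    rw [uIcc_of_le ht.1]; exact Icc_subset_Ici_self
  have hθi : ∀ t ∈ Icc 0 T, IntervalIntegrable θ volume 0 t := fun t ht =>
    (hθ.mono (hsub t ht)).intervalIntegrable
  have hT' : T ∈ Icc 0 T := right_mem_Icc.2 hT
  have hMc : ContinuousOn M (Icc 0 T) := by
    have h1 := (intervalIntegral.continuousOn_primitive_interval' (key T hT).1 left_mem_uIcc)
    rw [uIcc_of_le hT] at h1
    refine ((continuousOn_const (c := logCharFun f₀ s)).add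
      ((continuousOn_const (c := ((r⁻¹ : ℝ) : ℂ))).mul h1)).congr fun t ht => ?_
    have := (key t ht.1).2
    rw [sub_eq_iff_eq_add'] at this
    exact this
  have hNc : ContinuousOn N (Icc 0 T) := by
    have h1 := (intervalIntegral.continuousOn_primitive_interval' (hθi T hT') left_mem_uIcc)
    rw [uIcc_of_le hT] at h1
    exact continuousOn_const.mul h1.cexp
  have hNd : ∀ t ∈ Ioo 0 T, HasDerivAt N (N t * θ t) t := by
    intro t ht
    have h1 : HasDerivAt (fun t => ∫ u in (0)..t, θ u) (θ t) t :=
      intervalIntegral.integral_hasDerivAt_right (hθi t ⟨ht.1.le, ht.2.le⟩)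
        (hθ.stronglyMeasurableAtFilter_nhdsWithin measurableSet_Ici t |>.filter_mono
          (le_of_eq (nhdsWithin_eq_nhds.2 (Ici_mem_nhds ht.1)).symm))
        (hθ.continuousAt (Ici_mem_nhds ht.1))
    have := h1.cexp.const_mul (logCharFun f₀ s)
    rwa [← mul_assoc] at this
  have hNθ : ∀ t ∈ Icc 0 T, IntervalIntegrable (fun u => N u * θ u) volume 0 t := fun t ht =>
    ((hNc.mul (hθ.mono Icc_subset_Ici_self)).mono (by
      rw [uIcc_of_le ht.1]; exact Icc_subset_Icc_right ht.2)).intervalIntegrable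
  have hMθ : ∀ t ∈ Icc 0 T, IntervalIntegrable (fun u => M u * θ u) volume 0 t := fun t ht =>
    ((hMc.mul (hθ.mono Icc_subset_Ici_self)).mono (by
      rw [uIcc_of_le ht.1]; exact Icc_subset_Icc_right ht.2)).intervalIntegrable
  have hNeq : ∀ t ∈ Icc 0 T, N t - logCharFun f₀ s = ∫ u in (0)..t, N u * θ u := by
    intro t ht
    rw [intervalIntegral.integral_eq_sub_of_hasDerivAt_of_le ht.1
      (hNc.mono (Icc_subset_Icc_right ht.2)) (fun x hx => hNd x ⟨hx.1, hx.2.trans_le ht.2⟩)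
      (hNθ t ht)]
    simp [hN]
  have hmain : ∀ t ∈ Icc 0 T, ‖M t - N t‖ ≤ C * (∫ x in (0)..t, ‖M x - N x‖) + ε * T := by
    intro t ht
    have hk := key t ht.1
    have hR : IntervalIntegrable (fun u => (r⁻¹ : ℝ) * (M u * Q u) - M u * θ u) volume 0 t :=
      (hk.1.const_mul _).sub (hMθ t ht)
    have hD : IntervalIntegrable (fun u => M u * θ u - N u * θ u) volume 0 t :=
      (hMθ t ht).sub (hNθ t ht)
    -- The first integral is the consistency error, at most `ε T` because `‖M‖ ≤ 1`; the second is
    -- the Gronwall term.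
    have h1 : M t - N t = (∫ u in (0)..t, ((r⁻¹ : ℝ) * (M u * Q u) - M u * θ u)) +
        ∫ u in (0)..t, (M u * θ u - N u * θ u) := by
      rw [intervalIntegral.integral_sub (hk.1.const_mul _) (hMθ t ht),
        intervalIntegral.integral_sub (hMθ t ht) (hNθ t ht), intervalIntegral.integral_const_mul,
        ← hNeq t ht, ← hk.2]
      ring
    have h2 : ‖∫ u in (0)..t, ((r⁻¹ : ℝ) * (M u * Q u) - M u * θ u)‖ ≤ ε * T := by
      refine (intervalIntegral.norm_integral_le_of_norm_le_const (C := ε) fun u hu => ?_).trans ?_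
      · rw [uIoc_of_le ht.1] at hu
        have : (r⁻¹ : ℝ) * (M u * Q u) - M u * θ u = M u * ((r⁻¹ : ℝ) * Q u - θ u) := by ring
        rw [this, norm_mul]
        exact (mul_le_mul (norm_logCharFun_le _ s) (hθε u hu.1.le) (norm_nonneg _)
          zero_le_one).trans_eq (one_mul _)
      · rw [sub_zero, abs_of_nonneg ht.1]
        exact mul_le_mul_of_nonneg_left ht.2 hε
    have hMN : IntervalIntegrable (fun u => ‖M u - N u‖) volume 0 t :=
      ((hMc.sub hNc).norm.mono (by
        rw [uIcc_of_le ht.1]; exact Icc_subset_Icc_right ht.2)).intervalIntegrable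
    have h3 : ‖∫ u in (0)..t, (M u * θ u - N u * θ u)‖ ≤ C * ∫ x in (0)..t, ‖M x - N x‖ := by
      rw [← intervalIntegral.integral_const_mul]
      refine intervalIntegral.norm_integral_le_of_norm_le ht.1 (ae_of_all _ fun u hu => ?_)
        (hMN.const_mul C)
      rw [← sub_mul, norm_mul, mul_comm]
      exact mul_le_mul_of_nonneg_right (hθC u hu.1.le) (norm_nonneg _)
    rw [h1]
    exact (norm_add_le _ _).trans (by linarith)
  exact le_mul_exp_of_le_integral hC hT (hMc.sub hNc).norm
    (fun t _ => norm_nonneg _) hmain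

/-! ### Prices -/

lemma HasMoment.integrable_coe {p : ℝ} (hp : 1 ≤ p) {f : ProbabilityMeasure ℝ≥0}
    (hf : HasMoment p f) : Integrable (fun w : ℝ≥0 => (w : ℝ)) (f : Measure ℝ≥0) := by
  refine ((integrable_const (1 : ℝ)).add hf).mono'
    measurable_coe_nnreal_real.aestronglyMeasurable (ae_of_all _ fun w => ?_)
  rw [Real.norm_of_nonneg w.coe_nonneg, Pi.add_apply]
  rcases le_total (w : ℝ) 1 with h | h
  · linarith [Real.rpow_nonneg w.coe_nonneg p]
  · have := Real.rpow_le_rpow_of_exponent_le h hp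
    rw [Real.rpow_one] at this
    linarith

namespace Market

variable (M : Market)

lemma μ_lt_one {S : ℝ} (hS : 0 ≤ S) : M.μ S < 1 :=
  (M.μ_antitone self_mem_Ici hS hS).trans_lt M.μ_zero_lt_one

variable {M}

/-- The value of the bonds held, per stock, when the price of the stock is `S`. -/
noncomputable def bondValue (M : Market) (S : ℝ) : ℝ := S * (1 - M.μ S) / M.μ S

/-- The ratio of bonds to stocks `(1 - μ) / μ` is nondecreasing because `μ` is nonincreasing. This
lower bound on the slope yields monotonicity of the bond value and all the Lipschitz estimates for
prices. -/
lemma sub_mul_le_bondValue_sub {S T : ℝ} (hS : 0 ≤ S) (hST : S ≤ T) :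
    (T - S) * ((1 - M.μ S) / M.μ S) ≤ M.bondValue T - M.bondValue S := by
  have hT := hS.trans hST
  have h1 := M.μ_pos S hS
  have h2 := M.μ_pos T hT
  have h3 : (1 - M.μ S) / M.μ S ≤ (1 - M.μ T) / M.μ T := by
    have := M.μ_antitone hS hT hST
    rw [div_le_div_iff₀ h1 h2]
    nlinarith
  have h4 := mul_le_mul_of_nonneg_left h3 hT
  unfold bondValue
  rw [mul_div_assoc, mul_div_assoc]
  linarith

lemma le_of_bondValue_le {S T : ℝ} (hT : 0 ≤ T)
    (h : M.bondValue S ≤ M.bondValue T) : S ≤ T := by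
  by_contra! hlt
  have h1 := sub_mul_le_bondValue_sub (M := M) hT hlt.le
  have h2 : 0 < (S - T) * ((1 - M.μ T) / M.μ T) :=
    mul_pos (sub_pos.2 hlt) (div_pos (sub_pos.2 (M.μ_lt_one hT)) (M.μ_pos T hT))
  linarith

lemma bondValue_pos {S : ℝ} (hS : 0 < S) : 0 < M.bondValue S :=
  div_pos (mul_pos hS (sub_pos.2 (M.μ_lt_one hS.le))) (M.μ_pos S hS.le)

lemma IsPrice.meanWealth_eq {f : ProbabilityMeasure ℝ≥0} {S : ℝ} (h : M.IsPrice f S) :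
    meanWealth f = M.n * (S / M.μ S) := by
  have h1 := (M.μ_pos S h.1.le).ne'
  have h2 := M.n_pos.ne'
  have h3 := h.2
  field_simp at h3 ⊢
  linarith

/-- `S / μ S` is `S` plus the increasing bond value. By the price equation it is also the mean
wealth per stock, so the price is unique, monotone and Lipschitz in the mean wealth. -/
lemma sub_le_div_sub_div {S T : ℝ} (hS : 0 ≤ S) (hST : S ≤ T) :
    T - S ≤ T / M.μ T - S / M.μ S := by
  have h1 := sub_mul_le_bondValue_sub (M := M) hS hST
  have h2 : 0 ≤ (T - S) * ((1 - M.μ S) / M.μ S) :=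
    mul_nonneg (sub_nonneg.2 hST)
      (div_nonneg (sub_nonneg.2 (M.μ_lt_one hS).le) (M.μ_pos S hS).le)
  have h3 : ∀ U, 0 ≤ U → M.bondValue U = U / M.μ U - U := fun U hU => by
    have := (M.μ_pos U hU).ne'
    unfold bondValue
    field_simp
  rw [h3 S hS, h3 T (hS.trans hST)] at h1
  linarith

/-- The price depends monotonically on the mean wealth. -/
lemma IsPrice.mono {f g : ProbabilityMeasure ℝ≥0} {S T : ℝ} (hS : M.IsPrice f S)
    (hT : M.IsPrice g T) (h : meanWealth f ≤ meanWealth g) : S ≤ T := by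
  by_contra! hlt
  have h1 := sub_le_div_sub_div (M := M) hT.1.le hlt.le
  rw [hS.meanWealth_eq, hT.meanWealth_eq] at h
  have := le_of_mul_le_mul_left h M.n_pos
  linarith

/-- The price is a Lipschitz function of the mean wealth. -/
lemma IsPrice.abs_sub_le {f g : ProbabilityMeasure ℝ≥0} {S T : ℝ} (hS : M.IsPrice f S)
    (hT : M.IsPrice g T) : |S - T| ≤ |meanWealth f - meanWealth g| / M.n := by
  wlog h : S ≤ T generalizing f g S T
  · rw [abs_sub_comm, abs_sub_comm (meanWealth f)]
    exact this hT hS (not_le.1 h).le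
  have h1 := sub_le_div_sub_div (M := M) hS.1.le h
  rw [le_div_iff₀ M.n_pos, abs_of_nonpos (by linarith), hS.meanWealth_eq, hT.meanWealth_eq,
    ← mul_sub, abs_mul, abs_of_pos M.n_pos, mul_comm]
  refine mul_le_mul_of_nonneg_left ?_ M.n_pos.le
  rw [abs_of_nonpos (by linarith)]
  linarith

lemma IsPrice.meanWealth_pos {f : ProbabilityMeasure ℝ≥0} {S : ℝ} (h : M.IsPrice f S) :
    0 < meanWealth f := by
  rw [h.meanWealth_eq]
  exact mul_pos M.n_pos (div_pos h.1 (M.μ_pos S h.1.le))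

/-! ### Moments of the noise and of the deviation from the optimal fraction -/

variable (M) in
lemma measurable_scale (σ : ℝ) : Measurable (fun y : ℝ => σ * y) := measurable_const_mul σ

instance isProbabilityMeasure_Θ (M : Market) (σ : ℝ) : IsProbabilityMeasure (M.Θ σ) :=
  Measure.isProbabilityMeasure_map (measurable_scale σ).aemeasurable

lemma integrable_Y_sq : Integrable (fun y : ℝ => y ^ 2) (M.Y : Measure ℝ) := by
  by_contra h
  have := M.Y_variance
  rw [integral_undef h] at this
  exact zero_ne_one this

lemma integrable_Y : Integrable (fun y : ℝ => y) (M.Y : Measure ℝ) := by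
  refine ((integrable_const (1 : ℝ)).add (integrable_Y_sq (M := M))).mono'
    aestronglyMeasurable_id (ae_of_all _ fun y => ?_)
  rw [Real.norm_eq_abs, Pi.add_apply, ← sq_abs]
  nlinarith [sq_nonneg (|y| - 1), abs_nonneg y]

lemma integrable_Θ (σ : ℝ) : Integrable (fun η : ℝ => η) (M.Θ σ) :=
  (integrable_map_measure aestronglyMeasurable_id (measurable_scale σ).aemeasurable).2
    (integrable_Y.const_mul σ)

lemma integrable_Θ_sq (σ : ℝ) : Integrable (fun η : ℝ => η ^ 2) (M.Θ σ) := by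
  refine (integrable_map_measure (by fun_prop) (measurable_scale σ).aemeasurable).2 ?_
  refine (integrable_Y_sq.const_mul (σ ^ 2)).congr (ae_of_all _ fun y => ?_)
  simp [mul_pow]

lemma integral_Θ (σ : ℝ) : ∫ η, η ∂(M.Θ σ) = 0 := by
  rw [Θ, integral_map (f := fun η => η) (measurable_scale σ).aemeasurable aestronglyMeasurable_id,
    integral_const_mul, M.Y_mean, mul_zero]

lemma integral_Θ_sq (σ : ℝ) : ∫ η, η ^ 2 ∂(M.Θ σ) = σ ^ 2 := by
  rw [Θ, integral_map (measurable_scale σ).aemeasurable (by fun_prop)]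
  simp_rw [mul_pow]
  rw [integral_const_mul, M.Y_variance, mul_one]

lemma ae_abs_le_one {S : ℝ} (hS : 0 ≤ S) : ∀ᵐ ξ ∂(M.Φ (M.μ S) : Measure ℝ), |ξ| ≤ 1 := by
  filter_upwards [M.Φ_support S hS] with ξ hξ
  exact (hξ.trans (min_le_left _ _)).trans (M.μ_lt_one hS).le

lemma integrable_Φ {S : ℝ} (hS : 0 ≤ S) :
    Integrable (fun ξ : ℝ => ξ) (M.Φ (M.μ S) : Measure ℝ) :=
  (integrable_const (1 : ℝ)).mono' aestronglyMeasurable_id (ae_abs_le_one hS)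

lemma integrable_Φ_sq {S : ℝ} (hS : 0 ≤ S) :
    Integrable (fun ξ : ℝ => ξ ^ 2) (M.Φ (M.μ S) : Measure ℝ) := by
  refine (integrable_const (1 : ℝ)).mono' (by fun_prop) ?_
  filter_upwards [ae_abs_le_one hS] with ξ hξ
  rw [Real.norm_eq_abs, abs_pow]
  exact pow_le_one₀ (abs_nonneg ξ) hξ

/-- The relative gain of an investor. -/
noncomputable def gain (r D S S' : ℝ) (γ η : ℝ) : ℝ :=
  r + γ * ((S' - S + D) / S - r) + γ / S * η

lemma newWealth_eq (r D S S' γ η w : ℝ) :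
    newWealth r D S S' γ η w = w * (1 + gain r D S S' γ η) := by
  unfold newWealth gain
  ring

/-! ### Moments of the gain and the equation for the future price -/

section gain

variable {r σ D S S' : ℝ}

lemma integral_fraction (hS : 0 ≤ S) :
    ∫ ξ, (M.μ S + ξ) ∂(M.Φ (M.μ S) : Measure ℝ) = M.μ S := by
  rw [integral_add (integrable_const _) (integrable_Φ hS), M.Φ_mean S hS]
  simp

lemma integrable_fraction_sq (hS : 0 ≤ S) :
    Integrable (fun ξ => (M.μ S + ξ) ^ 2) (M.Φ (M.μ S) : Measure ℝ) := by
  refine ((integrable_const (M.μ S ^ 2)).add (((integrable_Φ hS).const_mul (2 * M.μ S)).add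
    (integrable_Φ_sq hS))).congr (ae_of_all _ fun ξ => ?_)
  simp only [Pi.add_apply]
  ring

lemma integral_fraction_sq (hS : 0 ≤ S) :
    ∫ ξ, (M.μ S + ξ) ^ 2 ∂(M.Φ (M.μ S) : Measure ℝ) = M.μ S ^ 2 + M.ζ (M.μ S) ^ 2 := by
  have h : (fun ξ => (M.μ S + ξ) ^ 2) = fun ξ => M.μ S ^ 2 + (2 * M.μ S * ξ + ξ ^ 2) := by
    ext ξ; ring
  rw [h, integral_add (integrable_const _)
    (((integrable_Φ hS).const_mul (2 * M.μ S)).fun_add (integrable_Φ_sq hS)),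
    integral_add ((integrable_Φ hS).const_mul (2 * M.μ S)) (integrable_Φ_sq hS),
    integral_const_mul, M.Φ_mean S hS, M.Φ_variance S hS]
  simp

lemma integral_gain_right (γ : ℝ) :
    ∫ η, gain r D S S' γ η ∂(M.Θ σ) = r + γ * ((S' - S + D) / S - r) := by
  unfold gain
  rw [integral_add (integrable_const _) ((integrable_Θ σ).const_mul _), integral_const_mul,
    integral_Θ]
  simp

lemma integrable_gain (hS : 0 ≤ S) :
    Integrable (fun z : ℝ × ℝ => gain r D S S' (M.μ S + z.1) z.2)
      ((M.Φ (M.μ S) : Measure ℝ).prod (M.Θ σ)) := by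
  have h1 : Integrable (fun ξ => M.μ S + ξ) (M.Φ (M.μ S) : Measure ℝ) :=
    (integrable_const _).add (integrable_Φ hS)
  exact ((integrable_const r).add ((h1.comp_fst _).mul_const _)).add
    ((h1.div_const S).mul_prod (integrable_Θ σ))

lemma integral_gain (hS : 0 ≤ S) :
    ∫ z : ℝ × ℝ, gain r D S S' (M.μ S + z.1) z.2 ∂((M.Φ (M.μ S) : Measure ℝ).prod (M.Θ σ)) =
      r + M.μ S * ((S' - S + D) / S - r) := by
  have h1 : Integrable (fun ξ => M.μ S + ξ) (M.Φ (M.μ S) : Measure ℝ) :=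
    (integrable_const _).add (integrable_Φ hS)
  rw [integral_prod _ (integrable_gain hS)]
  simp only [integral_gain_right]
  rw [integral_add (integrable_const _) (h1.mul_const _), integral_mul_const,
    integral_fraction hS]
  simp

/-- Ordered by powers of `η`: under the product law the linear term has zero mean and the quadratic
one carries the variance of the noise. -/
lemma gain_sq (γ η : ℝ) : gain r D S S' γ η ^ 2 =
    (r ^ 2 + (2 * r * ((S' - S + D) / S - r)) * γ + ((S' - S + D) / S - r) ^ 2 * γ ^ 2) +
    ((2 * r / S) * γ + (2 * ((S' - S + D) / S - r) / S) * γ ^ 2) * η + (1 / S ^ 2 * γ ^ 2) * η ^ 2 := by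
  unfold gain
  ring

lemma integrable_gain_sq_and_integral (hS : 0 ≤ S) :
    Integrable (fun z : ℝ × ℝ => gain r D S S' (M.μ S + z.1) z.2 ^ 2)
      ((M.Φ (M.μ S) : Measure ℝ).prod (M.Θ σ)) ∧
    ∫ z : ℝ × ℝ, gain r D S S' (M.μ S + z.1) z.2 ^ 2
        ∂((M.Φ (M.μ S) : Measure ℝ).prod (M.Θ σ)) =
      r ^ 2 + 2 * r * ((S' - S + D) / S - r) * M.μ S +
        ((S' - S + D) / S - r) ^ 2 * (M.μ S ^ 2 + M.ζ (M.μ S) ^ 2) +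
        (M.μ S ^ 2 + M.ζ (M.μ S) ^ 2) / S ^ 2 * σ ^ 2 := by
  have h1 : Integrable (fun ξ => M.μ S + ξ) (M.Φ (M.μ S) : Measure ℝ) :=
    (integrable_const _).add (integrable_Φ hS)
  have h2 := integrable_fraction_sq (M := M) hS
  have hA : Integrable (fun ξ => r ^ 2 + (2 * r * ((S' - S + D) / S - r)) * (M.μ S + ξ) +
      ((S' - S + D) / S - r) ^ 2 * (M.μ S + ξ) ^ 2) (M.Φ (M.μ S) : Measure ℝ) :=
    ((integrable_const _).add (h1.const_mul _)).add (h2.const_mul _)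
  have hB : Integrable (fun ξ => (2 * r / S) * (M.μ S + ξ) +
      (2 * ((S' - S + D) / S - r) / S) * (M.μ S + ξ) ^ 2) (M.Φ (M.μ S) : Measure ℝ) :=
    (h1.const_mul _).add (h2.const_mul _)
  have hC : Integrable (fun ξ => 1 / S ^ 2 * (M.μ S + ξ) ^ 2) (M.Φ (M.μ S) : Measure ℝ) :=
    h2.const_mul _
  have hA' := hA.comp_fst (M.Θ σ)
  have hB' := hB.mul_prod (integrable_Θ (M := M) σ)
  have hC' := hC.mul_prod (integrable_Θ_sq (M := M) σ)
  simp only [gain_sq]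
  refine ⟨(hA'.add hB').add hC', ?_⟩
  rw [integral_add (hA'.fun_add hB') hC', integral_add hA' hB',
    integral_prod_mul (fun ξ => (2 * r / S) * (M.μ S + ξ) +
      (2 * ((S' - S + D) / S - r) / S) * (M.μ S + ξ) ^ 2) (fun η : ℝ => η),
    integral_prod_mul (fun ξ => 1 / S ^ 2 * (M.μ S + ξ) ^ 2) (fun η : ℝ => η ^ 2),
    integral_Θ, integral_Θ_sq, integral_const_mul, integral_fraction_sq hS,
    integral_fun_fst (fun ξ => r ^ 2 + (2 * r * ((S' - S + D) / S - r)) * (M.μ S + ξ) +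
      ((S' - S + D) / S - r) ^ 2 * (M.μ S + ξ) ^ 2),
    integral_add ((integrable_const _).fun_add (h1.const_mul _)) (h2.const_mul _),
    integral_add (integrable_const _) (h1.const_mul _), integral_const_mul, integral_const_mul,
    integral_fraction hS, integral_fraction_sq hS]
  simp only [integral_const, probReal_univ, one_smul, mul_zero]
  ring

lemma expectedNewWealth_eq (f : ProbabilityMeasure ℝ≥0) (hS : 0 ≤ S) :
    M.expectedNewWealth r σ D S S' f =
      meanWealth f * (1 + (r + M.μ S * ((S' - S + D) / S - r))) := by
  have h1 : Integrable (fun ξ => M.μ S + ξ) (M.Φ (M.μ S) : Measure ℝ) :=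
    (integrable_const _).add (integrable_Φ hS)
  have h2 : ∀ γ, ∫ η, (1 + gain r D S S' γ η) ∂(M.Θ σ) =
      1 + (r + γ * ((S' - S + D) / S - r)) := fun γ => by
    rw [integral_add (integrable_const _) (by
      unfold gain; exact (integrable_const _).add ((integrable_Θ σ).const_mul _)),
      integral_gain_right]
    simp
  unfold expectedNewWealth
  simp only [newWealth_eq, integral_const_mul, h2]
  rw [integral_mul_const, meanWealth]
  congr 1
  rw [integral_add (integrable_const _) ((integrable_const _).fun_add (h1.mul_const _)),
    integral_add (integrable_const _) (h1.mul_const _), integral_mul_const,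
    integral_fraction hS]
  simp

/-- The unknown `S'` also enters `E[w']` through the stocks held. Since `μ(S) · meanWealth f / S =
n`, these contribute `n (S' + D)`; the part `n S'` moves to the left side and leaves the balance of
bonds per stock: old bonds with interest, plus the dividend. -/
lemma IsFuturePrice.bondValue_eq {f : ProbabilityMeasure ℝ≥0} (hS : M.IsPrice f S)
    (hS' : M.IsFuturePrice r σ D f S S') :
    M.bondValue S' = (1 + r) * M.bondValue S + D := by
  have h1 := M.μ_pos S hS.1.le
  have h2 := M.μ_pos S' hS'.1
  have h3 := hS'.2
  have h4 := hS.1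
  have h5 := M.n_pos
  rw [expectedNewWealth_eq f hS.1.le, hS.meanWealth_eq] at h3
  unfold bondValue
  field_simp at h3 ⊢
  linarith

end gain

end Market

/-! ### From the kinetic equation to jump flows -/

namespace Market

variable {M : Market} {r σ D S S' : ℝ}

lemma measurable_gain_fraction (M : Market) (r D S S' : ℝ) :
    Measurable (fun z : ℝ × ℝ => 1 + gain r D S S' (M.μ S + z.1) z.2) := by
  unfold gain
  fun_prop

/-- The law of the factor by which wealth is multiplied in one round of the market. -/
noncomputable def jumpLaw (M : Market) (r σ D S S' : ℝ) : ProbabilityMeasure ℝ :=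
  ⟨((M.Φ (M.μ S) : Measure ℝ).prod (M.Θ σ)).map
    (fun z : ℝ × ℝ => 1 + gain r D S S' (M.μ S + z.1) z.2),
    Measure.isProbabilityMeasure_map (measurable_gain_fraction M r D S S').aemeasurable⟩

lemma coe_jumpLaw : (M.jumpLaw r σ D S S' : Measure ℝ) =
    ((M.Φ (M.μ S) : Measure ℝ).prod (M.Θ σ)).map
      (fun z : ℝ × ℝ => 1 + gain r D S S' (M.μ S + z.1) z.2) := rfl

lemma integral_jumpLaw {E : Type*} [NormedAddCommGroup E] [NormedSpace ℝ E] {h : ℝ → E}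
    (hh : StronglyMeasurable h) :
    ∫ x, h x ∂(M.jumpLaw r σ D S S' : Measure ℝ) =
      ∫ z : ℝ × ℝ, h (1 + gain r D S S' (M.μ S + z.1) z.2)
        ∂((M.Φ (M.μ S) : Measure ℝ).prod (M.Θ σ)) := by
  rw [coe_jumpLaw, integral_map (measurable_gain_fraction M r D S S').aemeasurable
    hh.aestronglyMeasurable]

lemma ae_jumpLaw {q : ℝ → Prop} (hq : MeasurableSet {x | q x})
    (h : ∀ᵐ ξ ∂(M.Φ (M.μ S) : Measure ℝ), ∀ᵐ η ∂(M.Θ σ), q (1 + gain r D S S' (M.μ S + ξ) η)) :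
    ∀ᵐ x ∂(M.jumpLaw r σ D S S' : Measure ℝ), q x := by
  rw [coe_jumpLaw, ae_map_iff (measurable_gain_fraction M r D S S').aemeasurable hq]
  exact (Measure.ae_prod_iff_ae_ae (measurable_gain_fraction M r D S S' hq)).2 h

lemma integral_jumpLaw_sub_one (hS : 0 ≤ S) :
    ∫ x, (x - 1) ∂(M.jumpLaw r σ D S S' : Measure ℝ) = r + M.μ S * ((S' - S + D) / S - r) := by
  rw [integral_jumpLaw (by fun_prop), ← integral_gain (σ := σ) hS]
  simp

lemma integral_jumpLaw_sub_one_sq (hS : 0 ≤ S) :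
    ∫ x, (x - 1) ^ 2 ∂(M.jumpLaw r σ D S S' : Measure ℝ) =
      r ^ 2 + 2 * r * ((S' - S + D) / S - r) * M.μ S +
        ((S' - S + D) / S - r) ^ 2 * (M.μ S ^ 2 + M.ζ (M.μ S) ^ 2) +
        (M.μ S ^ 2 + M.ζ (M.μ S) ^ 2) / S ^ 2 * σ ^ 2 := by
  rw [integral_jumpLaw (by fun_prop), ← (integrable_gain_sq_and_integral hS).2]
  simp

lemma ae_fraction_mem (hS : 0 ≤ S) :
    ∀ᵐ ξ ∂(M.Φ (M.μ S) : Measure ℝ), 0 ≤ M.μ S + ξ ∧ M.μ S + ξ ≤ 1 := by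
  filter_upwards [M.Φ_support S hS] with ξ hξ
  have h1 := abs_le.1 (hξ.trans (min_le_left _ _))
  have h2 := abs_le.1 (hξ.trans (min_le_right _ _))
  constructor <;> linarith [h1.1, h2.2]

/-- The factor is a convex combination, with weight `γ` in `[0, 1]`, of `1 + r` and `(S' + D + η) /
S`; the latter is nonnegative because the noise is at most `S' + D` in absolute value. -/
lemma ae_jumpLaw_mem (hr : 0 ≤ r) (hS : 0 < S) {d : ℝ} (hd : ∀ᵐ η ∂(M.Θ σ), |η| ≤ d)
    (hdS : d ≤ S' + D) :
    ∃ K, ∀ᵐ x ∂(M.jumpLaw r σ D S S' : Measure ℝ), 0 ≤ x ∧ x ≤ K := by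
  refine ⟨1 + r + (S' + D + d) / S, ae_jumpLaw measurableSet_Icc ?_⟩
  filter_upwards [ae_fraction_mem hS.le] with ξ hξ
  filter_upwards [hd] with η hη
  have h1 : 1 + gain r D S S' (M.μ S + ξ) η =
      (1 - (M.μ S + ξ)) * (1 + r) + (M.μ S + ξ) * ((S' + D + η) / S) := by
    unfold gain
    field_simp
    ring
  have h2 := abs_le.1 hη
  have h3 : 0 ≤ (S' + D + η) / S := div_nonneg (by linarith) hS.le
  have h4 : (S' + D + η) / S ≤ (S' + D + d) / S := by gcongr; exact h2.2
  rw [h1]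
  constructor
  · exact add_nonneg (mul_nonneg (by linarith) (by linarith)) (mul_nonneg hξ.1 h3)
  · have h5 : (1 - (M.μ S + ξ)) * (1 + r) ≤ 1 * (1 + r) :=
      mul_le_mul_of_nonneg_right (by linarith) (by linarith)
    have h6 : (M.μ S + ξ) * ((S' + D + η) / S) ≤ 1 * ((S' + D + d) / S) :=
      mul_le_mul hξ.2 h4 h3 zero_le_one
    linarith

lemma ae_jumpLaw_abs_sub_one_le (hr : 0 ≤ r) (hS : 0 < S) {b c : ℝ}
    (hb : ∀ᵐ η ∂(M.Θ σ), |η| ≤ b) (hc : |(S' - S + D) / S - r| ≤ c) :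
    ∀ᵐ x ∂(M.jumpLaw r σ D S S' : Measure ℝ), |x - 1| ≤ r + c + b / S := by
  refine ae_jumpLaw (measurableSet_le (by fun_prop) measurable_const) ?_
  filter_upwards [ae_fraction_mem hS.le] with ξ hξ
  filter_upwards [hb] with η hη
  rw [add_sub_cancel_left, gain]
  have h1 : |M.μ S + ξ| ≤ 1 := abs_le.2 ⟨by linarith [hξ.1], hξ.2⟩
  refine (abs_add_three _ _ _).trans ?_
  rw [abs_of_nonneg hr, abs_mul, abs_mul, abs_div, abs_of_pos hS]
  have h2 : |M.μ S + ξ| * |(S' - S + D) / S - r| ≤ 1 * c :=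
    mul_le_mul h1 hc (abs_nonneg _) zero_le_one
  have h3 : |M.μ S + ξ| / S * |η| ≤ 1 / S * b :=
    mul_le_mul (by gcongr) hη (abs_nonneg _) (by positivity)
  have h4 : 1 / S * b = b / S := by ring
  linarith

lemma collision_eq_integral_prod {f : ProbabilityMeasure ℝ≥0}
    (hf : Integrable (fun w : ℝ≥0 => (w : ℝ)) (f : Measure ℝ≥0))
    (hK : ∃ K, ∀ᵐ x ∂(M.jumpLaw r σ D S S' : Measure ℝ), 0 ≤ x ∧ x ≤ K)
    {φ : ℝ → ℝ} (hφ : Continuous φ) (hb : ∀ w, 0 ≤ w → |φ w| ≤ 1 + w) :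
    M.collision r σ D S S' f φ = ∫ z : ℝ≥0 × ℝ, (φ (z.1 * z.2) - φ z.1)
      ∂((f : Measure ℝ≥0).prod (M.jumpLaw r σ D S S' : Measure ℝ)) := by
  rw [integral_prod _ (integrable_sub_of_linear_growth hf hK hφ hb)]
  refine integral_congr_ae (ae_of_all _ fun w => ?_)
  obtain ⟨K, hK⟩ := hK
  have hint : Integrable (fun x => φ (w * x) - φ w) (M.jumpLaw r σ D S S' : Measure ℝ) := by
    refine (integrable_const (2 + (w : ℝ) * (1 + K))).mono' (by fun_prop) ?_
    filter_upwards [hK] with x hx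
    have h1 := hb (w * x) (mul_nonneg w.coe_nonneg hx.1)
    have h2 := hb w w.coe_nonneg
    have h3 : (w : ℝ) * x ≤ w * K := mul_le_mul_of_nonneg_left hx.2 w.coe_nonneg
    rw [Real.norm_eq_abs]
    refine (abs_sub _ _).trans ?_
    linarith
  have hint' : Integrable (fun z : ℝ × ℝ =>
      φ (w * (1 + gain r D S S' (M.μ S + z.1) z.2)) - φ w)
      ((M.Φ (M.μ S) : Measure ℝ).prod (M.Θ σ)) := by
    rw [coe_jumpLaw, integrable_map_measure (by fun_prop)
      (measurable_gain_fraction M r D S S').aemeasurable] at hint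
    exact hint
  simp only [newWealth_eq]
  rw [integral_jumpLaw (h := fun x => φ (w * x) - φ w)
    (Continuous.stronglyMeasurable (by fun_prop)), integral_prod _ hint']

end Market

/-- A weak solution of the kinetic equation is, on the slow time scale, a jump flow. -/
lemma Market.IsKineticSolution.isJumpFlow {M : Market} {p r σ D : ℝ} (hp : 1 ≤ p) (hr : 0 < r)
    {f₀ : ProbabilityMeasure ℝ≥0} {f : ℝ → ProbabilityMeasure ℝ≥0} {S S' : ℝ → ℝ}
    (h : M.IsKineticSolution p r σ D f₀ f S S') :
    IsJumpFlow p r f₀ (fun τ => f (τ / r))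
      (fun τ => M.jumpLaw r σ D (S (τ / r)) (S' (τ / r))) := by
  have hdiv : ∀ τ, 0 ≤ τ → 0 ≤ τ / r := fun τ hτ => div_nonneg hτ hr.le
  have hbd : ∀ τ, 0 ≤ τ → ∃ K, ∀ᵐ x ∂(M.jumpLaw r σ D (S (τ / r)) (S' (τ / r)) : Measure ℝ),
      0 ≤ x ∧ x ≤ K := fun τ hτ => by
    obtain ⟨d, -, hd, hdS⟩ := h.noise
    exact Market.ae_jumpLaw_mem hr.le (h.price _ (hdiv τ hτ)).1 hd (hdS _ (hdiv τ hτ))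
  refine ⟨hbd, fun τ hτ => (h.curve.1 _ (hdiv τ hτ)).integrable_coe hp, fun φ hφ => ?_,
    fun φ hφ => ?_, fun φ hφ hc hb τ hτ => ?_⟩
  · exact (h.curve.2 φ hφ).comp (contDiff_id.div_const r).contDiffOn fun τ hτ => hdiv τ hτ
  -- The datum is prescribed as a limit at `0+`; the curve is continuous on the closed half-line, so
  -- its value at 0 integrates test functions in the same way as `f₀`.
  · rw [zero_div]
    have h1 := (h.curve.2 φ hφ).continuousOn 0 self_mem_Ici
    exact tendsto_nhds_unique (h1.mono_left (nhdsWithin_mono _ Ioi_subset_Ici_self)) (h.initial φ hφ)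
  · have h1 := h.equation φ hφ (τ / r) (div_pos hτ hr)
    have h2 : HasDerivAt (fun t : ℝ => t / r) (1 / r) τ := (hasDerivAt_id τ).div_const r
    have h3 := h1.comp τ h2
    rw [Market.collision_eq_integral_prod ((h.curve.1 _ (hdiv τ hτ.le)).integrable_coe hp)
      (hbd τ hτ.le) hc hb, one_div, mul_comm] at h3
    exact h3

/-! ### Small jumps -/

/-- Expansion of `exp (i s log x)` at `x = 1`. In the constant, `2|s|` is the third-order remainder
of the logarithm, `3 s ^ 2` comes from replacing `log² x` by `(x - 1)²`, and `8 |s| ^ 3` from the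
exponential remainder with `|log x| ≤ 2 |x - 1|`; `h2` keeps its argument in the unit disc. The
error is written with a factor `(x - 1) ^ 2`, to be integrated into a second moment times the
maximal jump. -/
lemma norm_logChar_sub_taylor_le (s : ℝ) {x : ℝ} (h1 : |x - 1| ≤ 1 / 2)
    (h2 : |s| * (2 * |x - 1|) ≤ 1) :
    ‖logChar s x - 1 - (Complex.I * s) * (x - 1 : ℝ) -
        (Complex.I * s) * (Complex.I * s - 1) / 2 * ((x - 1) ^ 2 : ℝ)‖ ≤
      (2 * |s| + 3 * s ^ 2 + 8 * |s| ^ 3) * |x - 1| * (x - 1) ^ 2 := by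
  have hx : 0 < x := by linarith [(abs_le.1 h1).1]
  obtain ⟨y, rfl⟩ : ∃ y, x = 1 + y := ⟨x - 1, by ring⟩
  rw [add_sub_cancel_left] at *
  have hy1 : |-y| < 1 := by rw [abs_neg]; linarith
  have hpos : 0 < 1 - |y| := by linarith
  obtain ⟨l, hl⟩ : ∃ l, Real.log (1 + y) = l := ⟨_, rfl⟩
  have hl0 : |l| ≤ 2 * |y| := by
    have := Real.abs_log_sub_add_sum_range_le hy1 0
    simp only [Finset.range_zero, Finset.sum_empty, zero_add, sub_neg_eq_add, hl, abs_neg,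
      pow_one] at this
    refine this.trans ?_
    rw [div_le_iff₀ hpos]
    nlinarith [abs_nonneg y]
  have hl2 : |l - y + y ^ 2 / 2| ≤ 2 * |y| ^ 3 := by
    have := Real.abs_log_sub_add_sum_range_le hy1 2
    simp only [Finset.sum_range_succ, Finset.range_zero, Finset.sum_empty, zero_add,
      sub_neg_eq_add, hl, abs_neg] at this
    norm_num at this
    have h3 : l - y + y ^ 2 / 2 = -y + y ^ 2 / 2 + l := by ring
    rw [h3]
    refine this.trans ?_
    rw [div_le_iff₀ hpos]
    nlinarith [pow_nonneg (abs_nonneg y) 3]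
  have hsq : |l ^ 2 - y ^ 2| ≤ 6 * |y| ^ 3 := by
    have h3 : |l - y| ≤ 2 * y ^ 2 := by
      have h4 : l - y = (l - y + y ^ 2 / 2) - y ^ 2 / 2 := by ring
      rw [h4]
      refine (abs_sub _ _).trans ?_
      rw [abs_of_nonneg (by positivity : 0 ≤ y ^ 2 / 2)]
      have h5 : |y| ^ 3 ≤ y ^ 2 / 2 := by
        rw [← sq_abs y]
        nlinarith [pow_nonneg (abs_nonneg y) 2]
      linarith [sq_nonneg y]
    have h5 : |l + y| ≤ 3 * |y| := (abs_add_le _ _).trans (by linarith)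
    have h6 : l ^ 2 - y ^ 2 = (l - y) * (l + y) := by ring
    rw [h6, abs_mul]
    refine (mul_le_mul h3 h5 (abs_nonneg _) (by positivity)).trans_eq ?_
    rw [← sq_abs y]
    ring
  have hsl : ‖((s * l : ℝ) : ℂ) * Complex.I‖ ≤ 1 := by
    rw [norm_mul, Complex.norm_I, mul_one, Complex.norm_real, Real.norm_eq_abs, abs_mul]
    exact (mul_le_mul_of_nonneg_left hl0 (abs_nonneg s)).trans h2
  have hexp := Complex.exp_bound hsl (n := 3) (by norm_num)
  have h7 : logChar s (1 + y) = Complex.exp (((s * l : ℝ) : ℂ) * Complex.I) := by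
    rw [logChar, if_pos hx, hl]
  rw [h7]
  have hdec : Complex.exp (((s * l : ℝ) : ℂ) * Complex.I) - 1 - (Complex.I * s) * (y : ℝ) -
        (Complex.I * s) * (Complex.I * s - 1) / 2 * (y ^ 2 : ℝ) =
      (Complex.exp (((s * l : ℝ) : ℂ) * Complex.I) - ∑ m ∈ Finset.range 3,
        (((s * l : ℝ) : ℂ) * Complex.I) ^ m / (m.factorial : ℂ)) +
      ((s * (l - y + y ^ 2 / 2) : ℝ) : ℂ) * Complex.I -
      ((s ^ 2 / 2 * (l ^ 2 - y ^ 2) : ℝ) : ℂ) := by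
    simp only [Finset.sum_range_succ, Finset.range_zero, Finset.sum_empty, Nat.factorial]
    push_cast
    ring_nf
    simp only [Complex.I_sq]
    ring
  rw [hdec]
  refine (norm_sub_le _ _).trans ((add_le_add_left (norm_add_le _ _) _).trans ?_)
  rw [norm_mul, Complex.norm_I, mul_one, Complex.norm_real, Complex.norm_real, Real.norm_eq_abs,
    Real.norm_eq_abs, abs_mul, abs_mul, abs_of_nonneg (by positivity : 0 ≤ s ^ 2 / 2)]
  have h8 : ‖((s * l : ℝ) : ℂ) * Complex.I‖ ^ 3 ≤ 8 * |s| ^ 3 * |y| ^ 3 := by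
    rw [norm_mul, Complex.norm_I, mul_one, Complex.norm_real, Real.norm_eq_abs, abs_mul, mul_pow]
    have := pow_le_pow_left₀ (abs_nonneg l) hl0 3
    nlinarith [pow_nonneg (abs_nonneg s) 3]
  have h9 : ((3 : ℕ).succ * ((3 : ℕ).factorial * (3 : ℕ) : ℝ)⁻¹ : ℝ) ≤ 1 := by
    norm_num [Nat.factorial]
  have h10 := mul_le_mul_of_nonneg_left h9
    (pow_nonneg (norm_nonneg (((s * l : ℝ) : ℂ) * Complex.I)) 3)
  have h11 := mul_le_mul_of_nonneg_left hl2 (abs_nonneg s)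
  have h12 := mul_le_mul_of_nonneg_left hsq (by positivity : 0 ≤ s ^ 2 / 2)
  have h13 : |y| ^ 3 = |y| * y ^ 2 := by rw [← sq_abs y]; ring
  rw [mul_assoc, ← h13]
  linarith

/-- Second order expansion of the jump operator on the function `w ^ (i s)`. -/
lemma norm_integral_logChar_sub_le (ρ : ProbabilityMeasure ℝ) (s : ℝ) {e : ℝ} (h1 : e ≤ 1 / 2)
    (h2 : |s| * (2 * e) ≤ 1) (hρ : ∀ᵐ x ∂(ρ : Measure ℝ), |x - 1| ≤ e) :
    ‖∫ x, (logChar s x - 1) ∂(ρ : Measure ℝ) -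
        ((Complex.I * s) * ((∫ x, (x - 1) ∂(ρ : Measure ℝ) : ℝ) : ℂ) +
        (Complex.I * s) * (Complex.I * s - 1) / 2 *
          ((∫ x, (x - 1) ^ 2 ∂(ρ : Measure ℝ) : ℝ) : ℂ))‖ ≤
      (2 * |s| + 3 * s ^ 2 + 8 * |s| ^ 3) * e * ∫ x, (x - 1) ^ 2 ∂(ρ : Measure ℝ) := by
  have i0 : Integrable (fun x => logChar s x - 1) (ρ : Measure ℝ) :=
    (integrable_of_norm_le_const (measurable_logChar s).aestronglyMeasurable
      (norm_logChar_le s)).sub (integrable_const _)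
  have i1 : Integrable (fun x : ℝ => x - 1) (ρ : Measure ℝ) :=
    (integrable_const e).mono' (by fun_prop) hρ
  have i2 : Integrable (fun x : ℝ => (x - 1) ^ 2) (ρ : Measure ℝ) := by
    refine (integrable_const (e ^ 2)).mono' (by fun_prop) ?_
    filter_upwards [hρ] with x hx
    rw [Real.norm_eq_abs, abs_pow]
    exact pow_le_pow_left₀ (abs_nonneg _) hx 2
  have j1 : Integrable (fun x : ℝ => (Complex.I * s) * ((x - 1 : ℝ) : ℂ)) (ρ : Measure ℝ) :=
    i1.ofReal.const_mul _
  have j2 : Integrable (fun x : ℝ => (Complex.I * s) * (Complex.I * s - 1) / 2 *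
      (((x - 1) ^ 2 : ℝ) : ℂ)) (ρ : Measure ℝ) := i2.ofReal.const_mul _
  rw [← integral_complex_ofReal, ← integral_complex_ofReal, ← integral_const_mul, ← integral_const_mul,
    ← integral_add j1 j2, ← integral_sub i0 (j1.fun_add j2), ← integral_const_mul]
  refine norm_integral_le_of_norm_le (i2.const_mul _) ?_
  filter_upwards [hρ] with x hx
  have h3 := norm_logChar_sub_taylor_le s (hx.trans h1)
    ((mul_le_mul_of_nonneg_left (by linarith) (abs_nonneg s)).trans h2)
  rw [← sub_sub]
  refine h3.trans ?_
  gcongr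

/-! ### Small-rate asymptotics of returns, drift and diffusion -/

namespace Market

variable {M : Market} {r σ lam ν S S' s₀ : ℝ}

lemma le_of_bondValue_eq (hr : 0 < r) (hlam : 0 ≤ lam) (hS : 0 < S) (hS' : 0 ≤ S')
    (h : M.bondValue S' = (1 + r) * M.bondValue S + lam * r) : S ≤ S' := by
  refine le_of_bondValue_le (M := M) hS' ?_
  have := mul_nonneg hr.le (bondValue_pos (M := M) hS).le
  have := mul_nonneg hlam hr.le
  linarith

/-- The bond value increases by `r (bondValue S + lam)` and its slope to the right of `S` is at
least `(1 - μ S) / μ S`; the bound is the quotient of the two. -/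
lemma sub_le_of_bondValue_eq (hr : 0 < r) (hlam : 0 ≤ lam) (hS : 0 < S) (hS' : 0 ≤ S')
    (h : M.bondValue S' = (1 + r) * M.bondValue S + lam * r) :
    S' - S ≤ r * (S + lam * (M.μ S / (1 - M.μ S))) := by
  have h1 := sub_mul_le_bondValue_sub (M := M) hS.le (le_of_bondValue_eq hr hlam hS hS' h)
  have h2 := M.μ_pos S hS.le
  have h3 := sub_pos.2 (M.μ_lt_one hS.le)
  rw [h] at h1
  have h4 : (S' - S) * ((1 - M.μ S) / M.μ S) ≤ r * M.bondValue S + lam * r := by linarith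
  have h5 := mul_le_mul_of_nonneg_right h4 (div_pos h2 h3).le
  unfold bondValue at h5
  have h6 : (S' - S) * ((1 - M.μ S) / M.μ S) * (M.μ S / (1 - M.μ S)) = S' - S := by
    field_simp
  rw [h6] at h5
  refine h5.trans_eq ?_
  field_simp

/-- A bound for the rate of return of stocks when the price is at least `s₀`. -/
noncomputable def returnBound (M : Market) (lam s₀ : ℝ) : ℝ := 1 + lam / ((1 - M.μ 0) * s₀)

lemma one_le_returnBound (hlam : 0 ≤ lam) (hs₀ : 0 < s₀) : 1 ≤ M.returnBound lam s₀ := by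
  have h0 := sub_pos.2 M.μ_zero_lt_one
  unfold returnBound
  have : 0 ≤ lam / ((1 - M.μ 0) * s₀) := by positivity
  linarith

lemma return_mem (hr : 0 < r) (hlam : 0 ≤ lam) (hs₀ : 0 < s₀) (hS : s₀ ≤ S) (hS' : 0 ≤ S')
    (h : M.bondValue S' = (1 + r) * M.bondValue S + lam * r) :
    0 ≤ (S' - S + lam * r) / S ∧ (S' - S + lam * r) / S ≤ r * M.returnBound lam s₀ := by
  have hS0 : 0 < S := hs₀.trans_le hS
  have h1 := le_of_bondValue_eq hr hlam hS0 hS' h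
  have h2 := sub_le_of_bondValue_eq hr hlam hS0 hS' h
  have h3 := sub_pos.2 (M.μ_lt_one hS0.le)
  have h0 := sub_pos.2 M.μ_zero_lt_one
  refine ⟨div_nonneg (by nlinarith [mul_nonneg hlam hr.le]) hS0.le, ?_⟩
  rw [div_le_iff₀ hS0]
  have h4 : S' - S + lam * r ≤ r * (S + lam / (1 - M.μ S)) := by
    have : lam / (1 - M.μ S) = lam * (M.μ S / (1 - M.μ S)) + lam := by
      field_simp
      ring
    rw [this]
    linarith
  -- Here the lower bound `s₀` on the price and `μ S ≤ μ 0` make the estimate uniform in `S`.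
  have h5 : lam / (1 - M.μ S) ≤ lam / ((1 - M.μ 0) * s₀) * S := by
    rw [div_mul_eq_mul_div, div_le_div_iff₀ h3 (by positivity)]
    have h6 : 1 - M.μ 0 ≤ 1 - M.μ S := by
      linarith [M.μ_antitone self_mem_Ici hS0.le hS0.le]
    have h7 : (1 - M.μ 0) * s₀ ≤ (1 - M.μ S) * S := mul_le_mul h6 hS hs₀.le h3.le
    calc lam * ((1 - M.μ 0) * s₀) ≤ lam * ((1 - M.μ S) * S) := by gcongr
      _ = lam * S * (1 - M.μ S) := by ring
  refine h4.trans ?_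
  rw [mul_assoc]
  refine mul_le_mul_of_nonneg_left ?_ hr.le
  unfold returnBound
  linarith

lemma abs_return_sub_le (hr : 0 < r) (hlam : 0 ≤ lam) (hs₀ : 0 < s₀) (hS : s₀ ≤ S) (hS' : 0 ≤ S')
    (h : M.bondValue S' = (1 + r) * M.bondValue S + lam * r) :
    |(S' - S + lam * r) / S - r| ≤ r * M.returnBound lam s₀ := by
  have h1 := return_mem hr hlam hs₀ hS hS' h
  have h2 := mul_le_mul_of_nonneg_left (one_le_returnBound (M := M) hlam hs₀) hr.le
  rw [abs_le]
  constructor <;> linarith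

/-- The expected rate of growth of wealth on the slow time scale. -/
noncomputable def jumpDrift (M : Market) (r lam S S' : ℝ) : ℝ :=
  r⁻¹ * (r + M.μ S * ((S' - S + lam * r) / S - r))

lemma jumpDrift_mem (hr : 0 < r) (hlam : 0 ≤ lam) (hs₀ : 0 < s₀) (hS : s₀ ≤ S) (hS' : 0 ≤ S')
    (h : M.bondValue S' = (1 + r) * M.bondValue S + lam * r) :
    0 ≤ M.jumpDrift r lam S S' ∧ M.jumpDrift r lam S S' ≤ 1 + M.returnBound lam s₀ := by
  have hS0 : 0 < S := hs₀.trans_le hS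
  have h1 := return_mem hr hlam hs₀ hS hS' h
  have h2 := M.μ_pos S hS0.le
  have h3 := M.μ_lt_one hS0.le
  have h4 := abs_return_sub_le hr hlam hs₀ hS hS' h
  unfold jumpDrift
  constructor
  · refine mul_nonneg (inv_pos.2 hr).le ?_
    -- A convex combination of the return of bonds and that of stocks, both nonnegative.
    have : r + M.μ S * ((S' - S + lam * r) / S - r) =
      (1 - M.μ S) * r + M.μ S * ((S' - S + lam * r) / S) := by ring
    rw [this]
    exact add_nonneg (mul_nonneg (by linarith) hr.le) (mul_nonneg h2.le h1.1)
  · rw [inv_mul_le_iff₀ hr]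
    have h5 : M.μ S * ((S' - S + lam * r) / S - r) ≤ 1 * (r * M.returnBound lam s₀) :=
      (le_abs_self _).trans (by
        rw [abs_mul, abs_of_pos h2]
        exact mul_le_mul h3.le h4 (abs_nonneg _) zero_le_one)
    linarith

lemma ζ_sq_le_one (hS : 0 ≤ S) : M.ζ (M.μ S) ^ 2 ≤ 1 := by
  rw [← M.Φ_variance S hS]
  have := integral_mono_ae (integrable_Φ_sq hS) (integrable_const (1 : ℝ))
    (by
      filter_upwards [ae_abs_le_one (M := M) hS] with ξ hξ
      rw [← sq_abs]
      exact pow_le_one₀ (abs_nonneg ξ) hξ)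
  simpa using this

lemma diffusionCoeff_nonneg (hν : 0 ≤ ν) : 0 ≤ M.diffusionCoeff ν S := by
  unfold diffusionCoeff
  positivity

lemma diffusionCoeff_le (hν : 0 ≤ ν) (hs₀ : 0 < s₀) (hS : s₀ ≤ S) :
    M.diffusionCoeff ν S ≤ 2 / s₀ ^ 2 * ν := by
  have hS0 : 0 < S := hs₀.trans_le hS
  have h1 := ζ_sq_le_one (M := M) hS0.le
  have h2 : M.μ S ^ 2 ≤ 1 := pow_le_one₀ (M.μ_pos S hS0.le).le (M.μ_lt_one hS0.le).le
  unfold diffusionCoeff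
  gcongr
  linarith

/-- Drift and excess return are `O(r)`, so their contributions to the second moment are `O(r²)`.
Only the noise, of variance `ν r`, contributes at order `r`. -/
lemma abs_second_moment_sub_diffusionCoeff_le (hr : 0 < r) (hlam : 0 ≤ lam)
    (hs₀ : 0 < s₀) (hS : s₀ ≤ S) (hS' : 0 ≤ S') (hσ : σ ^ 2 = ν * r)
    (h : M.bondValue S' = (1 + r) * M.bondValue S + lam * r) :
    |r⁻¹ * ∫ x, (x - 1) ^ 2 ∂(M.jumpLaw r σ (lam * r) S S' : Measure ℝ) - M.diffusionCoeff ν S| ≤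
      r * (1 + 2 * M.returnBound lam s₀ + 2 * M.returnBound lam s₀ ^ 2) := by
  have hS0 : 0 < S := hs₀.trans_le hS
  have h4 := abs_return_sub_le hr hlam hs₀ hS hS' h
  have hK := one_le_returnBound (M := M) hlam hs₀
  rw [integral_jumpLaw_sub_one_sq hS0.le, hσ]
  set K := M.returnBound lam s₀
  set g := (S' - S + lam * r) / S - r
  have h1 := ζ_sq_le_one (M := M) hS0.le
  have h2 : M.μ S ^ 2 ≤ 1 := pow_le_one₀ (M.μ_pos S hS0.le).le (M.μ_lt_one hS0.le).le
  have h5 : r⁻¹ * (r ^ 2 + 2 * r * g * M.μ S + g ^ 2 * (M.μ S ^ 2 + M.ζ (M.μ S) ^ 2) +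
      (M.μ S ^ 2 + M.ζ (M.μ S) ^ 2) / S ^ 2 * (ν * r)) - M.diffusionCoeff ν S =
      r + 2 * (g * M.μ S) + r⁻¹ * (g ^ 2 * (M.μ S ^ 2 + M.ζ (M.μ S) ^ 2)) := by
    unfold diffusionCoeff
    field_simp
    ring
  rw [h5]
  have h6 : |g * M.μ S| ≤ r * K := by
    rw [abs_mul, abs_of_pos (M.μ_pos S hS0.le)]
    exact (mul_le_mul h4 (M.μ_lt_one hS0.le).le (M.μ_pos S hS0.le).le (by positivity)).trans_eq
      (mul_one _)
  have h7 : g ^ 2 ≤ (r * K) ^ 2 := by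
    rw [← sq_abs g]
    exact pow_le_pow_left₀ (abs_nonneg g) h4 2
  have h8 : r⁻¹ * (g ^ 2 * (M.μ S ^ 2 + M.ζ (M.μ S) ^ 2)) ≤ r * (2 * K ^ 2) := by
    rw [inv_mul_le_iff₀ hr]
    calc g ^ 2 * (M.μ S ^ 2 + M.ζ (M.μ S) ^ 2) ≤ (r * K) ^ 2 * 2 :=
          mul_le_mul h7 (by linarith) (by positivity) (by positivity)
      _ = r * (r * (2 * K ^ 2)) := by ring
  have h9 : 0 ≤ r⁻¹ * (g ^ 2 * (M.μ S ^ 2 + M.ζ (M.μ S) ^ 2)) := by positivity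
  have h10 := abs_le.1 h6
  rw [abs_le]
  constructor <;> nlinarith [mul_pos hr (by linarith : 0 < K), sq_nonneg K,
    mul_nonneg hr.le (sq_nonneg K)]

/-- Strict differentiability is needed because the increment from the present to the future price is
taken between two points that both move with `r`. -/
lemma hasStrictDerivAt_bondValue (hS : 0 < S) :
    HasStrictDerivAt M.bondValue
      ((M.μ S * (1 - M.μ S) - S * deriv M.μ S) / M.μ S ^ 2) S := by
  have h1 : HasStrictDerivAt M.μ (deriv M.μ S) S :=
    (M.μ_contDiff.contDiffAt (Ioi_mem_nhds hS)).hasStrictDerivAt one_ne_zero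
  have h2 := (M.μ_pos S hS.le).ne'
  have h3 := ((hasStrictDerivAt_id S).mul ((hasStrictDerivAt_const S (1 : ℝ)).sub h1)).div h1 h2
  refine h3.congr_deriv ?_
  simp only [id, Pi.sub_apply, Pi.mul_apply]
  congr 1
  ring

lemma deriv_μ_nonpos (hS : 0 < S) : deriv M.μ S ≤ 0 := by
  rw [← derivWithin_of_mem_nhds (Ici_mem_nhds hS)]
  exact M.μ_antitone.derivWithin_nonpos

lemma κ_denom_pos (hS : 0 < S) : 0 < M.μ S * (1 - M.μ S) - S * deriv M.μ S := by
  have h1 := mul_pos (M.μ_pos S hS.le) (sub_pos.2 (M.μ_lt_one hS.le))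
  have h2 := mul_nonpos_of_nonneg_of_nonpos hS.le (deriv_μ_nonpos (M := M) hS)
  linarith

lemma continuousAt_μ (hS : 0 < S) : ContinuousAt M.μ S :=
  (M.μ_contDiff.contDiffAt (Ioi_mem_nhds hS)).continuousAt

lemma continuousAt_bondValue (hS : 0 < S) : ContinuousAt M.bondValue S :=
  hasStrictDerivAt_bondValue hS |>.hasDerivAt.continuousAt

/-- In the limit of small interest rate, the jump drift becomes the drift coefficient. -/
lemma tendsto_jumpDrift {r T T' : ℕ → ℝ} (hlam : 0 ≤ lam) (hr : ∀ k, 0 < r k)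
    (hr0 : Tendsto r atTop (𝓝 0)) (hs₀ : 0 < s₀) (hT : ∀ k, s₀ ≤ T k) (hT' : ∀ k, 0 ≤ T' k)
    (h : ∀ k, M.bondValue (T' k) = (1 + r k) * M.bondValue (T k) + lam * r k)
    (hlim : Tendsto T atTop (𝓝 S)) :
    Tendsto (fun k => M.jumpDrift (r k) lam (T k) (T' k)) atTop (𝓝 (M.driftCoeff lam S)) := by
  have hS : 0 < S := hs₀.trans_le (ge_of_tendsto' hlim hT)
  have hTpos : ∀ k, 0 < T k := fun k => hs₀.trans_le (hT k)
  have hμ : Tendsto (fun k => M.μ (T k)) atTop (𝓝 (M.μ S)) := (continuousAt_μ hS).tendsto.comp hlim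
  have hμ1 := M.μ_pos S hS.le
  have hμ2 := sub_pos.2 (M.μ_lt_one hS.le)
  have hbd : ∀ k, ‖T' k - T k‖ ≤ ((T k + lam * (M.μ (T k) / (1 - M.μ (T k)))) * r k) := fun k => by
    rw [Real.norm_of_nonneg (sub_nonneg.2 (le_of_bondValue_eq (hr k) hlam (hTpos k) (hT' k) (h k))),
      mul_comm]
    exact sub_le_of_bondValue_eq (hr k) hlam (hTpos k) (hT' k) (h k)
  have hcoef : Tendsto (fun k => T k + lam * (M.μ (T k) / (1 - M.μ (T k)))) atTop
      (𝓝 (S + lam * (M.μ S / (1 - M.μ S)))) :=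
    hlim.add ((hμ.div (tendsto_const_nhds.sub hμ) hμ2.ne').const_mul _)
  have hO : (fun k => T' k - T k) =O[atTop] r := by
    have h1 := (Asymptotics.isBigO_of_le atTop fun k => (hbd k).trans (le_abs_self _)).trans
      ((hcoef.isBigO_one ℝ).mul (Asymptotics.isBigO_refl r atTop))
    simpa using h1
  have hdiff : Tendsto (fun k => T' k - T k) atTop (𝓝 0) := hO.trans_tendsto hr0
  have hlim' : Tendsto T' atTop (𝓝 S) := by simpa using hdiff.add hlim
  have hstrict := (hasStrictDerivAt_bondValue (M := M) hS).isLittleO.comp_tendsto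
    (hlim'.prodMk_nhds hlim)
  have ho := (hstrict.trans_isBigO hO).tendsto_div_nhds_zero
  have hden := κ_denom_pos (M := M) hS
  set G' := (M.μ S * (1 - M.μ S) - S * deriv M.μ S) / M.μ S ^ 2 with hG'
  have hG'pos : 0 < G' := by positivity
  -- The bond balance says that `bondValue` increases by `r (bondValue T + lam)`; dividing by its
  -- slope `G'` gives the speed of the price.
  have hq : Tendsto (fun k => (T' k - T k) / r k) atTop (𝓝 ((M.bondValue S + lam) / G')) := by
    have h2 : Tendsto (fun k => M.bondValue (T k) + lam) atTop (𝓝 (M.bondValue S + lam)) :=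
      ((continuousAt_bondValue hS).tendsto.comp hlim).add_const _
    have h3 := (h2.sub ho).div_const G'
    rw [sub_zero] at h3
    refine h3.congr fun k => ?_
    have := (hr k).ne'
    simp only [Function.comp, ContinuousLinearMap.toSpanSingleton_apply, smul_eq_mul, h k]
    field_simp
    ring
  have hfin : Tendsto (fun k => 1 - M.μ (T k) + M.μ (T k) * (((T' k - T k) / r k + lam) / T k))
      atTop (𝓝 (1 - M.μ S + M.μ S * (((M.bondValue S + lam) / G' + lam) / S))) :=
    (tendsto_const_nhds.sub hμ).add (hμ.mul ((hq.add_const _).div hlim hS.ne'))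
  -- This is where `κ` enters: `bondValue S / G' = S κ` and `lam / G' = lam κ μ / (1 - μ)`.
  have heq : M.driftCoeff lam S = 1 - M.μ S + M.μ S * (((M.bondValue S + lam) / G' + lam) / S) := by
    rw [hG']
    unfold driftCoeff κ bondValue
    have := hden.ne'
    field_simp
    ring
  rw [heq]
  refine hfin.congr fun k => ?_
  have h1 := (hr k).ne'
  have h2 := (hTpos k).ne'
  unfold jumpDrift
  field_simp
  ring

lemma continuousAt_driftCoeff (hS : 0 < S) : ContinuousAt (M.driftCoeff lam) S := by
  have h1 : ContinuousAt M.μ S := continuousAt_μ hS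
  have h2 : ContinuousAt (deriv M.μ) S :=
    (M.μ_contDiff.continuousOn_deriv_of_isOpen isOpen_Ioi le_rfl).continuousAt (Ioi_mem_nhds hS)
  have h3 := (κ_denom_pos (M := M) hS).ne'
  have h4 := (sub_pos.2 (M.μ_lt_one hS.le)).ne'
  have h5 : ContinuousAt M.κ S :=
    (h1.mul (continuousAt_const.sub h1)).div
      ((h1.mul (continuousAt_const.sub h1)).sub (continuousAt_id.mul h2)) h3
  exact continuousAt_const.add (h1.mul ((h5.sub continuousAt_const).add
    ((((h1.mul (h5.sub continuousAt_const)).add continuousAt_const).div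
      (continuousAt_const.sub h1) h4).mul (continuousAt_const.div continuousAt_id hS.ne'))))

lemma continuousAt_diffusionCoeff (hS : 0 < S) : ContinuousAt (M.diffusionCoeff ν) S := by
  have h1 : ContinuousAt M.μ S := continuousAt_μ hS
  have h2 : ContinuousAt (fun T => M.ζ (M.μ T)) S := by
    have h3 : ContinuousWithinAt M.ζ (M.μ '' Ici 0) (M.μ S) :=
      M.ζ_continuous _ (mem_image_of_mem _ (mem_Ici.2 hS.le))
    have h4 : ContinuousWithinAt (fun T => M.ζ (M.μ T)) (Ici 0) S :=
      h3.comp h1.continuousWithinAt fun T hT => mem_image_of_mem _ hT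
    exact h4.continuousAt (Ici_mem_nhds hS)
  exact (((h1.pow 2).add (h2.pow 2)).div (continuousAt_id.pow 2) (pow_ne_zero 2 hS.ne')).mul
    continuousAt_const

end Market

/-! ### Log-normal multiplicative noise -/

open ProbabilityTheory in
/-- The standard Gaussian measure on the line. -/
noncomputable abbrev stdGaussian : Measure ℝ := gaussianReal 0 1

/-- The value at time one of a geometric Brownian motion with drift `a` and volatility `c`, as a
function of a Gaussian variable. -/
noncomputable def logNormalFactor (a c z : ℝ) : ℝ := Real.exp (a - c ^ 2 / 2 + c * z)

lemma logNormalFactor_pos (a c z : ℝ) : 0 < logNormalFactor a c z := Real.exp_pos _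

lemma continuous_logNormalFactor (a c : ℝ) : Continuous (logNormalFactor a c) := by
  unfold logNormalFactor
  fun_prop

lemma measurable_logNormal_map (a c : ℝ) :
    Measurable (fun z : ℝ≥0 × ℝ => z.1 * (logNormalFactor a c z.2).toNNReal) :=
  measurable_fst.mul
    ((continuous_logNormalFactor a c).measurable.comp measurable_snd).real_toNNReal

/-- The law of `w X`, where `w` has the law `f₀` and `X` is an independent log-normal variable. -/
noncomputable def logNormalLaw (f₀ : ProbabilityMeasure ℝ≥0) (a c : ℝ) : ProbabilityMeasure ℝ≥0 :=
  ⟨((f₀ : Measure ℝ≥0).prod stdGaussian).map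
    (fun z => z.1 * (logNormalFactor a c z.2).toNNReal),
    Measure.isProbabilityMeasure_map (measurable_logNormal_map a c).aemeasurable⟩

lemma coe_logNormalLaw (f₀ : ProbabilityMeasure ℝ≥0) (a c : ℝ) :
    (logNormalLaw f₀ a c : Measure ℝ≥0) = ((f₀ : Measure ℝ≥0).prod stdGaussian).map
      (fun z => z.1 * (logNormalFactor a c z.2).toNNReal) := rfl

lemma coe_mul_logNormalFactor (a c : ℝ) (z : ℝ≥0 × ℝ) :
    ((z.1 * (logNormalFactor a c z.2).toNNReal : ℝ≥0) : ℝ) = z.1 * logNormalFactor a c z.2 := by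
  rw [NNReal.coe_mul, Real.coe_toNNReal _ (logNormalFactor_pos a c z.2).le]

lemma integral_logNormalLaw {E : Type*} [NormedAddCommGroup E] [NormedSpace ℝ E]
    (f₀ : ProbabilityMeasure ℝ≥0) (a c : ℝ) {h : ℝ → E}
    (hh : StronglyMeasurable (fun w : ℝ≥0 => h w)) :
    ∫ w : ℝ≥0, h w ∂(logNormalLaw f₀ a c : Measure ℝ≥0) =
      ∫ z : ℝ≥0 × ℝ, h (z.1 * logNormalFactor a c z.2)
        ∂((f₀ : Measure ℝ≥0).prod stdGaussian) := by
  rw [coe_logNormalLaw, integral_map (measurable_logNormal_map a c).aemeasurable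
    hh.aestronglyMeasurable]
  simp only [coe_mul_logNormalFactor]

lemma integrable_logNormalLaw_iff (f₀ : ProbabilityMeasure ℝ≥0) (a c : ℝ) {h : ℝ → ℝ}
    (hh : StronglyMeasurable (fun w : ℝ≥0 => h w)) :
    Integrable (fun w : ℝ≥0 => h w) (logNormalLaw f₀ a c : Measure ℝ≥0) ↔
      Integrable (fun z : ℝ≥0 × ℝ => h (z.1 * logNormalFactor a c z.2))
        ((f₀ : Measure ℝ≥0).prod stdGaussian) := by
  rw [coe_logNormalLaw, integrable_map_measure hh.aestronglyMeasurable
    (measurable_logNormal_map a c).aemeasurable]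
  simp only [Function.comp_def, coe_mul_logNormalFactor]

lemma integrable_exp_mul_abs (L : ℝ) :
    Integrable (fun z : ℝ => Real.exp (L * |z|)) stdGaussian := by
  refine ((ProbabilityTheory.integrable_exp_mul_gaussianReal L).add
    (ProbabilityTheory.integrable_exp_mul_gaussianReal (-L))).mono' (by fun_prop)
    (ae_of_all _ fun z => ?_)
  rw [Real.norm_of_nonneg (Real.exp_pos _).le, Pi.add_apply]
  rcases le_total 0 z with h | h
  · rw [abs_of_nonneg h]
    linarith [Real.exp_pos (-L * z)]
  · rw [abs_of_nonpos h, mul_neg, ← neg_mul]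
    linarith [Real.exp_pos (L * z)]

lemma integrable_one_add_rpow {p : ℝ} (hp : 0 ≤ p) {f₀ : ProbabilityMeasure ℝ≥0}
    (hf₀ : HasMoment p f₀) :
    Integrable (fun w : ℝ≥0 => (1 + (w : ℝ)) ^ p) (f₀ : Measure ℝ≥0) := by
  refine (((integrable_const (1 : ℝ)).add hf₀).const_mul (2 ^ p)).mono'
    (Measurable.aestronglyMeasurable (by fun_prop)) (ae_of_all _ fun w => ?_)
  have hw := w.coe_nonneg
  rw [Real.norm_of_nonneg (by positivity), Pi.add_apply]
  rcases le_total (w : ℝ) 1 with h | h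
  · have h1 : (1 + (w : ℝ)) ^ p ≤ 2 ^ p := Real.rpow_le_rpow (by positivity) (by linarith) hp
    have h2 : 0 ≤ (2 : ℝ) ^ p * (w : ℝ) ^ p := by positivity
    linarith
  · have h1 : (1 + (w : ℝ)) ^ p ≤ (2 * w) ^ p := Real.rpow_le_rpow (by positivity) (by linarith) hp
    rw [Real.mul_rpow (by norm_num) hw] at h1
    have h2 : 0 ≤ (2 : ℝ) ^ p := by positivity
    linarith

/-- The common dominating function: it is uniform over parameters bounded by `K`, separates `w` from
`z`, and is integrable because Gaussian variables have all exponential moments. The factor `1 + |z|`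
is there for derivatives in the parameters, which bring down a `z`. -/
lemma one_add_mul_rpow_le {p K a c w z : ℝ} (hp : 0 ≤ p) (hK : |a - c ^ 2 / 2| ≤ K)
    (hc : |c| ≤ K) (hw : 0 ≤ w) :
    (1 + w * logNormalFactor a c z) ^ p * (1 + |z|) ≤
      (1 + w) ^ p * (Real.exp (p * K) * Real.exp ((p * K + 1) * |z|)) := by
  have hK0 : 0 ≤ K := (abs_nonneg _).trans hc
  have h1 : logNormalFactor a c z ≤ Real.exp (K + K * |z|) := by
    refine Real.exp_le_exp.2 (add_le_add ((le_abs_self _).trans hK) ((le_abs_self _).trans ?_))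
    rw [abs_mul]
    exact mul_le_mul_of_nonneg_right hc (abs_nonneg z)
  have h2 : 1 ≤ Real.exp (K + K * |z|) := Real.one_le_exp (by positivity)
  have h3 : 1 + w * logNormalFactor a c z ≤ (1 + w) * Real.exp (K + K * |z|) := by
    nlinarith
  have h4 : (1 + w * logNormalFactor a c z) ^ p ≤
      (1 + w) ^ p * Real.exp (K + K * |z|) ^ p := by
    rw [← Real.mul_rpow (by positivity) (by positivity)]
    exact Real.rpow_le_rpow
      (add_nonneg zero_le_one (mul_nonneg hw (logNormalFactor_pos a c z).le)) h3 hp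
  have h5 : 1 + |z| ≤ Real.exp |z| := by linarith [Real.add_one_le_exp |z|]
  refine (mul_le_mul h4 h5 (by positivity) (by positivity)).trans_eq ?_
  rw [← Real.exp_mul, mul_assoc, ← Real.exp_add, ← Real.exp_add]
  ring_nf

lemma integrable_bound {p : ℝ} (hp : 0 ≤ p) (K : ℝ) {f₀ : ProbabilityMeasure ℝ≥0}
    (hf₀ : HasMoment p f₀) :
    Integrable (fun z : ℝ≥0 × ℝ => (1 + (z.1 : ℝ)) ^ p *
      (Real.exp (p * K) * Real.exp ((p * K + 1) * |z.2|)))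
      ((f₀ : Measure ℝ≥0).prod stdGaussian) :=
  (integrable_one_add_rpow hp hf₀).mul_prod ((integrable_exp_mul_abs _).const_mul _)

section growth

variable {p C : ℝ} {h : ℝ → ℝ}

lemma continuous_comp_coe (hh : ContinuousOn h (Ici 0)) : Continuous (fun w : ℝ≥0 => h w) :=
  hh.comp_continuous NNReal.continuous_coe fun w => w.coe_nonneg

lemma continuous_comp_logNormalFactor (hh : ContinuousOn h (Ici 0)) (a c : ℝ) :
    Continuous (fun z : ℝ≥0 × ℝ => h (z.1 * logNormalFactor a c z.2)) :=
  hh.comp_continuous ((NNReal.continuous_coe.comp continuous_fst).mul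
    ((continuous_logNormalFactor a c).comp continuous_snd))
    fun z => mul_nonneg z.1.coe_nonneg (logNormalFactor_pos a c z.2).le

lemma abs_comp_mul_le (hp : 0 ≤ p) (hC : 0 ≤ C) (hb : ∀ y, 0 ≤ y → |h y| ≤ C * (1 + y) ^ p)
    {K a c w z : ℝ} (hK : |a - c ^ 2 / 2| ≤ K) (hc : |c| ≤ K) (hw : 0 ≤ w) :
    |h (w * logNormalFactor a c z)| * (1 + |z|) ≤
      C * ((1 + w) ^ p * (Real.exp (p * K) * Real.exp ((p * K + 1) * |z|))) := by
  have h1 := hb _ (mul_nonneg hw (logNormalFactor_pos a c z).le)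
  have h2 := mul_le_mul_of_nonneg_left (one_add_mul_rpow_le (z := z) hp hK hc hw) hC
  have h3 := mul_le_mul_of_nonneg_right h1 (by positivity : 0 ≤ 1 + |z|)
  rw [mul_assoc] at h3
  exact h3.trans h2

lemma abs_comp_le (hp : 0 ≤ p) (hC : 0 ≤ C) (hb : ∀ y, 0 ≤ y → |h y| ≤ C * (1 + y) ^ p)
    {K a c w z : ℝ} (hK : |a - c ^ 2 / 2| ≤ K) (hc : |c| ≤ K) (hw : 0 ≤ w) :
    |h (w * logNormalFactor a c z)| ≤
      C * ((1 + w) ^ p * (Real.exp (p * K) * Real.exp ((p * K + 1) * |z|))) :=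
  (le_mul_of_one_le_right (abs_nonneg _) (by linarith [abs_nonneg z])).trans
    (abs_comp_mul_le hp hC hb hK hc hw)

lemma integrable_comp_logNormalFactor (hp : 0 ≤ p) (hC : 0 ≤ C) (hh : ContinuousOn h (Ici 0))
    (hb : ∀ y, 0 ≤ y → |h y| ≤ C * (1 + y) ^ p) {f₀ : ProbabilityMeasure ℝ≥0}
    (hf₀ : HasMoment p f₀) (a c : ℝ) :
    Integrable (fun z : ℝ≥0 × ℝ => h (z.1 * logNormalFactor a c z.2))
        ((f₀ : Measure ℝ≥0).prod stdGaussian) :=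
  ((integrable_bound hp (max |a - c ^ 2 / 2| |c|) hf₀).const_mul C).mono'
    (continuous_comp_logNormalFactor hh a c).aestronglyMeasurable
    (ae_of_all _ fun z => abs_comp_le hp hC hb (le_max_left _ _) (le_max_right _ _) z.1.coe_nonneg)

lemma continuous_integral_logNormalLaw (hp : 0 ≤ p) (hC : 0 ≤ C) (hh : ContinuousOn h (Ici 0))
    (hb : ∀ y, 0 ≤ y → |h y| ≤ C * (1 + y) ^ p) {f₀ : ProbabilityMeasure ℝ≥0}
    (hf₀ : HasMoment p f₀) {a c : ℝ → ℝ} (ha : Continuous a) (hc : Continuous c) :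
    Continuous (fun τ => ∫ w : ℝ≥0, h w ∂(logNormalLaw f₀ (a τ) (c τ) : Measure ℝ≥0)) := by
  simp only [integral_logNormalLaw _ _ _ (continuous_comp_coe hh).stronglyMeasurable]
  refine continuous_iff_continuousAt.2 fun τ => ?_
  have h1 : Continuous (fun t => max |a t - c t ^ 2 / 2| |c t|) := by fun_prop
  have h2 := h1.continuousAt.eventually_le_const (lt_add_one (max |a τ - c τ ^ 2 / 2| |c τ|))
  refine continuousAt_of_dominated (Eventually.of_forall fun t =>
    (continuous_comp_logNormalFactor hh (a t) (c t)).aestronglyMeasurable) ?_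
    ((integrable_bound hp (max |a τ - c τ ^ 2 / 2| |c τ| + 1) hf₀).const_mul C)
    (ae_of_all _ fun z => ?_)
  · filter_upwards [h2] with t ht
    exact ae_of_all _ fun z => abs_comp_le hp hC hb ((le_max_left _ _).trans ht)
      ((le_max_right _ _).trans ht) z.1.coe_nonneg
  · refine (hh.comp_continuous (f := fun t => (z.1 : ℝ) * logNormalFactor (a t) (c t) z.2) ?_
      fun t => mul_nonneg z.1.coe_nonneg (logNormalFactor_pos _ _ _).le).continuousAt
    unfold logNormalFactor
    fun_prop

end growth

lemma hasMoment_logNormalLaw {p : ℝ} (hp : 0 ≤ p) {f₀ : ProbabilityMeasure ℝ≥0}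
    (hf₀ : HasMoment p f₀) (a c : ℝ) : HasMoment p (logNormalLaw f₀ a c) := by
  have hcont : ContinuousOn (fun y : ℝ => y ^ p) (Ici 0) :=
    (Real.continuous_rpow_const hp).continuousOn
  refine (integrable_logNormalLaw_iff f₀ a c (h := fun y => y ^ p)
    (continuous_comp_coe hcont).stronglyMeasurable).2
    (integrable_comp_logNormalFactor hp zero_le_one hcont (fun y hy => ?_) hf₀ a c)
  rw [abs_of_nonneg (by positivity), one_mul]
  exact Real.rpow_le_rpow hy (by linarith) hp

lemma integral_logNormalFactor (a c : ℝ) :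
    ∫ z, logNormalFactor a c z ∂stdGaussian = Real.exp a := by
  have h1 : ∀ z, logNormalFactor a c z = Real.exp (a - c ^ 2 / 2) * Real.exp (c * z) :=
    fun z => Real.exp_add _ _
  have h2 := congrFun (ProbabilityTheory.mgf_id_gaussianReal (μ := 0) (v := 1)) c
  simp only [ProbabilityTheory.mgf, id, zero_mul, zero_add, NNReal.coe_one, one_mul] at h2
  simp only [h1]
  rw [integral_const_mul, h2, ← Real.exp_add]
  ring_nf

lemma meanWealth_logNormalLaw (f₀ : ProbabilityMeasure ℝ≥0) (a c : ℝ) :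
    meanWealth (logNormalLaw f₀ a c) = meanWealth f₀ * Real.exp a := by
  rw [meanWealth, integral_logNormalLaw f₀ a c (h := fun y => y)
    NNReal.continuous_coe.stronglyMeasurable,
    integral_prod_mul (fun w : ℝ≥0 => (w : ℝ)) (logNormalFactor a c), integral_logNormalFactor]
  rfl

/-- Independence and the Gaussian characteristic function. The exponent `i s (a - c²/2) - s² c²/2`,
regrouped, is the symbol of the limiting equation with drift `a` and diffusion `c²`. -/
lemma logCharFun_logNormalLaw (f₀ : ProbabilityMeasure ℝ≥0) (a c s : ℝ) :
    logCharFun (logNormalLaw f₀ a c) s = logCharFun f₀ s *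
      Complex.exp ((Complex.I * s) * a +
        (Complex.I * s) * (Complex.I * s - 1) / 2 * (c ^ 2 : ℝ)) := by
  rw [logCharFun, integral_logNormalLaw f₀ a c
    ((measurable_logChar s).comp measurable_coe_nnreal_real).stronglyMeasurable]
  simp only [fun z : ℝ≥0 × ℝ => logChar_mul s z.1.coe_nonneg (logNormalFactor_pos a c z.2)]
  rw [integral_prod_mul (fun w : ℝ≥0 => logChar s w) (fun z => logChar s (logNormalFactor a c z)),
    ← logCharFun]
  congr 1
  have h1 : ∀ z : ℝ, logChar s (logNormalFactor a c z) =
      Complex.exp (Complex.I * s * (a - c ^ 2 / 2 : ℝ)) *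
        Complex.exp ((s * c : ℝ) * z * Complex.I) := fun z => by
    rw [logChar, if_pos (logNormalFactor_pos a c z), logNormalFactor, Real.log_exp,
      ← Complex.exp_add]
    push_cast
    ring_nf
  simp only [h1]
  rw [integral_const_mul, ← charFun_apply_real, ProbabilityTheory.charFun_gaussianReal,
    ← Complex.exp_add]
  congr 1
  push_cast
  ring_nf
  simp only [Complex.I_sq]
  ring

/-- Conditionally on the Gaussian variable the law is a dilation of `f₀` by a positive number, hence
absolutely continuous. The argument does not need `c ≠ 0`. -/
lemma HasDensity.logNormalLaw {f₀ : ProbabilityMeasure ℝ≥0} (hf₀ : HasDensity f₀) (a c : ℝ) :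
    HasDensity (logNormalLaw f₀ a c) := by
  refine Measure.AbsolutelyContinuous.mk fun s hs hs0 => ?_
  have hm := (measurable_coe_nnreal_real.comp (measurable_logNormal_map a c))
  rw [coe_logNormalLaw, Measure.map_map measurable_coe_nnreal_real (measurable_logNormal_map a c),
    Measure.map_apply hm hs, Measure.prod_apply_symm (hm hs)]
  refine lintegral_eq_zero_of_ae_eq_zero (ae_of_all _ fun z => ?_)
  have h1 : (fun w : ℝ≥0 => (w, z)) ⁻¹' ((NNReal.toReal ∘ fun z : ℝ≥0 × ℝ =>
      z.1 * (logNormalFactor a c z.2).toNNReal) ⁻¹' s) =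
      (fun w : ℝ≥0 => (w : ℝ)) ⁻¹' ((fun y => logNormalFactor a c z * y) ⁻¹' s) := by
    ext w
    simp only [mem_preimage, Function.comp_def, coe_mul_logNormalFactor]
    rw [mul_comm]
  beta_reduce
  rw [h1, ← Measure.map_apply measurable_coe_nnreal_real (measurable_const_mul _ hs)]
  refine hf₀ ?_
  rw [Real.volume_preimage_mul_left (logNormalFactor_pos a c z).ne', hs0, mul_zero]

/-! ### The Fokker-Planck equation for the log-normal flow -/

lemma hasDerivAt_gaussianPDFReal (z : ℝ) :
    HasDerivAt (ProbabilityTheory.gaussianPDFReal 0 1)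
      (-z * ProbabilityTheory.gaussianPDFReal 0 1 z) z := by
  simp only [ProbabilityTheory.gaussianPDFReal_def, sub_zero, NNReal.coe_one, mul_one]
  have h1 : HasDerivAt (fun x : ℝ => -x ^ 2 / 2) (-z) z := by
    refine ((hasDerivAt_pow 2 z).neg.div_const 2).congr_deriv ?_
    push_cast
    ring
  refine (h1.exp.const_mul _).congr_deriv ?_
  ring

lemma integrable_stdGaussian_iff {h : ℝ → ℝ} : Integrable h stdGaussian ↔
    Integrable (fun z => ProbabilityTheory.gaussianPDFReal 0 1 z * h z) volume := by
  rw [stdGaussian, ProbabilityTheory.gaussianReal_of_var_ne_zero _ one_ne_zero,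
    integrable_withDensity_iff_integrable_smul' (ProbabilityTheory.measurable_gaussianPDF 0 1)
      (ae_of_all _ fun _ => ENNReal.ofReal_lt_top)]
  simp only [ProbabilityTheory.toReal_gaussianPDF, smul_eq_mul]

/-- Gaussian integration by parts. -/
lemma integral_id_mul_stdGaussian {h h' : ℝ → ℝ} (hd : ∀ z, HasDerivAt h (h' z) z)
    (i0 : Integrable h stdGaussian) (i1 : Integrable (fun z => z * h z) stdGaussian)
    (i2 : Integrable h' stdGaussian) :
    ∫ z, z * h z ∂stdGaussian = ∫ z, h' z ∂stdGaussian := by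
  rw [integrable_stdGaussian_iff] at i0 i1 i2
  have key := integral_mul_deriv_eq_deriv_mul_of_integrable (u := h) (u' := h')
    (v := ProbabilityTheory.gaussianPDFReal 0 1)
    (v' := fun z => -z * ProbabilityTheory.gaussianPDFReal 0 1 z) (fun z _ => hd z)
    (fun z _ => hasDerivAt_gaussianPDFReal z)
    (i1.neg.congr (ae_of_all _ fun z => by simp only [Pi.neg_apply, Pi.mul_apply]; ring))
    (i2.congr (ae_of_all _ fun z => by simp only [Pi.mul_apply]; ring))
    (i0.congr (ae_of_all _ fun z => by simp only [Pi.mul_apply]; ring))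
  rw [stdGaussian, ProbabilityTheory.integral_gaussianReal_eq_integral_smul one_ne_zero,
    ProbabilityTheory.integral_gaussianReal_eq_integral_smul one_ne_zero]
  simp only [smul_eq_mul]
  have h1 : ∫ z, h z * (-z * ProbabilityTheory.gaussianPDFReal 0 1 z) =
      -∫ z, ProbabilityTheory.gaussianPDFReal 0 1 z * (z * h z) := by
    rw [← integral_neg]
    exact integral_congr_ae (ae_of_all _ fun z => by ring)
  have h2 : ∫ z, h' z * ProbabilityTheory.gaussianPDFReal 0 1 z =
      ∫ z, ProbabilityTheory.gaussianPDFReal 0 1 z * h' z :=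
    integral_congr_ae (ae_of_all _ fun z => mul_comm _ _)
  rw [h1, h2] at key
  exact neg_injective key

section testFunction

variable {p : ℝ} {φ : ℝ → ℝ}

lemma IsTestFunction.hasDerivWithinAt (hp : 2 < p) (hφ : IsTestFunction p φ) {y : ℝ}
    (hy : 0 ≤ y) : HasDerivWithinAt φ (derivWithin φ (Ici 0) y) (Ici 0) y :=
  ((hφ.contDiffOn_two hp).differentiableOn two_ne_zero y hy).hasDerivWithinAt

lemma IsTestFunction.hasDerivWithinAt_deriv (hp : 2 < p) (hφ : IsTestFunction p φ) {y : ℝ}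
    (hy : 0 ≤ y) :
    HasDerivWithinAt (derivWithin φ (Ici 0)) (iteratedDerivWithin 2 φ (Ici 0) y) (Ici 0) y := by
  have h := (hφ.contDiffOn_two hp).differentiableOn_iteratedDerivWithin (m := 1)
    (by norm_num) (uniqueDiffOn_Ici 0) y hy
  have h' := h.hasDerivWithinAt
  rw [← iteratedDerivWithin_succ, iteratedDerivWithin_one] at h'
  exact h'

lemma IsTestFunction.continuousOn_mul_deriv (hp : 2 < p) (hφ : IsTestFunction p φ) :
    ContinuousOn (fun y => y * derivWithin φ (Ici 0) y) (Ici 0) :=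
  continuousOn_id.mul ((hφ.contDiffOn_two hp).continuousOn_derivWithin (uniqueDiffOn_Ici 0)
    (by norm_num))

lemma IsTestFunction.continuousOn_sq_mul_deriv (hp : 2 < p) (hφ : IsTestFunction p φ) :
    ContinuousOn (fun y => y ^ 2 * iteratedDerivWithin 2 φ (Ici 0) y) (Ici 0) :=
  (continuousOn_id.pow 2).mul ((hφ.contDiffOn_two hp).continuousOn_iteratedDerivWithin
    (m := 2) le_rfl (uniqueDiffOn_Ici 0))

lemma IsTestFunction.exists_bound (hp : 2 < p) (hφ : IsTestFunction p φ) :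
    ∃ C, 0 ≤ C ∧ (∀ y, 0 ≤ y → |φ y| ≤ C * (1 + y) ^ p) ∧
      (∀ y, 0 ≤ y → |y * derivWithin φ (Ici 0) y| ≤ C * (1 + y) ^ p) ∧
      (∀ y, 0 ≤ y → |y ^ 2 * iteratedDerivWithin 2 φ (Ici 0) y| ≤ C * (1 + y) ^ p) := by
  obtain ⟨C, hC, h⟩ := hφ.exists_growth hp
  have hpow : ∀ y : ℝ, 0 ≤ y → ∀ j : ℕ, y ^ j * (1 + y) ^ (p - j) ≤ (1 + y) ^ p := by
    intro y hy j
    have h1 : (1 + y) ^ p = (1 + y) ^ j * (1 + y) ^ (p - j) := by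
      rw [← Real.rpow_natCast, ← Real.rpow_add (by linarith)]
      ring_nf
    rw [h1]
    gcongr
    linarith
  have hmain : ∀ j : ℕ, j ≤ 2 → ∀ y, 0 ≤ y →
      |y ^ j * iteratedDerivWithin j φ (Ici 0) y| ≤ C * (1 + y) ^ p := by
    intro j hj y hy
    rw [abs_mul, abs_of_nonneg (by positivity : 0 ≤ y ^ j)]
    calc y ^ j * |iteratedDerivWithin j φ (Ici 0) y| ≤ y ^ j * (C * (1 + y) ^ (p - j)) := by
          gcongr; exact h j hj y hy
      _ = C * (y ^ j * (1 + y) ^ (p - j)) := by ring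
      _ ≤ C * (1 + y) ^ p := by gcongr; exact hpow y hy j
  refine ⟨C, hC, fun y hy => ?_, fun y hy => ?_, hmain 2 le_rfl⟩
  · simpa [iteratedDerivWithin_zero] using hmain 0 (by norm_num) y hy
  · simpa [iteratedDerivWithin_one] using hmain 1 (by norm_num) y hy

/-- Integration by parts for the log-normal law. -/
lemma integral_mul_deriv_mul_id (hp : 2 < p) (hφ : IsTestFunction p φ)
    {f₀ : ProbabilityMeasure ℝ≥0} (hf₀ : HasMoment p f₀) (a c : ℝ) :
    Integrable (fun z : ℝ≥0 × ℝ => z.2 * (z.1 * logNormalFactor a c z.2 *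
      derivWithin φ (Ici 0) (z.1 * logNormalFactor a c z.2)))
      ((f₀ : Measure ℝ≥0).prod stdGaussian) ∧
    ∫ z : ℝ≥0 × ℝ, z.2 * (z.1 * logNormalFactor a c z.2 *
        derivWithin φ (Ici 0) (z.1 * logNormalFactor a c z.2))
        ∂((f₀ : Measure ℝ≥0).prod stdGaussian) =
      c * (∫ w : ℝ≥0, (w : ℝ) * derivWithin φ (Ici 0) w ∂(logNormalLaw f₀ a c : Measure ℝ≥0)) +
      c * ∫ w : ℝ≥0, (w : ℝ) ^ 2 * iteratedDerivWithin 2 φ (Ici 0) w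
        ∂(logNormalLaw f₀ a c : Measure ℝ≥0) := by
  have hp0 : 0 ≤ p := by linarith
  obtain ⟨C, hC, -, hb1, hb2⟩ := hφ.exists_bound hp
  have hc1 := hφ.continuousOn_mul_deriv hp
  have hc2 := hφ.continuousOn_sq_mul_deriv hp
  set h1 : ℝ → ℝ := fun y => y * derivWithin φ (Ici 0) y with hh1
  set h2 : ℝ → ℝ := fun y => y ^ 2 * iteratedDerivWithin 2 φ (Ici 0) y with hh2
  set K := max |a - c ^ 2 / 2| |c| with hK
  have i1 := integrable_comp_logNormalFactor hp0 hC hc1 hb1 hf₀ a c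
  have i2 := integrable_comp_logNormalFactor hp0 hC hc2 hb2 hf₀ a c
  have i3 : Integrable (fun z : ℝ≥0 × ℝ => z.2 * h1 (z.1 * logNormalFactor a c z.2))
      ((f₀ : Measure ℝ≥0).prod stdGaussian) := by
    refine ((integrable_bound hp0 K hf₀).const_mul C).mono'
      (continuous_snd.mul (continuous_comp_logNormalFactor hc1 a c)).aestronglyMeasurable
      (ae_of_all _ fun z => ?_)
    refine le_trans ?_ (abs_comp_mul_le hp0 hC hb1 (le_max_left _ _) (le_max_right _ _)
      z.1.coe_nonneg)
    rw [Real.norm_eq_abs, abs_mul, mul_comm]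
    gcongr
    linarith
  refine ⟨i3, ?_⟩
  -- For fixed `w` and `y = w X(z)`, one has `dy/dz = c y`, so `d/dz (y φ'(y)) = c (y φ' + y² φ'')`.
  have hstein : ∀ᵐ w : ℝ≥0 ∂(f₀ : Measure ℝ≥0),
      ∫ z, z * h1 ((w : ℝ) * logNormalFactor a c z) ∂stdGaussian =
      ∫ z, (c * h1 ((w : ℝ) * logNormalFactor a c z) + c * h2 ((w : ℝ) * logNormalFactor a c z))
        ∂stdGaussian := by
    filter_upwards [i1.prod_right_ae, i2.prod_right_ae, i3.prod_right_ae] with w j1 j2 j3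
    refine integral_id_mul_stdGaussian (fun z => ?_) j1 j3 ((j1.const_mul c).add (j2.const_mul c))
    have hX : HasDerivAt (fun z => (w : ℝ) * logNormalFactor a c z)
        (w * (logNormalFactor a c z * c)) z := by
      unfold logNormalFactor
      have : HasDerivAt (fun z : ℝ => a - c ^ 2 / 2 + c * z) c z := by
        simpa using ((hasDerivAt_id z).const_mul c).const_add (a - c ^ 2 / 2)
      exact this.exp.const_mul (w : ℝ)
    have hpos : ∀ z, 0 ≤ (w : ℝ) * logNormalFactor a c z := fun z =>
      mul_nonneg w.coe_nonneg (logNormalFactor_pos a c z).le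
    have hd := ((hasDerivWithinAt_id _ _).mul (hφ.hasDerivWithinAt_deriv hp (hpos z))).comp_hasDerivAt
      z hX (Eventually.of_forall hpos)
    refine hd.congr_deriv ?_
    simp only [hh1, hh2, id]
    ring
  have e1 : ∫ w : ℝ≥0, (w : ℝ) * derivWithin φ (Ici 0) w ∂(logNormalLaw f₀ a c : Measure ℝ≥0) =
      ∫ z : ℝ≥0 × ℝ, h1 (z.1 * logNormalFactor a c z.2) ∂((f₀ : Measure ℝ≥0).prod stdGaussian) :=
    integral_logNormalLaw f₀ a c (h := h1) (continuous_comp_coe hc1).stronglyMeasurable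
  have e2 : ∫ w : ℝ≥0, (w : ℝ) ^ 2 * iteratedDerivWithin 2 φ (Ici 0) w
      ∂(logNormalLaw f₀ a c : Measure ℝ≥0) =
      ∫ z : ℝ≥0 × ℝ, h2 (z.1 * logNormalFactor a c z.2) ∂((f₀ : Measure ℝ≥0).prod stdGaussian) :=
    integral_logNormalLaw f₀ a c (h := h2) (continuous_comp_coe hc2).stronglyMeasurable
  rw [e1, e2, ← integral_const_mul, ← integral_const_mul,
    ← integral_add (i1.const_mul c) (i2.const_mul c), integral_prod _ i3,
    integral_prod _ ((i1.const_mul c).fun_add (i2.const_mul c))]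
  exact integral_congr_ae hstein

/-- With `y = w X_t`, the time derivative of `φ(y)` is `y φ'(y) (a' - c c' + c' z)`. Integration by
parts in `z` turns the last term into `c c' (y φ' + y² φ'')`, whose first half cancels the Itô
correction `-c c'`. Positive times only: `c` will be a square root vanishing at 0. -/
lemma hasDerivAt_integral_logNormalLaw (hp : 2 < p) (hφ : IsTestFunction p φ)
    {f₀ : ProbabilityMeasure ℝ≥0} (hf₀ : HasMoment p f₀) {a c a' c' : ℝ → ℝ}
    (ha : ∀ t, 0 < t → HasDerivAt a (a' t) t) (hc : ∀ t, 0 < t → HasDerivAt c (c' t) t)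
    (ha' : ContinuousOn a' (Ioi 0)) (hc' : ContinuousOn c' (Ioi 0)) {τ : ℝ} (hτ : 0 < τ) :
    HasDerivAt (fun t => ∫ w : ℝ≥0, φ w ∂(logNormalLaw f₀ (a t) (c t) : Measure ℝ≥0))
      (a' τ * (∫ w : ℝ≥0, (w : ℝ) * derivWithin φ (Ici 0) w
          ∂(logNormalLaw f₀ (a τ) (c τ) : Measure ℝ≥0)) +
        c τ * c' τ * ∫ w : ℝ≥0, (w : ℝ) ^ 2 * iteratedDerivWithin 2 φ (Ici 0) w
          ∂(logNormalLaw f₀ (a τ) (c τ) : Measure ℝ≥0)) τ := by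
  have hp0 : 0 ≤ p := by linarith
  obtain ⟨C, hC, hb0, hb1, -⟩ := hφ.exists_bound hp
  have hc0 : ContinuousOn φ (Ici 0) := (hφ.contDiffOn_two hp).continuousOn
  have hc1 := hφ.continuousOn_mul_deriv hp
  set h1 : ℝ → ℝ := fun y => y * derivWithin φ (Ici 0) y with hh1
  have hsub : Icc (τ / 2) (2 * τ) ⊆ Ioi 0 := fun t ht => (half_pos hτ).trans_le ht.1
  have hacont : ContinuousOn a (Ioi 0) := fun t ht => (ha t ht).continuousAt.continuousWithinAt
  have hccont : ContinuousOn c (Ioi 0) := fun t ht => (hc t ht).continuousAt.continuousWithinAt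
  obtain ⟨K, hK⟩ : ∃ K, ∀ t ∈ Icc (τ / 2) (2 * τ), |a t - c t ^ 2 / 2| ≤ K ∧ |c t| ≤ K ∧
      |a' t - c t * c' t| ≤ K ∧ |c' t| ≤ K := by
    obtain ⟨K1, h1⟩ := isCompact_Icc.exists_bound_of_continuousOn
      ((hacont.sub ((hccont.pow 2).div_const 2)).mono hsub)
    obtain ⟨K2, h2⟩ := isCompact_Icc.exists_bound_of_continuousOn (hccont.mono hsub)
    obtain ⟨K3, h3⟩ := isCompact_Icc.exists_bound_of_continuousOn
      ((ha'.sub (hccont.mul hc')).mono hsub)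
    obtain ⟨K4, h4⟩ := isCompact_Icc.exists_bound_of_continuousOn (hc'.mono hsub)
    refine ⟨max (max K1 K2) (max K3 K4), fun t ht => ⟨?_, ?_, ?_, ?_⟩⟩
    · exact (h1 t ht).trans ((le_max_left _ _).trans (le_max_left _ _))
    · exact (h2 t ht).trans ((le_max_right _ _).trans (le_max_left _ _))
    · exact (h3 t ht).trans ((le_max_left _ _).trans (le_max_right _ _))
    · exact (h4 t ht).trans ((le_max_right _ _).trans (le_max_right _ _))
  have hnhds : Icc (τ / 2) (2 * τ) ∈ 𝓝 τ := Icc_mem_nhds (by linarith) (by linarith)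
  have hτmem : τ ∈ Icc (τ / 2) (2 * τ) := mem_of_mem_nhds hnhds
  have hK0 : 0 ≤ K := (abs_nonneg _).trans (hK τ hτmem).2.1
  let G : ℝ → ℝ≥0 × ℝ → ℝ := fun t z => φ (z.1 * logNormalFactor (a t) (c t) z.2)
  let G' : ℝ → ℝ≥0 × ℝ → ℝ := fun t z =>
    h1 (z.1 * logNormalFactor (a t) (c t) z.2) * (a' t - c t * c' t + c' t * z.2)
  have hmain := hasDerivAt_integral_of_dominated_loc_of_deriv_le
    (μ := (f₀ : Measure ℝ≥0).prod stdGaussian) (F := G) (F' := G') (x₀ := τ)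
    (bound := fun z => C * ((1 + (z.1 : ℝ)) ^ p *
      (Real.exp (p * K) * Real.exp ((p * K + 1) * |z.2|))) * K) hnhds
    (Eventually.of_forall fun t =>
      (continuous_comp_logNormalFactor hc0 (a t) (c t)).aestronglyMeasurable)
    (integrable_comp_logNormalFactor hp0 hC hc0 hb0 hf₀ (a τ) (c τ))
    (((continuous_comp_logNormalFactor hc1 (a τ) (c τ)).mul (by fun_prop)).aestronglyMeasurable)
    (ae_of_all _ fun z t ht => ?_) (((integrable_bound hp0 K hf₀).const_mul C).mul_const K)
    (ae_of_all _ fun z t ht => ?_)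
  · have hderiv := hmain.2
    simp only [integral_logNormalLaw _ _ _ (continuous_comp_coe hc0).stronglyMeasurable]
    refine hderiv.congr_deriv ?_
    have i1 := integrable_comp_logNormalFactor hp0 hC hc1 hb1 hf₀ (a τ) (c τ)
    have i3 := integral_mul_deriv_mul_id hp hφ hf₀ (a τ) (c τ)
    have e1 : ∫ w : ℝ≥0, (w : ℝ) * derivWithin φ (Ici 0) w
        ∂(logNormalLaw f₀ (a τ) (c τ) : Measure ℝ≥0) =
        ∫ z : ℝ≥0 × ℝ, h1 (z.1 * logNormalFactor (a τ) (c τ) z.2)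
          ∂((f₀ : Measure ℝ≥0).prod stdGaussian) :=
      integral_logNormalLaw f₀ (a τ) (c τ) (h := h1) (continuous_comp_coe hc1).stronglyMeasurable
    have e3 : ∫ z, G' τ z ∂((f₀ : Measure ℝ≥0).prod stdGaussian) =
        (a' τ - c τ * c' τ) * (∫ z : ℝ≥0 × ℝ, h1 (z.1 * logNormalFactor (a τ) (c τ) z.2)
          ∂((f₀ : Measure ℝ≥0).prod stdGaussian)) +
        c' τ * ∫ z : ℝ≥0 × ℝ, z.2 * h1 (z.1 * logNormalFactor (a τ) (c τ) z.2)
          ∂((f₀ : Measure ℝ≥0).prod stdGaussian) := by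
      rw [← integral_const_mul, ← integral_const_mul,
        ← integral_add (i1.const_mul _) (i3.1.const_mul _)]
      refine integral_congr_ae (ae_of_all _ fun z => ?_)
      simp only [G', hh1]
      ring
    rw [e3, i3.2, e1]
    ring
  · obtain ⟨k1, k2, k3, k4⟩ := hK t ht
    have h3 : |a' t - c t * c' t + c' t * z.2| ≤ (1 + |z.2|) * K := by
      refine (abs_add_le _ _).trans ?_
      rw [abs_mul]
      nlinarith [abs_nonneg z.2]
    have h4 := mul_le_mul_of_nonneg_right
      (abs_comp_mul_le (z := z.2) hp0 hC hb1 k1 k2 z.1.coe_nonneg) hK0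
    rw [Real.norm_eq_abs, abs_mul]
    refine le_trans ?_ h4
    rw [mul_assoc]
    exact mul_le_mul_of_nonneg_left h3 (abs_nonneg _)
  · have ht0 := hsub ht
    have hE : HasDerivAt (fun t => a t - c t ^ 2 / 2 + c t * z.2)
        (a' t - c t * c' t + c' t * z.2) t := by
      refine (((ha t ht0).sub (((hc t ht0).pow 2).div_const 2)).add
        ((hc t ht0).mul_const z.2)).congr_deriv ?_
      push_cast
      ring
    have hX := hE.exp.const_mul (z.1 : ℝ)
    have hpos : ∀ t, 0 ≤ (z.1 : ℝ) * logNormalFactor (a t) (c t) z.2 := fun t =>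
      mul_nonneg z.1.coe_nonneg (logNormalFactor_pos _ _ _).le
    refine ((hφ.hasDerivWithinAt hp (hpos t)).comp_hasDerivAt t hX
      (Eventually.of_forall hpos)).congr_deriv ?_
    simp only [G', hh1, logNormalFactor]
    ring

end testFunction

/-- The log-normal flow solves the Fokker-Planck equation. -/
lemma isFokkerPlanckSolution_logNormalLaw {p : ℝ} (hp : 2 < p) {f₀ : ProbabilityMeasure ℝ≥0}
    (hf₀ : HasMoment p f₀) {A B a c c' : ℝ → ℝ} (hA : Continuous A) (hB : Continuous B)
    (hac : Continuous a) (hcc : Continuous c) (ha0 : a 0 = 0) (hc0 : c 0 = 0)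
    (ha : ∀ t, 0 < t → HasDerivAt a (A t) t) (hc : ∀ t, 0 < t → HasDerivAt c (c' t) t)
    (hc' : ContinuousOn c' (Ioi 0)) (hcB : ∀ t, 0 < t → c t * c' t = 1 / 2 * B t) :
    IsFokkerPlanckSolution p A B f₀ (fun τ => logNormalLaw f₀ (a τ) (c τ)) := by
  have hp0 : 0 ≤ p := by linarith
  have heq : ∀ φ, IsTestFunction p φ → ∀ τ, 0 < τ → HasDerivAt
      (fun t => ∫ w : ℝ≥0, φ w ∂(logNormalLaw f₀ (a t) (c t) : Measure ℝ≥0))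
      (A τ * (∫ w : ℝ≥0, (w : ℝ) * derivWithin φ (Ici 0) w
          ∂(logNormalLaw f₀ (a τ) (c τ) : Measure ℝ≥0)) +
        1 / 2 * B τ * ∫ w : ℝ≥0, (w : ℝ) ^ 2 * iteratedDerivWithin 2 φ (Ici 0) w
          ∂(logNormalLaw f₀ (a τ) (c τ) : Measure ℝ≥0)) τ := fun φ hφ τ hτ => by
    rw [← hcB τ hτ]
    exact hasDerivAt_integral_logNormalLaw hp hφ hf₀ ha hc hA.continuousOn hc' hτ
  have hcont : ∀ φ, IsTestFunction p φ →
      Continuous (fun t => ∫ w : ℝ≥0, φ w ∂(logNormalLaw f₀ (a t) (c t) : Measure ℝ≥0)) :=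
    fun φ hφ => by
      obtain ⟨C, hC, hb0, -⟩ := hφ.exists_bound hp
      exact continuous_integral_logNormalLaw hp0 hC (hφ.contDiffOn_two hp).continuousOn hb0 hf₀
        hac hcc
  refine ⟨⟨fun t _ => hasMoment_logNormalLaw hp0 hf₀ _ _, fun φ hφ => ?_⟩, heq, fun φ hφ => ?_⟩
  · obtain ⟨C, hC, -, hb1, hb2⟩ := hφ.exists_bound hp
    obtain ⟨G, hG⟩ : ∃ G : ℝ → ℝ, G = fun τ => A τ * (∫ w : ℝ≥0, (w : ℝ) * derivWithin φ (Ici 0) w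
          ∂(logNormalLaw f₀ (a τ) (c τ) : Measure ℝ≥0)) +
        1 / 2 * B τ * ∫ w : ℝ≥0, (w : ℝ) ^ 2 * iteratedDerivWithin 2 φ (Ici 0) w
          ∂(logNormalLaw f₀ (a τ) (c τ) : Measure ℝ≥0) := ⟨_, rfl⟩
    have heqG : ∀ τ, 0 < τ → HasDerivAt
        (fun t => ∫ w : ℝ≥0, φ w ∂(logNormalLaw f₀ (a t) (c t) : Measure ℝ≥0)) (G τ) τ := by
      rw [hG]
      exact heq φ hφ
    have hGc : Continuous G := by
      rw [hG]
      exact (hA.mul (continuous_integral_logNormalLaw hp0 hC (hφ.continuousOn_mul_deriv hp) hb1 hf₀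
        hac hcc)).add ((continuous_const.mul hB).mul (continuous_integral_logNormalLaw hp0 hC
        (hφ.continuousOn_sq_mul_deriv hp) hb2 hf₀ hac hcc))
    have hd : ∀ τ ∈ Ici (0 : ℝ), HasDerivWithinAt
        (fun t => ∫ w : ℝ≥0, φ w ∂(logNormalLaw f₀ (a t) (c t) : Measure ℝ≥0)) (G τ) (Ici 0) τ := by
      intro τ hτ
      rcases (mem_Ici.1 hτ).eq_or_lt with rfl | hτ
      -- At time 0 the volatility need not be differentiable; the one-sided derivative of the
      -- integral is obtained as the limit of its derivatives at positive times.
      · refine hasDerivWithinAt_Ici_of_tendsto_deriv (s := Ioi 0)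
          (fun t ht => (heqG t ht).differentiableAt.differentiableWithinAt)
          (hcont φ hφ).continuousWithinAt self_mem_nhdsWithin ?_
        refine (hGc.continuousAt.mono_left nhdsWithin_le_nhds).congr' ?_
        filter_upwards [self_mem_nhdsWithin] with t ht
        exact (heqG t ht).deriv.symm
      · exact (heqG τ hτ).hasDerivWithinAt
    refine (contDiffOn_one_iff_derivWithin (uniqueDiffOn_Ici 0)).2
      ⟨fun τ hτ => (hd τ hτ).differentiableWithinAt, ?_⟩
    exact hGc.continuousOn.congr fun τ hτ => (hd τ hτ).derivWithin (uniqueDiffOn_Ici 0 τ hτ)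
  · have h1 := (hcont φ hφ).tendsto 0
    have h2 : ∫ w : ℝ≥0, φ w ∂(logNormalLaw f₀ (a 0) (c 0) : Measure ℝ≥0) =
        ∫ w : ℝ≥0, φ w ∂(f₀ : Measure ℝ≥0) := by
      rw [integral_logNormalLaw f₀ _ _
        (continuous_comp_coe (hφ.contDiffOn_two hp).continuousOn).stronglyMeasurable, ha0, hc0]
      simp only [logNormalFactor, ne_eq, OfNat.ofNat_ne_zero, not_false_eq_true, zero_pow,
        zero_div, sub_zero, zero_mul, add_zero, Real.exp_zero, mul_one]
      rw [integral_fun_fst (fun w : ℝ≥0 => φ w)]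
      simp
    rw [h2] at h1
    exact h1.mono_left nhdsWithin_le_nhds

/-! ### Weak convergence and compactness -/

/-- `1 - logChar 0` is the indicator of zero wealth; since `Real.log 0 = 0`, an atom there adds a
constant to the characteristic function of `log w`. -/
lemma exp_log_eq_logChar (s : ℝ) (w : ℝ≥0) :
    Complex.exp (s * (Real.log w : ℝ) * Complex.I) = logChar s w + (1 - logChar 0 w) := by
  rcases eq_or_ne w 0 with rfl | hw
  · simp [logChar]
  · have hw' : (0 : ℝ) < w := by exact_mod_cast pos_iff_ne_zero.2 hw
    simp [logChar, hw']

lemma measurable_log_coe : Measurable (fun w : ℝ≥0 => Real.log w) :=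
  Real.measurable_log.comp measurable_coe_nnreal_real

/-- Convergence of the characteristic functions of the logarithm of wealth implies weak
convergence. -/
lemma tendsto_of_tendsto_logCharFun {f : ℕ → ProbabilityMeasure ℝ≥0} {g : ProbabilityMeasure ℝ≥0}
    (h : ∀ s, Tendsto (fun j => logCharFun (f j) s) atTop (𝓝 (logCharFun g s))) :
    Tendsto f atTop (𝓝 g) := by
  let law : ProbabilityMeasure ℝ≥0 → ProbabilityMeasure ℝ := fun f =>
    f.map measurable_log_coe.aemeasurable
  have hint : ∀ f : ProbabilityMeasure ℝ≥0, Integrable (fun w : ℝ≥0 => 1 - logChar 0 w)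
      (f : Measure ℝ≥0) := fun f => (integrable_const _).sub (integrable_logChar f 0)
  have hchar : ∀ f s, charFun (law f : Measure ℝ) s =
      logCharFun f s + (1 - logCharFun f 0) := fun f s => by
    have e : (law f : Measure ℝ) = (f : Measure ℝ≥0).map (fun w : ℝ≥0 => Real.log w) := rfl
    rw [charFun_apply_real, e,
      integral_map measurable_log_coe.aemeasurable (by fun_prop)]
    simp only [exp_log_eq_logChar]
    rw [integral_add (integrable_logChar f s) (hint f),
      integral_sub (integrable_const _) (integrable_logChar f 0)]
    simp [logCharFun]
  have hlaw : Tendsto (fun j => law (f j)) atTop (𝓝 (law g)) := by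
    refine ProbabilityMeasure.tendsto_iff_tendsto_charFun.2 fun s => ?_
    simp only [hchar]
    exact (h s).add (tendsto_const_nhds.sub (h 0))
  rw [ProbabilityMeasure.tendsto_iff_forall_integral_tendsto] at hlaw ⊢
  intro φ
  let ψ : BoundedContinuousFunction ℝ ℝ :=
    φ.compContinuous ⟨fun x : ℝ => (Real.exp x).toNNReal, by fun_prop⟩
  -- The logarithm sends both 0 and 1 to 0. The correction separates them again, and its integral is
  -- controlled by the transform at `s = 0`.
  have hψ : ∀ w : ℝ≥0, φ w = ψ (Real.log w) - (φ 1 - φ 0) * (1 - logChar 0 w).re := by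
    intro w
    rcases eq_or_ne w 0 with rfl | hw
    · simp [logChar, ψ]
    · have hw' : (0 : ℝ) < w := by exact_mod_cast pos_iff_ne_zero.2 hw
      simp [logChar, hw', ψ, Real.exp_log hw']
  have hφ : ∀ f : ProbabilityMeasure ℝ≥0, ∫ w, φ w ∂(f : Measure ℝ≥0) =
      ∫ x, ψ x ∂(law f : Measure ℝ) - (φ 1 - φ 0) * (1 - logCharFun f 0).re := by
    intro f
    have e : (law f : Measure ℝ) = (f : Measure ℝ≥0).map (fun w : ℝ≥0 => Real.log w) := rfl
    have i1 : Integrable (fun w : ℝ≥0 => ψ (Real.log w)) (f : Measure ℝ≥0) :=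
      integrable_of_norm_le_const
        (ψ.continuous.measurable.comp measurable_log_coe).aestronglyMeasurable
        fun w => ψ.norm_coe_le_norm _
    have e2 : 1 - logCharFun f 0 = ∫ w : ℝ≥0, (1 - logChar 0 w) ∂(f : Measure ℝ≥0) := by
      rw [integral_sub (integrable_const _) (integrable_logChar f 0)]
      simp [logCharFun]
    have e3 : (∫ w : ℝ≥0, (1 - logChar 0 w) ∂(f : Measure ℝ≥0)).re =
        ∫ w : ℝ≥0, (1 - logChar 0 w).re ∂(f : Measure ℝ≥0) := (integral_re (hint f)).symm
    have i2 : Integrable (fun w : ℝ≥0 => (φ 1 - φ 0) * (1 - logChar 0 w).re) (f : Measure ℝ≥0) :=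
      (hint f).re.const_mul _
    rw [e, integral_map measurable_log_coe.aemeasurable
      ψ.continuous.aestronglyMeasurable, e2, e3, ← integral_const_mul,
      ← integral_sub i1 i2]
    exact integral_congr_ae (ae_of_all _ fun w => hψ w)
  simp only [hφ]
  exact (hlaw ψ).sub (tendsto_const_nhds.mul
    ((Complex.continuous_re.tendsto _).comp (tendsto_const_nhds.sub (h 0))))

/-- A sequence of uniformly Lipschitz functions which is bounded at the origin has a subsequence
which converges pointwise. -/
lemma exists_subseq_tendsto_of_lipschitz {u : ℕ → ℝ → ℝ} {B C : ℝ}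
    (hL : ∀ k s t, 0 ≤ s → 0 ≤ t → |u k s - u k t| ≤ C * |s - t|) (h0 : ∀ k, |u k 0| ≤ B) :
    ∃ i : ℕ → ℕ, StrictMono i ∧ ∀ τ, 0 ≤ τ → ∃ l, Tendsto (fun j => u (i j) τ) atTop (𝓝 l) := by
  -- Tychonoff on the rationals gives convergence on a countable dense set of times; absolute values
  -- keep the times nonnegative. The Lipschitz bound extends it to all times.
  have hcomp : IsCompact (Set.pi univ fun q : ℚ => Icc (-(B + C * |(q : ℝ)|)) (B + C * |(q : ℝ)|)) :=
    isCompact_univ_pi fun q => isCompact_Icc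
  have hmem : ∀ k, (fun q : ℚ => u k |(q : ℝ)|) ∈
      Set.pi univ fun q : ℚ => Icc (-(B + C * |(q : ℝ)|)) (B + C * |(q : ℝ)|) := by
    intro k q _
    have h1 := hL k |(q : ℝ)| 0 (abs_nonneg _) le_rfl
    rw [sub_zero, abs_abs] at h1
    have h2 := abs_sub_abs_le_abs_sub (u k |(q : ℝ)|) (u k 0)
    exact abs_le.1 (by linarith [h0 k])
  obtain ⟨x, -, i, hi, hx⟩ := hcomp.tendsto_subseq hmem
  refine ⟨i, hi, fun τ hτ => ?_⟩
  refine cauchySeq_tendsto_of_complete (Metric.cauchySeq_iff.2 fun ε hε => ?_)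
  have hC : 0 < |C| + 1 := by positivity
  obtain ⟨q, hq1, hq2⟩ := exists_rat_btwn (show τ < τ + ε / (3 * (|C| + 1)) by
    linarith [show 0 < ε / (3 * (|C| + 1)) by positivity])
  have hq0 : 0 ≤ (q : ℝ) := hτ.trans hq1.le
  have hclose : ∀ k, |u k τ - u k q| ≤ ε / 3 := fun k => by
    refine (hL k τ q hτ hq0).trans ?_
    have h1 : |τ - q| ≤ ε / (3 * (|C| + 1)) := by
      rw [abs_of_neg (by linarith)]
      linarith
    calc C * |τ - q| ≤ (|C| + 1) * (ε / (3 * (|C| + 1))) :=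
          mul_le_mul (by linarith [le_abs_self C]) h1 (abs_nonneg _) hC.le
      _ = ε / 3 := by field_simp
  have hqlim : Tendsto (fun j => u (i j) q) atTop (𝓝 (x q)) := by
    have := (tendsto_pi_nhds.1 hx) q
    simpa [Function.comp_def, abs_of_nonneg hq0] using this
  obtain ⟨N, hN⟩ := Metric.cauchySeq_iff.1 hqlim.cauchySeq (ε / 3) (by positivity)
  refine ⟨N, fun a ha b hb => ?_⟩
  have h1 := hN a ha b hb
  have h2 := abs_le.1 (hclose (i a))
  have h3 := abs_le.1 (hclose (i b))
  rw [Real.dist_eq] at h1 ⊢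
  have h4 := abs_lt.1 h1
  rw [abs_lt]
  constructor <;> linarith [h2.1, h2.2, h3.1, h3.2, h4.1, h4.2]

/-! ### Estimates for the symbol and for the noise -/

namespace Market

variable {M : Market} {r σ lam ν S S' s₀ : ℝ}

/-- The slope bound with a constant independent of the price. The future price is controlled only
through its bond value, and may vanish a priori; this transfers continuity to it. -/
lemma mul_abs_sub_le_bondValue (hS : 0 ≤ S) (hS' : 0 ≤ S') :
    (1 - M.μ 0) / M.μ 0 * |S - S'| ≤ |M.bondValue S - M.bondValue S'| := by
  wlog h : S' ≤ S generalizing S S'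
  · rw [abs_sub_comm, abs_sub_comm (M.bondValue S)]
    exact this hS' hS (not_le.1 h).le
  have h1 := sub_mul_le_bondValue_sub (M := M) hS' h
  have h2 : (1 - M.μ 0) / M.μ 0 ≤ (1 - M.μ S') / M.μ S' := by
    have := M.μ_antitone self_mem_Ici hS' hS'
    rw [div_le_div_iff₀ (M.μ_pos 0 le_rfl) (M.μ_pos S' hS')]
    nlinarith
  rw [abs_of_nonneg (sub_nonneg.2 h), mul_comm]
  exact ((mul_le_mul_of_nonneg_left h2 (sub_nonneg.2 h)).trans h1).trans (le_abs_self _)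

lemma continuousOn_of_continuousOn_bondValue {T : ℝ → ℝ} {s : Set ℝ} (hT : ∀ t ∈ s, 0 ≤ T t)
    (h : ContinuousOn (fun t => M.bondValue (T t)) s) : ContinuousOn T s := by
  intro t ht
  have hc : 0 < (1 - M.μ 0) / M.μ 0 := div_pos (sub_pos.2 M.μ_zero_lt_one) (M.μ_pos 0 le_rfl)
  have h1 := (tendsto_iff_dist_tendsto_zero.1 (h t ht)).div_const ((1 - M.μ 0) / M.μ 0)
  rw [zero_div] at h1
  refine tendsto_iff_dist_tendsto_zero.2 (squeeze_zero' (Eventually.of_forall fun _ => dist_nonneg)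
    ?_ h1)
  filter_upwards [self_mem_nhdsWithin] with x hx
  rw [le_div_iff₀ hc, Real.dist_eq, Real.dist_eq, mul_comm]
  exact mul_abs_sub_le_bondValue (hT x hx) (hT t ht)

/-- The symbol of the limiting equation on the function `w ^ (i s)`. -/
noncomputable def symbol (s A B : ℝ) : ℂ :=
  (Complex.I * s) * (A : ℂ) + (Complex.I * s) * (Complex.I * s - 1) / 2 * (B : ℂ)

lemma norm_symbol_coeff_le (s : ℝ) :
    ‖(Complex.I * s) * (Complex.I * s - 1) / 2‖ ≤ |s| * (|s| + 1) := by
  have h1 : ‖Complex.I * s‖ = |s| := by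
    rw [norm_mul, Complex.norm_I, one_mul, Complex.norm_real, Real.norm_eq_abs]
  have h2 : ‖Complex.I * s - 1‖ ≤ |s| + 1 :=
    (norm_sub_le _ _).trans (by rw [h1, norm_one])
  rw [norm_div, norm_mul, h1, Complex.norm_ofNat]
  have h3 : 0 ≤ |s| * ‖Complex.I * s - 1‖ := by positivity
  have h4 := mul_le_mul_of_nonneg_left h2 (abs_nonneg s)
  linarith

lemma norm_symbol_le (s : ℝ) {A B KA KB : ℝ} (hA : |A| ≤ KA) (hB : |B| ≤ KB) :
    ‖symbol s A B‖ ≤ |s| * KA + |s| * (|s| + 1) * KB := by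
  have h1 : ‖Complex.I * s‖ = |s| := by
    rw [norm_mul, Complex.norm_I, one_mul, Complex.norm_real, Real.norm_eq_abs]
  unfold symbol
  refine (norm_add_le _ _).trans (add_le_add ?_ ?_)
  · rw [norm_mul, h1, Complex.norm_real, Real.norm_eq_abs]
    gcongr
  · rw [norm_mul, Complex.norm_real, Real.norm_eq_abs]
    exact mul_le_mul (norm_symbol_coeff_le s) hB (abs_nonneg _) (by positivity)

/-- The constant in the estimate of the second moment of the relative gain. -/
noncomputable def momentBound (M : Market) (lam s₀ : ℝ) : ℝ :=
  1 + 2 * M.returnBound lam s₀ + 2 * M.returnBound lam s₀ ^ 2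

/-- For small interest rate the jump operator is close to the Fokker-Planck operator. -/
lemma norm_jump_sub_symbol_le (hr : 0 < r) (hlam : 0 ≤ lam) (hν : 0 ≤ ν)
    (hs₀ : 0 < s₀) (hS : s₀ ≤ S) (hS' : 0 ≤ S') (hσ : σ ^ 2 = ν * r)
    (h : M.bondValue S' = (1 + r) * M.bondValue S + lam * r) {b e : ℝ} (hb0 : 0 ≤ b)
    (hb : ∀ᵐ η ∂(M.Θ σ), |η| ≤ b) (he : r + r * M.returnBound lam s₀ + b / s₀ ≤ e) (s : ℝ)
    (he1 : e ≤ 1 / 2) (he2 : |s| * (2 * e) ≤ 1) :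
    (∀ᵐ x ∂(M.jumpLaw r σ (lam * r) S S' : Measure ℝ), |x - 1| ≤ e) ∧
    ‖(r⁻¹ : ℝ) * (∫ x, (logChar s x - 1) ∂(M.jumpLaw r σ (lam * r) S S' : Measure ℝ)) -
        symbol s (M.jumpDrift r lam S S') (M.diffusionCoeff ν S)‖ ≤
      (2 * |s| + 3 * s ^ 2 + 8 * |s| ^ 3) * e *
        (2 / s₀ ^ 2 * ν + r * M.momentBound lam s₀) +
      |s| * (|s| + 1) * (r * M.momentBound lam s₀) := by
  have hS0 : 0 < S := hs₀.trans_le hS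
  have hae : ∀ᵐ x ∂(M.jumpLaw r σ (lam * r) S S' : Measure ℝ), |x - 1| ≤ e := by
    filter_upwards [ae_jumpLaw_abs_sub_one_le hr.le hS0 hb
      (abs_return_sub_le hr hlam hs₀ hS hS' h)] with x hx
    have : b / S ≤ b / s₀ := by gcongr
    linarith
  refine ⟨hae, ?_⟩
  have he0 : 0 ≤ e := le_trans (by
    have := one_le_returnBound (M := M) hlam hs₀
    positivity) he
  have h1 := norm_integral_logChar_sub_le (M.jumpLaw r σ (lam * r) S S') s he1 he2 hae
  have h2 := abs_second_moment_sub_diffusionCoeff_le (M := M) hr hlam hs₀ hS hS' hσ h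
  have h3 := diffusionCoeff_le (M := M) hν hs₀ hS
  rw [integral_jumpLaw_sub_one hS0.le] at h1
  rw [← momentBound] at h2
  set Q := ∫ x, (logChar s x - 1) ∂(M.jumpLaw r σ (lam * r) S S' : Measure ℝ)
  set V := ∫ x, (x - 1) ^ 2 ∂(M.jumpLaw r σ (lam * r) S S' : Measure ℝ)
  set m := r + M.μ S * ((S' - S + lam * r) / S - r) with hm
  have hV : r⁻¹ * V ≤ 2 / s₀ ^ 2 * ν + r * M.momentBound lam s₀ := by
    linarith [(abs_le.1 h2).2]
  -- Taylor error plus error in the second moment; the first moment makes no error, `jumpDrift`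
  -- being `r⁻¹ * m` exactly.
  have hdec : (r⁻¹ : ℝ) * Q - symbol s (M.jumpDrift r lam S S') (M.diffusionCoeff ν S) =
      (r⁻¹ : ℝ) * (Q - ((Complex.I * s) * (m : ℂ) +
        (Complex.I * s) * (Complex.I * s - 1) / 2 * (V : ℂ))) +
      (Complex.I * s) * (Complex.I * s - 1) / 2 *
        ((r⁻¹ * V - M.diffusionCoeff ν S : ℝ) : ℂ) := by
    rw [symbol, show M.jumpDrift r lam S S' = r⁻¹ * m from rfl]
    push_cast
    ring
  rw [hdec]
  refine (norm_add_le _ _).trans (add_le_add ?_ ?_)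
  · rw [norm_mul, Complex.norm_real, Real.norm_of_nonneg (inv_pos.2 hr).le]
    refine (mul_le_mul_of_nonneg_left h1 (inv_pos.2 hr).le).trans ?_
    have h4 : r⁻¹ * ((2 * |s| + 3 * s ^ 2 + 8 * |s| ^ 3) * e * V) =
      (2 * |s| + 3 * s ^ 2 + 8 * |s| ^ 3) * e * (r⁻¹ * V) := by ring
    rw [h4]
    exact mul_le_mul_of_nonneg_left hV (by positivity)
  · rw [norm_mul, Complex.norm_real, Real.norm_eq_abs]
    exact mul_le_mul (norm_symbol_coeff_le s) h2 (abs_nonneg _) (by positivity)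

/-- All noises are multiples of one variable `Y`. If `ν > 0`, boundedness for the single index 0
bounds `Y` itself, so the noise shrinks like `σ k`; if `ν = 0` there is none. -/
lemma exists_noise_bound {σ : ℕ → ℝ} {r : ℕ → ℝ} (hr : ∀ k, 0 < r k) (hν : 0 ≤ ν)
    (hσ : ∀ k, 0 ≤ σ k) (hσr : ∀ k, σ k ^ 2 = ν * r k) {d : ℝ}
    (hd : ∀ᵐ η ∂(M.Θ (σ 0)), |η| ≤ d) :
    ∃ L, 0 ≤ L ∧ ∀ k, ∀ᵐ η ∂(M.Θ (σ k)), |η| ≤ L * σ k := by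
  have hset : ∀ c : ℝ, MeasurableSet {η : ℝ | |η| ≤ c} := fun c =>
    measurableSet_le (by fun_prop) measurable_const
  rcases hν.eq_or_lt with rfl | hν
  · refine ⟨0, le_rfl, fun k => ?_⟩
    have h0 : σ k = 0 := by simpa using hσr k
    rw [Θ, ae_map_iff (measurable_scale _).aemeasurable (hset _), h0]
    exact ae_of_all _ fun y => by simp
  · have h0 : 0 < σ 0 := by
      refine lt_of_le_of_ne (hσ 0) fun h => ?_
      have h1 := mul_pos hν (hr 0)
      rw [← hσr 0, ← h] at h1
      norm_num at h1
    rw [Θ, ae_map_iff (measurable_scale _).aemeasurable (hset _)] at hd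
    refine ⟨|d| / σ 0, by positivity, fun k => ?_⟩
    rw [Θ, ae_map_iff (measurable_scale _).aemeasurable (hset _)]
    filter_upwards [hd] with y hy
    rw [abs_mul, abs_of_nonneg (hσ _)] at *
    have : |y| ≤ |d| / σ 0 := by
      rw [le_div_iff₀ h0, mul_comm]
      exact hy.trans (le_abs_self d)
    rw [mul_comm]
    exact mul_le_mul_of_nonneg_right this (hσ k)

end Market

/-! ### The limit of small interest rate -/

namespace Market.IsKineticSolution

variable {M : Market} {p r σ lam : ℝ} {f₀ : ProbabilityMeasure ℝ≥0}
  {f : ℝ → ProbabilityMeasure ℝ≥0} {S S' : ℝ → ℝ}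

lemma bondValue_eq (h : M.IsKineticSolution p r σ (lam * r) f₀ f S S') {t : ℝ} (ht : 0 ≤ t) :
    M.bondValue (S' t) = (1 + r) * M.bondValue (S t) + lam * r :=
  IsFuturePrice.bondValue_eq (h.price t ht) (h.futurePrice t ht)

lemma meanWealth_zero (h : M.IsKineticSolution p r σ (lam * r) f₀ f S S') (hp : 2 < p) (hr : 0 < r)
    (hf₀ : HasMoment p f₀) : meanWealth (f 0) = meanWealth f₀ := by
  have := (h.isJumpFlow (by linarith) hr).meanWealth_zero hp (hf₀.integrable_coe (by linarith))
  rwa [zero_div] at this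

lemma hasDerivAt_meanWealth (h : M.IsKineticSolution p r σ (lam * r) f₀ f S S') (hp : 2 < p)
    (hr : 0 < r) {τ : ℝ} (hτ : 0 < τ) :
    HasDerivAt (fun t => meanWealth (f (t / r)))
      (M.jumpDrift r lam (S (τ / r)) (S' (τ / r)) * meanWealth (f (τ / r))) τ := by
  have h1 := (h.isJumpFlow (by linarith) hr).hasDerivAt_meanWealth hp hr hτ
  rwa [integral_jumpLaw_sub_one (h.price _ (div_pos hτ hr).le).1.le] at h1

lemma continuousOn_meanWealth (h : M.IsKineticSolution p r σ (lam * r) f₀ f S S') (hp : 2 < p)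
    (hr : 0 < r) : ContinuousOn (fun t => meanWealth (f (t / r))) (Ici 0) :=
  (h.isJumpFlow (by linarith) hr).continuousOn_meanWealth hp

/-- Mean wealth is nondecreasing because its growth rate is nonnegative, and the price is monotone
in mean wealth. -/
lemma price_zero_le (h : M.IsKineticSolution p r σ (lam * r) f₀ f S S') (hp : 2 < p) (hr : 0 < r)
    (hlam : 0 ≤ lam) {t : ℝ} (ht : 0 ≤ t) : S 0 ≤ S t := by
  have hm : MonotoneOn (fun t => meanWealth (f (t / r))) (Ici 0) := by
    refine monotoneOn_of_deriv_nonneg (convex_Ici 0) (h.continuousOn_meanWealth hp hr) ?_ ?_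
    · rw [interior_Ici]
      exact fun τ hτ => (h.hasDerivAt_meanWealth hp hr hτ).differentiableAt.differentiableWithinAt
    · rw [interior_Ici]
      intro τ hτ
      have h0 : 0 ≤ τ / r := (div_pos hτ hr).le
      have hP := h.price _ h0
      rw [(h.hasDerivAt_meanWealth hp hr hτ).deriv]
      -- The current price serves as its own lower bound: only the sign of the drift is needed, and
      -- no uniform bound is known yet.
      exact mul_nonneg (jumpDrift_mem hr hlam hP.1 le_rfl (h.futurePrice _ h0).1
        (h.bondValue_eq h0)).1 hP.meanWealth_pos.le
  have h1 := hm self_mem_Ici (mem_Ici.2 (mul_nonneg ht hr.le)) (mul_nonneg ht hr.le)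
  simp only [zero_div, mul_div_cancel_right₀ t hr.ne'] at h1
  exact (h.price 0 le_rfl).mono (h.price t ht) h1

lemma continuousOn_price (h : M.IsKineticSolution p r σ (lam * r) f₀ f S S') (hp : 2 < p)
    (hr : 0 < r) : ContinuousOn (fun τ => S (τ / r)) (Ici 0) := by
  intro t ht
  have h1 := (tendsto_iff_dist_tendsto_zero.1 (h.continuousOn_meanWealth hp hr t ht)).div_const M.n
  rw [zero_div] at h1
  refine tendsto_iff_dist_tendsto_zero.2 (squeeze_zero' (Eventually.of_forall fun _ => dist_nonneg)
    ?_ h1)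
  filter_upwards [self_mem_nhdsWithin] with x hx
  exact (h.price _ (div_nonneg hx hr.le)).abs_sub_le (h.price _ (div_nonneg ht hr.le))

lemma continuousOn_jumpDrift (h : M.IsKineticSolution p r σ (lam * r) f₀ f S S') (hp : 2 < p)
    (hr : 0 < r) : ContinuousOn (fun τ => M.jumpDrift r lam (S (τ / r)) (S' (τ / r))) (Ici 0) := by
  have hpos : ∀ τ ∈ Ici (0 : ℝ), 0 < S (τ / r) := fun τ hτ => (h.price _ (div_nonneg hτ hr.le)).1
  have hT := h.continuousOn_price hp hr
  have hμ : ContinuousOn (fun τ => M.μ (S (τ / r))) (Ici 0) := fun τ hτ =>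
    ContinuousAt.comp_continuousWithinAt (f := fun τ => S (τ / r)) (continuousAt_μ (hpos τ hτ)) (hT τ hτ)
  have hG : ContinuousOn (fun τ => M.bondValue (S (τ / r))) (Ici 0) := fun τ hτ =>
    ContinuousAt.comp_continuousWithinAt (f := fun τ => S (τ / r)) (continuousAt_bondValue (hpos τ hτ))
      (hT τ hτ)
  have hT' : ContinuousOn (fun τ => S' (τ / r)) (Ici 0) := by
    refine continuousOn_of_continuousOn_bondValue (M := M)
      (fun τ hτ => (h.futurePrice _ (div_nonneg hτ hr.le)).1) ?_
    exact ((continuousOn_const.mul hG).add continuousOn_const).congr fun τ hτ =>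
      h.bondValue_eq (div_nonneg hτ hr.le)
  unfold jumpDrift
  exact continuousOn_const.mul (continuousOn_const.add (hμ.mul
    ((((hT'.sub hT).add continuousOn_const).div hT fun τ hτ => (hpos τ hτ).ne').sub
      continuousOn_const)))

lemma log_meanWealth_eq (h : M.IsKineticSolution p r σ (lam * r) f₀ f S S') (hp : 2 < p)
    (hr : 0 < r) (hf₀ : HasMoment p f₀) {τ : ℝ} (hτ : 0 ≤ τ) :
    Real.log (meanWealth (f (τ / r))) = Real.log (meanWealth f₀) +
      ∫ u in (0)..τ, M.jumpDrift r lam (S (u / r)) (S' (u / r)) := by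
  have hpos : ∀ t, 0 ≤ t → 0 < meanWealth (f (t / r)) := fun t ht =>
    (h.price _ (div_nonneg ht hr.le)).meanWealth_pos
  have hc : ContinuousOn (fun t => Real.log (meanWealth (f (t / r)))) (Icc 0 τ) :=
    ((h.continuousOn_meanWealth hp hr).mono Icc_subset_Ici_self).log
      fun t ht => (hpos t ht.1).ne'
  have hint : IntervalIntegrable (fun u => M.jumpDrift r lam (S (u / r)) (S' (u / r))) volume 0 τ :=
    ((h.continuousOn_jumpDrift hp hr).mono Icc_subset_Ici_self).intervalIntegrable_of_Icc hτ
  have key := intervalIntegral.integral_eq_sub_of_hasDerivAt_of_le hτ hc (fun t ht => by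
    have := (h.hasDerivAt_meanWealth hp hr ht.1).log (hpos t ht.1.le).ne'
    rwa [mul_div_cancel_right₀ _ (hpos t ht.1.le).ne'] at this) hint
  rw [key, zero_div, h.meanWealth_zero hp hr hf₀]
  ring

end Market.IsKineticSolution

open Market in
/-- The data of a sequence of kinetic solutions with interest rate tending to zero. -/
structure KineticSequence (M : Market) (p : ℝ) (f₀ : ProbabilityMeasure ℝ≥0) (ν lam s₀ : ℝ)
    (r σ : ℕ → ℝ) (f : ℕ → ℝ → ProbabilityMeasure ℝ≥0) (S S' : ℕ → ℝ → ℝ) : Prop where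
  two_lt : 2 < p
  moment : HasMoment p f₀
  ν_nonneg : 0 ≤ ν
  lam_nonneg : 0 ≤ lam
  r_pos : ∀ k, 0 < r k
  r_lim : Tendsto r atTop (𝓝 0)
  σ_nonneg : ∀ k, 0 ≤ σ k
  σ_sq : ∀ k, σ k ^ 2 = ν * r k
  s₀_pos : 0 < s₀
  le_price : ∀ k t, 0 ≤ t → s₀ ≤ S k t
  noise : ∃ L, 0 ≤ L ∧ ∀ k, ∀ᵐ η ∂(M.Θ (σ k)), |η| ≤ L * σ k
  sol : ∀ k, M.IsKineticSolution p (r k) (σ k) (lam * r k) f₀ (f k) (S k) (S' k)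

namespace KineticSequence

open Market

variable {M : Market} {p ν lam s₀ : ℝ} {f₀ : ProbabilityMeasure ℝ≥0} {r σ : ℕ → ℝ}
  {f : ℕ → ℝ → ProbabilityMeasure ℝ≥0} {S S' : ℕ → ℝ → ℝ}

lemma comp (h : KineticSequence M p f₀ ν lam s₀ r σ f S S') {i : ℕ → ℕ} (hi : StrictMono i) :
    KineticSequence M p f₀ ν lam s₀ (r ∘ i) (σ ∘ i) (f ∘ i) (S ∘ i) (S' ∘ i) := by
  obtain ⟨L, hL, hn⟩ := h.noise
  exact ⟨h.two_lt, h.moment, h.ν_nonneg, h.lam_nonneg, fun k => h.r_pos _,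
    h.r_lim.comp hi.tendsto_atTop, fun k => h.σ_nonneg _, fun k => h.σ_sq _, h.s₀_pos,
    fun k => h.le_price _, ⟨L, hL, fun k => hn _⟩, fun k => h.sol _⟩

lemma jumpDrift_mem (h : KineticSequence M p f₀ ν lam s₀ r σ f S S') (k : ℕ) {τ : ℝ}
    (hτ : 0 ≤ τ) : 0 ≤ M.jumpDrift (r k) lam (S k (τ / r k)) (S' k (τ / r k)) ∧
      M.jumpDrift (r k) lam (S k (τ / r k)) (S' k (τ / r k)) ≤ 1 + M.returnBound lam s₀ := by
  have h0 : 0 ≤ τ / r k := div_nonneg hτ (h.r_pos k).le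
  exact Market.jumpDrift_mem (h.r_pos k) h.lam_nonneg h.s₀_pos (h.le_price k _ h0)
    ((h.sol k).futurePrice _ h0).1 ((h.sol k).bondValue_eq h0)

/-- The equicontinuity behind the choice of the subsequence: the constant depends neither on `k` nor
on time. -/
lemma abs_log_sub_le (h : KineticSequence M p f₀ ν lam s₀ r σ f S S') (k : ℕ) {t τ : ℝ}
    (ht : 0 ≤ t) (hτ : 0 ≤ τ) :
    |Real.log (meanWealth (f k (t / r k))) - Real.log (meanWealth (f k (τ / r k)))| ≤
      (1 + M.returnBound lam s₀) * |t - τ| := by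
  have hint : ∀ t, 0 ≤ t → IntervalIntegrable
      (fun u => M.jumpDrift (r k) lam (S k (u / r k)) (S' k (u / r k))) volume 0 t := fun t ht =>
    (((h.sol k).continuousOn_jumpDrift h.two_lt (h.r_pos k)).mono
      Icc_subset_Ici_self).intervalIntegrable_of_Icc ht
  rw [(h.sol k).log_meanWealth_eq h.two_lt (h.r_pos k) h.moment ht,
    (h.sol k).log_meanWealth_eq h.two_lt (h.r_pos k) h.moment hτ, add_sub_add_left_eq_sub,
    intervalIntegral.integral_interval_sub_left (hint t ht) (hint τ hτ), ← Real.norm_eq_abs]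
  refine intervalIntegral.norm_integral_le_of_norm_le_const fun u hu => ?_
  have hu0 : 0 ≤ u := (le_min hτ ht).trans hu.1.le
  rw [Real.norm_of_nonneg (h.jumpDrift_mem k hu0).1]
  exact (h.jumpDrift_mem k hu0).2

/-- The symbol of the kinetic equation, up to terms which vanish with the interest rate. -/
noncomputable def jumpSymbol (M : Market) (ν lam r : ℝ) (S S' : ℝ → ℝ) (s u : ℝ) : ℂ :=
  symbol s (M.jumpDrift r lam (S (u / r)) (S' (u / r))) (M.diffusionCoeff ν (S (u / r)))

/-- A bound for the symbol. -/
noncomputable def symbolBound (M : Market) (ν lam s₀ s : ℝ) : ℝ :=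
  |s| * (1 + M.returnBound lam s₀) + |s| * (|s| + 1) * (2 / s₀ ^ 2 * ν) + 1

/-- The summand 1 in the bound serves here: at `s = 0` the rest vanishes, while Gronwall's
inequality is used with a positive constant. -/
lemma symbolBound_pos (h : KineticSequence M p f₀ ν lam s₀ r σ f S S') (s : ℝ) :
    0 < symbolBound M ν lam s₀ s := by
  have := one_le_returnBound (M := M) h.lam_nonneg h.s₀_pos
  have := h.ν_nonneg
  have := h.s₀_pos
  unfold symbolBound
  positivity

lemma norm_jumpSymbol_le (h : KineticSequence M p f₀ ν lam s₀ r σ f S S') (s : ℝ) (k : ℕ) {u : ℝ}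
    (hu : 0 ≤ u) : ‖jumpSymbol M ν lam (r k) (S k) (S' k) s u‖ ≤ symbolBound M ν lam s₀ s := by
  have h1 := h.jumpDrift_mem k hu
  refine (norm_symbol_le s (KA := 1 + M.returnBound lam s₀) (KB := 2 / s₀ ^ 2 * ν) ?_ ?_).trans
    (le_add_of_nonneg_right zero_le_one)
  · rw [abs_of_nonneg h1.1]
    exact h1.2
  · rw [abs_of_nonneg (diffusionCoeff_nonneg h.ν_nonneg)]
    exact diffusionCoeff_le h.ν_nonneg h.s₀_pos (h.le_price k _ (div_nonneg hu (h.r_pos k).le))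

lemma continuousOn_jumpSymbol (h : KineticSequence M p f₀ ν lam s₀ r σ f S S') (s : ℝ) (k : ℕ) :
    ContinuousOn (jumpSymbol M ν lam (r k) (S k) (S' k) s) (Ici 0) := by
  have h1 := (h.sol k).continuousOn_jumpDrift h.two_lt (h.r_pos k)
  have h2 : ContinuousOn (fun u => M.diffusionCoeff ν (S k (u / r k))) (Ici 0) := fun u hu =>
    ContinuousAt.comp_continuousWithinAt (f := fun u => S k (u / r k))
      (continuousAt_diffusionCoeff ((h.sol k).price _ (div_nonneg hu (h.r_pos k).le)).1)
      ((h.sol k).continuousOn_price h.two_lt (h.r_pos k) u hu)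
  exact (continuousOn_const.mul (Complex.continuous_ofReal.comp_continuousOn h1)).add
    (continuousOn_const.mul (Complex.continuous_ofReal.comp_continuousOn h2))

lemma tendsto_jumpDrift (h : KineticSequence M p f₀ ν lam s₀ r σ f S S') {u P : ℝ} (hu : 0 ≤ u)
    (hP : Tendsto (fun k => S k (u / r k)) atTop (𝓝 P)) :
    Tendsto (fun k => M.jumpDrift (r k) lam (S k (u / r k)) (S' k (u / r k))) atTop
      (𝓝 (M.driftCoeff lam P)) := by
  have hdiv : ∀ k, 0 ≤ u / r k := fun k => div_nonneg hu (h.r_pos k).le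
  exact Market.tendsto_jumpDrift (M := M) (T := fun k => S k (u / r k))
    (T' := fun k => S' k (u / r k)) h.lam_nonneg h.r_pos h.r_lim h.s₀_pos
    (fun k => h.le_price k _ (hdiv k)) (fun k => ((h.sol k).futurePrice _ (hdiv k)).1)
    (fun k => (h.sol k).bondValue_eq (hdiv k)) hP

lemma tendsto_integral_jumpSymbol (h : KineticSequence M p f₀ ν lam s₀ r σ f S S') {P : ℝ → ℝ}
    (hP : ∀ τ, 0 ≤ τ → Tendsto (fun k => S k (τ / r k)) atTop (𝓝 (P τ))) (s : ℝ) {τ : ℝ}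
    (hτ : 0 ≤ τ) :
    Tendsto (fun k => ∫ u in (0)..τ, jumpSymbol M ν lam (r k) (S k) (S' k) s u) atTop
      (𝓝 (∫ u in (0)..τ, symbol s (M.driftCoeff lam (P u)) (M.diffusionCoeff ν (P u)))) := by
  have hmem : ∀ u ∈ uIoc 0 τ, 0 ≤ u := fun u hu => by
    rw [uIoc_of_le hτ] at hu
    exact hu.1.le
  refine intervalIntegral.tendsto_integral_filter_of_dominated_convergence
    (fun _ => symbolBound M ν lam s₀ s) (Eventually.of_forall fun k => ?_)
    (Eventually.of_forall fun k => ae_of_all _ fun u hu => h.norm_jumpSymbol_le s k (hmem u hu))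
    intervalIntegrable_const (ae_of_all _ fun u hu => ?_)
  · exact ((h.continuousOn_jumpSymbol s k).mono hmem).aestronglyMeasurable measurableSet_uIoc
  · have hu0 := hmem u hu
    have h1 := h.tendsto_jumpDrift hu0 (hP u hu0)
    have hPpos : 0 < P u := h.s₀_pos.trans_le
      (ge_of_tendsto' (hP u hu0) fun k => h.le_price k _ (div_nonneg hu0 (h.r_pos k).le))
    have h2 := (continuousAt_diffusionCoeff (M := M) (ν := ν) hPpos).tendsto.comp (hP u hu0)
    exact (tendsto_const_nhds.mul ((Complex.continuous_ofReal.tendsto _).comp h1)).add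
      (tendsto_const_nhds.mul ((Complex.continuous_ofReal.tendsto _).comp h2))

lemma σ_lim (h : KineticSequence M p f₀ ν lam s₀ r σ f S S') : Tendsto σ atTop (𝓝 0) := by
  have h1 : σ = fun k => √(ν * r k) := funext fun k => by
    rw [← h.σ_sq k, Real.sqrt_sq (h.σ_nonneg k)]
  rw [h1]
  simpa using (h.r_lim.const_mul ν).sqrt

/-- The characteristic functions are asymptotically given by the symbol. -/
lemma tendsto_logCharFun_sub (h : KineticSequence M p f₀ ν lam s₀ r σ f S S') (s : ℝ) {τ : ℝ}
    (hτ : 0 ≤ τ) :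
    Tendsto (fun k => logCharFun (f k (τ / r k)) s - logCharFun f₀ s *
      Complex.exp (∫ u in (0)..τ, jumpSymbol M ν lam (r k) (S k) (S' k) s u)) atTop (𝓝 0) := by
  obtain ⟨L, hL, hnoise⟩ := h.noise
  have hdiv : ∀ k t, 0 ≤ t → 0 ≤ t / r k := fun k t ht => div_nonneg ht (h.r_pos k).le
  -- `e k` bounds the relative jumps in the round with rate `r k`: interest, excess return of
  -- stocks, and noise divided by the least price. `ε k` is the resulting distance of the jump
  -- operator from its symbol.
  obtain ⟨e, he⟩ : ∃ e : ℕ → ℝ, ∀ k, e k = r k + r k * M.returnBound lam s₀ + L * σ k / s₀ :=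
    ⟨_, fun _ => rfl⟩
  obtain ⟨ε, hε⟩ : ∃ ε : ℕ → ℝ, ∀ k, ε k = (2 * |s| + 3 * s ^ 2 + 8 * |s| ^ 3) * e k *
        (2 / s₀ ^ 2 * ν + r k * M.momentBound lam s₀) +
      |s| * (|s| + 1) * (r k * M.momentBound lam s₀) := ⟨_, fun _ => rfl⟩
  have helim : Tendsto e atTop (𝓝 0) := by
    rw [funext he]
    simpa using (h.r_lim.add (h.r_lim.mul_const _)).add ((h.σ_lim.const_mul L).div_const s₀)
  have hεlim : Tendsto ε atTop (𝓝 0) := by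
    rw [funext hε]
    have h1 := ((helim.const_mul (2 * |s| + 3 * s ^ 2 + 8 * |s| ^ 3)).mul
      ((h.r_lim.mul_const (M.momentBound lam s₀)).const_add (2 / s₀ ^ 2 * ν))).add
      ((h.r_lim.mul_const (M.momentBound lam s₀)).const_mul (|s| * (|s| + 1)))
    simpa using h1
  have h2e : Tendsto (fun k => |s| * (2 * e k)) atTop (𝓝 0) := by
    simpa using (helim.const_mul 2).const_mul |s|
  have hlim : Tendsto (fun k => ε k * τ * Real.exp (symbolBound M ν lam s₀ s * τ)) atTop (𝓝 0) := by
    simpa using (hεlim.mul_const τ).mul_const (Real.exp (symbolBound M ν lam s₀ s * τ))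
  refine squeeze_zero_norm' ?_ hlim
  filter_upwards [helim.eventually_le_const (show (0 : ℝ) < 1 / 2 by norm_num),
    h2e.eventually_le_const one_pos] with k hk1 hk2
  have key := fun u (hu : 0 ≤ u) => norm_jump_sub_symbol_le (h.r_pos k) h.lam_nonneg h.ν_nonneg
    h.s₀_pos (h.le_price k _ (hdiv k u hu)) ((h.sol k).futurePrice _ (hdiv k u hu)).1 (h.σ_sq k)
    ((h.sol k).bondValue_eq (hdiv k u hu)) (mul_nonneg hL (h.σ_nonneg k)) (hnoise k)
    (he k).ge s hk1 hk2
  simp only [← hε k] at key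
  refine ((h.sol k).isJumpFlow (by linarith [h.two_lt]) (h.r_pos k)).norm_logCharFun_sub_le
    h.two_lt (h.r_pos k) (fun u hu => ?_) s (h.continuousOn_jumpSymbol s k) (h.symbolBound_pos s)
    ((norm_nonneg _).trans (key 0 le_rfl).2) (fun u hu => h.norm_jumpSymbol_le s k hu)
    (fun u hu => (key u hu).2) hτ
  filter_upwards [(key u hu).1] with x hx
  linarith [(abs_le.1 hx).1]

/-- The characteristic functions converge as soon as the prices do. -/
lemma tendsto_logCharFun (h : KineticSequence M p f₀ ν lam s₀ r σ f S S') {P : ℝ → ℝ}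
    (hP : ∀ τ, 0 ≤ τ → Tendsto (fun k => S k (τ / r k)) atTop (𝓝 (P τ))) (s : ℝ) {τ : ℝ}
    (hτ : 0 ≤ τ) :
    Tendsto (fun k => logCharFun (f k (τ / r k)) s) atTop (𝓝 (logCharFun f₀ s *
      Complex.exp (∫ u in (0)..τ,
        symbol s (M.driftCoeff lam (P u)) (M.diffusionCoeff ν (P u))))) := by
  have hN : Tendsto (fun k => logCharFun f₀ s *
      Complex.exp (∫ u in (0)..τ, jumpSymbol M ν lam (r k) (S k) (S' k) s u)) atTop _ :=
    tendsto_const_nhds.mul ((Complex.continuous_exp.tendsto _).comp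
      (h.tendsto_integral_jumpSymbol hP s hτ))
  simpa using (h.tendsto_logCharFun_sub s hτ).add hN

end KineticSequence

/-! ### Compactness of the mean wealth and of the prices -/

namespace KineticSequence

open Market

variable {M : Market} {p ν lam s₀ : ℝ} {f₀ : ProbabilityMeasure ℝ≥0} {r σ : ℕ → ℝ}
  {f : ℕ → ℝ → ProbabilityMeasure ℝ≥0} {S S' : ℕ → ℝ → ℝ}

lemma isPrice (h : KineticSequence M p f₀ ν lam s₀ r σ f S S') (k : ℕ) {τ : ℝ} (hτ : 0 ≤ τ) :
    M.IsPrice (f k (τ / r k)) (S k (τ / r k)) :=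
  (h.sol k).price _ (div_nonneg hτ (h.r_pos k).le)

lemma meanWealth_pos (h : KineticSequence M p f₀ ν lam s₀ r σ f S S') : 0 < meanWealth f₀ := by
  rw [← (h.sol 0).meanWealth_zero h.two_lt (h.r_pos 0) h.moment]
  exact ((h.sol 0).price 0 le_rfl).meanWealth_pos

lemma exists_subseq_tendsto_log (h : KineticSequence M p f₀ ν lam s₀ r σ f S S') :
    ∃ i : ℕ → ℕ, StrictMono i ∧ ∀ τ, 0 ≤ τ → ∃ l,
      Tendsto (fun j => Real.log (meanWealth (f (i j) (τ / r (i j))))) atTop (𝓝 l) := by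
  refine exists_subseq_tendsto_of_lipschitz
    (u := fun k τ => Real.log (meanWealth (f k (τ / r k)))) (B := |Real.log (meanWealth f₀)|)
    (fun k s t hs ht => h.abs_log_sub_le k hs ht) fun k => ?_
  simp only [zero_div]
  rw [(h.sol k).meanWealth_zero h.two_lt (h.r_pos k) h.moment]

/-- Convergence of the mean wealth implies convergence of the prices. -/
lemma exists_tendsto_price (h : KineticSequence M p f₀ ν lam s₀ r σ f S S')
    (hl : ∀ τ, 0 ≤ τ → ∃ l, Tendsto (fun k => Real.log (meanWealth (f k (τ / r k)))) atTop (𝓝 l)) :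
    ∃ P : ℝ → ℝ, Continuous P ∧ (∀ τ, s₀ ≤ P τ) ∧
      ∀ τ, 0 ≤ τ → Tendsto (fun k => S k (τ / r k)) atTop (𝓝 (P τ)) := by
  -- Times are truncated at 0, so that the limits are defined and continuous on the whole line.
  have hl' : ∀ τ : ℝ, ∃ l, Tendsto (fun k => Real.log (meanWealth (f k (max τ 0 / r k)))) atTop
      (𝓝 l) := fun τ => hl _ (le_max_right _ _)
  choose v hv using hl'
  have hpos : ∀ τ : ℝ, 0 ≤ max τ 0 := fun τ => le_max_right _ _
  have hm : ∀ τ, Tendsto (fun k => meanWealth (f k (max τ 0 / r k))) atTop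
      (𝓝 (Real.exp (v τ))) := fun τ => by
    refine ((Real.continuous_exp.tendsto _).comp (hv τ)).congr fun k => ?_
    exact Real.exp_log (h.isPrice k (hpos τ)).meanWealth_pos
  have hvc : Continuous v := by
    have h0 : 0 ≤ 1 + M.returnBound lam s₀ :=
      (h.jumpDrift_mem 0 le_rfl).1.trans (h.jumpDrift_mem 0 le_rfl).2
    refine (LipschitzWith.of_dist_le_mul (K := ⟨1 + M.returnBound lam s₀, h0⟩)
      fun s t => ?_).continuous
    rw [Real.dist_eq, Real.dist_eq]
    refine le_of_tendsto' ((hv s).sub (hv t)).abs fun k =>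
      (h.abs_log_sub_le k (hpos s) (hpos t)).trans ?_
    exact mul_le_mul_of_nonneg_left (abs_max_sub_max_le_abs s t 0) h0
  have hS : ∀ τ, ∃ P, Tendsto (fun k => S k (max τ 0 / r k)) atTop (𝓝 P) := fun τ => by
    refine cauchySeq_tendsto_of_complete (Metric.cauchySeq_iff.2 fun ε hε => ?_)
    obtain ⟨N, hN⟩ := Metric.cauchySeq_iff.1 (hm τ).cauchySeq (ε * M.n) (mul_pos hε M.n_pos)
    refine ⟨N, fun a ha b hb => ?_⟩
    refine ((h.isPrice a (hpos τ)).abs_sub_le (h.isPrice b (hpos τ))).trans_lt ?_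
    rw [div_lt_iff₀ M.n_pos]
    exact hN a ha b hb
  choose P hP using hS
  refine ⟨P, ?_, fun τ => ge_of_tendsto' (hP τ) fun k =>
    h.le_price k _ (div_nonneg (hpos τ) (h.r_pos k).le), fun τ hτ => ?_⟩
  · refine continuous_iff_continuousAt.2 fun t => ?_
    have h1 : Tendsto (fun s => |Real.exp (v s) - Real.exp (v t)| / M.n) (𝓝 t) (𝓝 0) := by
      have := (((Real.continuous_exp.comp hvc).sub continuous_const).abs.div_const M.n).tendsto
        (x := t) (f := fun s => |Real.exp (v s) - Real.exp (v t)| / M.n)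
      simpa using this
    refine tendsto_iff_dist_tendsto_zero.2 (squeeze_zero (fun _ => dist_nonneg) (fun s => ?_) h1)
    exact le_of_tendsto_of_tendsto' ((hP s).sub (hP t)).abs
      (((hm s).sub (hm t)).abs.div_const M.n) fun k =>
      (h.isPrice k (hpos s)).abs_sub_le (h.isPrice k (hpos t))
  · simpa only [max_eq_left hτ] using hP τ

/-- Weak convergence of laws alone would not give convergence of means. The limit follows from the
equation for the mean wealth, and it equals the mean of the log-normal limit law; this makes the
limiting price the price of that law. -/
lemma tendsto_meanWealth (h : KineticSequence M p f₀ ν lam s₀ r σ f S S') {P : ℝ → ℝ}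
    (hP : ∀ τ, 0 ≤ τ → Tendsto (fun k => S k (τ / r k)) atTop (𝓝 (P τ))) {τ : ℝ} (hτ : 0 ≤ τ) :
    Tendsto (fun k => meanWealth (f k (τ / r k))) atTop
      (𝓝 (meanWealth f₀ * Real.exp (∫ u in (0)..τ, M.driftCoeff lam (P u)))) := by
  have hmem : ∀ u ∈ uIoc 0 τ, 0 ≤ u := fun u hu => by
    rw [uIoc_of_le hτ] at hu
    exact hu.1.le
  have key : Tendsto
      (fun k => ∫ u in (0)..τ, M.jumpDrift (r k) lam (S k (u / r k)) (S' k (u / r k))) atTop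
      (𝓝 (∫ u in (0)..τ, M.driftCoeff lam (P u))) := by
    refine intervalIntegral.tendsto_integral_filter_of_dominated_convergence
      (fun _ => 1 + M.returnBound lam s₀) (Eventually.of_forall fun k => ?_)
      (Eventually.of_forall fun k => ae_of_all _ fun u hu => ?_)
      intervalIntegrable_const (ae_of_all _ fun u hu =>
        h.tendsto_jumpDrift (hmem u hu) (hP u (hmem u hu)))
    · exact (((h.sol k).continuousOn_jumpDrift h.two_lt (h.r_pos k)).mono
        hmem).aestronglyMeasurable measurableSet_uIoc
    · rw [Real.norm_of_nonneg (h.jumpDrift_mem k (hmem u hu)).1]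
      exact (h.jumpDrift_mem k (hmem u hu)).2
  refine (((Real.continuous_exp.tendsto _).comp key).const_mul _).congr fun k => ?_
  rw [← Real.exp_log (h.isPrice k hτ).meanWealth_pos,
    (h.sol k).log_meanWealth_eq h.two_lt (h.r_pos k) h.moment hτ, Real.exp_add,
    Real.exp_log h.meanWealth_pos]
  rfl

end KineticSequence

/-! ### The limit law and the theorem -/

lemma Market.integral_symbol {A B : ℝ → ℝ} (hA : Continuous A) (hB : Continuous B) (s τ : ℝ) :
    ∫ u in (0)..τ, Market.symbol s (A u) (B u) =
      Market.symbol s (∫ u in (0)..τ, A u) (∫ u in (0)..τ, B u) := by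
  unfold Market.symbol
  rw [intervalIntegral.integral_add, intervalIntegral.integral_const_mul,
    intervalIntegral.integral_const_mul, intervalIntegral.integral_ofReal,
    intervalIntegral.integral_ofReal]
  all_goals exact Continuous.intervalIntegrable (by fun_prop) _ _

/-- The log-normal laws whose parameters are the integrated coefficients solve the Fokker-Planck
equation. -/
lemma isFokkerPlanckSolution_integral {p : ℝ} {f₀ : ProbabilityMeasure ℝ≥0} (hp : 2 < p)
    (hf₀ : HasMoment p f₀) {A B : ℝ → ℝ} (hA : Continuous A) (hB : Continuous B)
    (hB0 : (∀ t, B t = 0) ∨ ∀ t, 0 < B t) :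
    IsFokkerPlanckSolution p A B f₀
      (fun τ => logNormalLaw f₀ (∫ u in (0)..τ, A u) √(∫ u in (0)..τ, B u)) := by
  have hd : ∀ {F : ℝ → ℝ}, Continuous F → ∀ t,
      HasDerivAt (fun τ => ∫ u in (0)..τ, F u) (F t) t := fun hF t =>
    intervalIntegral.integral_hasDerivAt_right (hF.intervalIntegrable _ _)
      hF.stronglyMeasurable.stronglyMeasurableAtFilter hF.continuousAt
  have hc : ∀ {F : ℝ → ℝ}, Continuous F → Continuous fun τ => ∫ u in (0)..τ, F u := fun hF =>
    continuous_iff_continuousAt.2 fun t => (hd hF t).continuousAt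
  have hsqrt : Continuous fun τ => √(∫ u in (0)..τ, B u) := (hc hB).sqrt
  -- The square root of the integrated diffusion is differentiable at positive times if the integral
  -- is positive there; a vanishing diffusion gives a constant volatility 0 and a pure dilation.
  rcases hB0 with hB0 | hB0
  · refine isFokkerPlanckSolution_logNormalLaw hp hf₀ hA hB (hc hA) hsqrt (by simp) (by simp)
      (fun t _ => hd hA t) (c' := fun _ => 0) (fun t _ => ?_) continuousOn_const
      fun t _ => by simp [hB0]
    simp only [hB0, intervalIntegral.integral_zero, Real.sqrt_zero]
    exact hasDerivAt_const _ _
  · have hpos : ∀ t, 0 < t → 0 < ∫ u in (0)..t, B u := fun t ht =>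
      intervalIntegral.intervalIntegral_pos_of_pos (hB.intervalIntegrable _ _) hB0 ht
    have hpos' : ∀ t, 0 < t → 0 < √(∫ u in (0)..t, B u) := fun t ht => Real.sqrt_pos.2 (hpos t ht)
    refine isFokkerPlanckSolution_logNormalLaw hp hf₀ hA hB (hc hA) hsqrt (by simp) (by simp)
      (fun t _ => hd hA t) (c' := fun t => B t / (2 * √(∫ u in (0)..t, B u)))
      (fun t ht => (hd hB t).sqrt (hpos t ht).ne')
      (hB.continuousOn.div (continuous_const.mul hsqrt).continuousOn fun t ht => ?_)
      fun t ht => ?_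
    · exact (mul_pos two_pos (hpos' t ht)).ne'
    · have := (hpos' t ht).ne'
      field_simp

theorem theorem2 (M : Market) (δ : ℝ) (hδ : 0 < δ)
    (f₀ : ProbabilityMeasure ℝ≥0) (hf₀ : HasMoment (2 + δ) f₀)
    (ν lam : ℝ) (hν : 0 ≤ ν) (hlam : 0 ≤ lam)
    (r σ D : ℕ → ℝ) (hr : ∀ k, 0 < r k) (hr0 : Tendsto r atTop (𝓝 0))
    (hσ : ∀ k, 0 ≤ σ k) (hσr : ∀ k, σ k ^ 2 = ν * r k) (hD : ∀ k, D k = lam * r k)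
    (f : ℕ → ℝ → ProbabilityMeasure ℝ≥0) (S S' : ℕ → ℝ → ℝ)
    (hf : ∀ k, M.IsKineticSolution (2 + δ) (r k) (σ k) (D k) f₀ (f k) (S k) (S' k)) :
    ∃ (i : ℕ → ℕ) (g : ℝ → ProbabilityMeasure ℝ≥0) (P : ℝ → ℝ),
      StrictMono i ∧
      (∀ τ, 0 ≤ τ → Tendsto (fun j => f (i j) (τ / r (i j))) atTop (𝓝 (g τ))) ∧
      (∀ τ, 0 ≤ τ → M.IsPrice (g τ) (P τ)) ∧
      IsFokkerPlanckSolution (2 + δ) (fun τ => M.driftCoeff lam (P τ))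
        (fun τ => M.diffusionCoeff ν (P τ)) f₀ g ∧
      (HasDensity f₀ → ∀ τ, 0 ≤ τ → HasDensity (g τ)) := by
  obtain rfl : D = fun k => lam * r k := funext hD
  have hp : 2 < 2 + δ := by linarith
  obtain ⟨d, -, hd, -⟩ := (hf 0).noise
  -- The mean wealth at time 0 is that of `f₀` for every `k`, hence all initial prices equal `S 0
  -- 0`, which is a common lower bound for all later prices.
  have h : KineticSequence M (2 + δ) f₀ ν lam (S 0 0) r σ f S S' := by
    refine ⟨hp, hf₀, hν, hlam, hr, hr0, hσ, hσr, ((hf 0).price 0 le_rfl).1, fun k t ht => ?_,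
      Market.exists_noise_bound hr hν hσ hσr hd, hf⟩
    refine le_trans ?_ ((hf k).price_zero_le hp (hr k) hlam ht)
    refine ((hf 0).price 0 le_rfl).mono ((hf k).price 0 le_rfl) ?_
    rw [(hf 0).meanWealth_zero hp (hr 0) hf₀, (hf k).meanWealth_zero hp (hr k) hf₀]
  obtain ⟨i, hi, hl⟩ := h.exists_subseq_tendsto_log
  have h' := h.comp hi
  obtain ⟨P, hPc, hPs, hP⟩ := h'.exists_tendsto_price hl
  have hPpos : ∀ τ, 0 < P τ := fun τ => h.s₀_pos.trans_le (hPs τ)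
  have hA : Continuous fun τ => M.driftCoeff lam (P τ) := continuous_iff_continuousAt.2 fun τ =>
    (Market.continuousAt_driftCoeff (hPpos τ)).comp hPc.continuousAt
  have hB : Continuous fun τ => M.diffusionCoeff ν (P τ) := continuous_iff_continuousAt.2 fun τ =>
    (Market.continuousAt_diffusionCoeff (hPpos τ)).comp hPc.continuousAt
  refine ⟨i, fun τ => logNormalLaw f₀ (∫ u in (0)..τ, M.driftCoeff lam (P u))
    √(∫ u in (0)..τ, M.diffusionCoeff ν (P u)), P, hi, fun τ hτ => ?_, fun τ hτ => ⟨hPpos τ, ?_⟩,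
    isFokkerPlanckSolution_integral hp hf₀ hA hB ?_, fun hdens τ _ => hdens.logNormalLaw _ _⟩
  · refine tendsto_of_tendsto_logCharFun fun s => ?_
    have h1 := h'.tendsto_logCharFun hP s hτ
    rw [Market.integral_symbol hA hB] at h1
    rw [logCharFun_logNormalLaw, Real.sq_sqrt
      (intervalIntegral.integral_nonneg hτ fun u _ => Market.diffusionCoeff_nonneg hν)]
    exact h1
  -- The price equation passes to the limit by uniqueness of limits: price, demand and mean wealth
  -- all converge.
  · rw [meanWealth_logNormalLaw]
    refine tendsto_nhds_unique (hP τ hτ) ?_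
    refine (((tendsto_const_nhds (x := 1 / M.n)).mul ((Market.continuousAt_μ
      (hPpos τ)).tendsto.comp (hP τ hτ))).mul (h'.tendsto_meanWealth hP hτ)).congr fun k => ?_
    exact (h'.isPrice k hτ).2.symm
  · rcases hν.eq_or_lt with rfl | hν
    · exact Or.inl fun t => mul_zero _
    · refine Or.inr fun t => mul_pos (div_pos ?_ (pow_pos (hPpos t) 2)) hν
      exact add_pos_of_pos_of_nonneg (pow_pos (M.μ_pos _ (hPpos t).le) 2) (sq_nonneg _)
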